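/- **Setting.** Let $n>2$, $s\in(0,1)$, and let $\Omega\subset\mathbb R^n$ be a bounded domain with smooth boundary and outer unit normal $\nu$. Let $\Pi_1,\Pi_2$ be disjoint, relatively open subsets of $\mathbb R^n\setminus\Omega$ with $\overline{\Pi_1}\cup\overline{\Pi_2}=\mathbb R^n\setminus\Omega$, and put $D=\Omega\cup\Pi_2$ (an open set), $D_\Omega=\mathbb R^{2n}\setminus(\Omega^c\times\Omega^c)$, $C_{n,s}=\big(\int_{\mathbb R^n}\frac{1-\cos\zeta_1}{|\zeta|^{n+2s}}\,d\zeta\big)^{-1}$. Let $\mathcal L=-\Delta+(-\Delta)^s$, and for $x\in\Pi_2$ let $$\mathcal N_su(x)=C_{n,s}\int_\Omega\frac{u(x)-u(y)}{|x-y|^{n+2s}}\,dy .$$ The space $\mathcal X^s(D)$ is the completion of $C_c^\infty(D)$, as a space of functions in $L^{2n/(n-2)}(\mathbb R^n)$, for the norm $$\eta(u)^2=\|\nabla u\|_{L^2(\mathbb R^n)}^2+C_{n,s}\iint_{D_\Omega}\frac{|u(x)-u(y)|^2}{|x-y|^{n+2s}}\,dx\,dy .$$ Elements of $\mathcal X^s(D)$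 are represented by quasicontinuous functions (with respect to the $H^1(\mathbb R^n)$-capacity); this gives them values on $\partial\Omega$ (traces) and almost everywhere with respect to measures that do not charge sets of capacity zero. Write $$a(u,\varphi)=\int_\Omega\nabla u\cdot\nabla\varphi\,dx+\frac{C_{n,s}}2\iint_{D_\Omega}\frac{(u(x)-u(y))(\varphi(x)-\varphi(y))}{|x-y|^{n+2s}}\,dx\,dy .$$ For a finite Borel measure $\mu\ge 0$, $\mathcal Lu=\mu$ in $\Omega$ means $a(u,\varphi)=\int_\Omega\varphi\,d\mu$ for all $\varphi\in C_c^\infty(\Omega)$. The weak normal derivative $\partial_\nu u$ of such a $u$ is a $\sigma$-measurable function on $\partial\Omega\cap\overline{\Pi_2}$ ($\sigma$ the surface measure) such that, for all $\varphi\in C_c^\infty(D)$, $\varphi\,\partial_\nu u$ and $\varphi\,\mathcal N_su$ are integrable on $\partial\Omega\cap\overline{\Pi_2}$ and on $\Pi_2$, and $$a(u,\varphi)=\int_\Omega\varphi\,d\mu+\int_{\partial\Omega\cap\overline{\Pi_2}}\varphi\,\partial_\nu u\,d\sigma+\int_{\Pi_2}\varphi\,\mathcal N_su\,dx .$$ **Theorem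 (Picone-type inequality).** Let $u,v\in\mathcal X^s(D)$ with $u\ge0$, $u$ not identically zero, let $\mathcal Lu\geq 0$ be a bounded Radon measure in $\Omega$, and let $u$ have a weak normal derivative $\partial_\nu u$ on $\partial\Omega\cap\overline{\Pi_2}$. Then $$\int_{\partial\Omega\cap\overline{\Pi_2}}\frac{|v|^2}{u}\,\partial_\nu u\,d\sigma+\int_{\Pi_2}\frac{|v|^2}{u}\,\mathcal N_su\,dx+\int_\Omega\frac{|v|^2}{u}\,d(\mathcal Lu)\ \le\ \|\nabla v\|_{L^2(\mathbb R^n)}^2+\frac{C_{n,s}}2\iint_{D_\Omega}\frac{|v(x)-v(y)|^2}{|x-y|^{n+2s}}\,dx\,dy ,$$ and in particular the left-hand side is at most $\eta(v)^2$. Here $|v|^2/u\in[0,\infty]$ with $0/0=0$ and $c/0=\infty$ for $c>0$; the first two integrals are differences of the integrals of the positive and negative parts in $[0,\infty]$, and the inequality is asserted whenever no expression $\infty-\infty$ occurs on the left. -/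

import Mathlib

open MeasureTheory Filter Topology
open scoped ENNReal ContDiff

noncomputable section

namespace MixedPicone

/-- Euclidean space `ℝⁿ`. -/
abbrev E (n : ℕ) := EuclideanSpace ℝ (Fin n)

variable {n : ℕ}

/-- `∂Ω` is smooth: near each boundary point `Ω` is the sublevel set `{ρ < 0}` of a smooth
function `ρ` without critical points. -/
def HasSmoothBoundary (Ω : Set (E n)) : Prop :=
  ∀ x ∈ frontier Ω, ∃ (V : Set (E n)) (ρ : E n → ℝ), IsOpen V ∧ x ∈ V ∧
    ContDiffOn ℝ ∞ ρ V ∧ (∀ y ∈ V, fderiv ℝ ρ y ≠ 0) ∧ Ω ∩ V = {y | y ∈ V ∧ ρ y < 0}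

/-- `S` is a relatively open subset of `ℝⁿ \ Ω`. -/
def IsRelOpenOutside (Ω S : Set (E n)) : Prop :=
  ∃ O : Set (E n), IsOpen O ∧ S = O \ Ω

/-- `C_c^∞(D)`: smooth functions on `ℝⁿ` with compact support contained in `D`. -/
def IsTest (D : Set (E n)) (φ : E n → ℝ) : Prop :=
  ContDiff ℝ ∞ φ ∧ HasCompactSupport φ ∧ tsupport φ ⊆ D

/-- `G` is the weak (distributional) gradient of `u` on `ℝⁿ`. -/
def HasWeakGradient (u : E n → ℝ) (G : E n → E n) : Prop :=
  LocallyIntegrable u volume ∧ LocallyIntegrable G volume ∧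
    ∀ φ : E n → ℝ, IsTest Set.univ φ → ∀ e : E n,
      ∫ x, u x * fderiv ℝ φ x e = -∫ x, inner ℝ (G x) e * φ x

open Classical in
/-- The weak gradient `∇u` (determined almost everywhere; `0` if there is none). -/
def wgrad (u : E n → ℝ) : E n → E n :=
  if h : ∃ G, HasWeakGradient u G then h.choose else 0

/-- The normalizing constant `C_{n,s} = (∫ (1 - cos ζ₁) / |ζ|^{n+2s} dζ)⁻¹`. -/
def Cns (n : ℕ) [NeZero n] (s : ℝ) : ℝ :=
  (∫ ζ : E n, (1 - Real.cos (ζ 0)) / ‖ζ‖ ^ ((n : ℝ) + 2 * s))⁻¹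

/-- `D_Ω = ℝ²ⁿ \ (Ωᶜ × Ωᶜ)`. -/
def DOmega (Ω : Set (E n)) : Set (E n × E n) := (Ωᶜ ×ˢ Ωᶜ)ᶜ

/-- The double integral `∬_{D_Ω} |u(x) - u(y)|² / |x - y|^{n+2s} dx dy ∈ [0, ∞]`. -/
def gagliardo (s : ℝ) (Ω : Set (E n)) (u : E n → ℝ) : ℝ≥0∞ :=
  ∫⁻ p in DOmega Ω, ENNReal.ofReal ((u p.1 - u p.2) ^ 2 / ‖p.1 - p.2‖ ^ ((n : ℝ) + 2 * s))

/-- `∫_{ℝⁿ} |∇u|² dx ∈ [0, ∞]`. -/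
def gradSq (u : E n → ℝ) : ℝ≥0∞ := ∫⁻ x, ENNReal.ofReal (‖wgrad u x‖ ^ 2)

/-- `η(u)² = ‖∇u‖²_{L²(ℝⁿ)} + C_{n,s} ∬_{D_Ω} |u(x) - u(y)|² / |x - y|^{n+2s} dx dy`. -/
def etaSq [NeZero n] (s : ℝ) (Ω : Set (E n)) (u : E n → ℝ) : ℝ≥0∞ :=
  gradSq u + ENNReal.ofReal (Cns n s) * gagliardo s Ω u

/-- `⟨u, u⟩ = ‖∇u‖²_{L²(ℝⁿ)} + (C_{n,s} / 2) ∬_{D_Ω} |u(x) - u(y)|² / |x - y|^{n+2s} dx dy`,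
the square of the norm of the scalar product of `𝒳ˢ(D)`; it is at most `η(u)²`. -/
def scalarSq [NeZero n] (s : ℝ) (Ω : Set (E n)) (u : E n → ℝ) : ℝ≥0∞ :=
  gradSq u + ENNReal.ofReal (Cns n s / 2) * gagliardo s Ω u

/-- `u ∈ 𝒳ˢ(D)`, the completion of `C_c^∞(D)` with respect to `η`, realized (as the Sobolev
inequality allows for `n > 2`) as a space of functions in `L^{2*}(ℝⁿ)`, `2* = 2n/(n-2)`. -/
def MemX [NeZero n] (s : ℝ) (Ω D : Set (E n)) (u : E n → ℝ) : Prop :=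
  MemLp u (ENNReal.ofReal (2 * n / (n - 2))) volume ∧
  (∃ G, HasWeakGradient u G) ∧
  ∃ φ : ℕ → E n → ℝ, (∀ k, IsTest D (φ k)) ∧
    Tendsto (fun k => eLpNorm (φ k - u) (ENNReal.ofReal (2 * n / (n - 2))) volume) atTop (𝓝 0) ∧
    Tendsto (fun k => etaSq s Ω (φ k - u)) atTop (𝓝 0)

/-- The Sobolev capacity of `A`: the infimum of `∫ f² + |∇f|²` over all `f ∈ H¹(ℝⁿ)` with
`f ≥ 1` a.e. on a neighbourhood of `A`. -/
def sobolevCap (A : Set (E n)) : ℝ≥0∞ :=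
  ⨅ (f : E n → ℝ) (_ : MemLp f 2 volume ∧ (∃ G, HasWeakGradient f G ∧ MemLp G 2 volume) ∧
      ∃ O, IsOpen O ∧ A ⊆ O ∧ ∀ᵐ x ∂(volume.restrict O), 1 ≤ f x),
    (∫⁻ x, ENNReal.ofReal (f x ^ 2)) + gradSq f

/-- `u` is quasicontinuous: continuous off open sets of arbitrarily small capacity. Each class in
`𝒳ˢ(D)` has a quasicontinuous representative, unique up to sets of capacity zero. Its values on
`∂Ω` are the trace of `u`, and it is defined almost everywhere for each measure that does not
charge sets of capacity zero. -/
def IsQuasicontinuous (u : E n → ℝ) : Prop :=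
  ∀ ε : ℝ≥0∞, 0 < ε → ∃ O : Set (E n), IsOpen O ∧ sobolevCap O < ε ∧ ContinuousOn u Oᶜ

/-- The nonlocal normal derivative
`𝒩ₛ u(x) = C_{n,s} ∫_Ω (u(x) - u(y)) / |x - y|^{n+2s} dy`, for `x` outside `Ω`. -/
def nonlocalNormal [NeZero n] (s : ℝ) (Ω : Set (E n)) (u : E n → ℝ) (x : E n) : ℝ :=
  Cns n s * ∫ y in Ω, (u x - u y) / ‖x - y‖ ^ ((n : ℝ) + 2 * s)

/-- The bilinear form
`∫_Ω ∇u·∇φ dx + (C_{n,s} / 2) ∬_{D_Ω} (u(x) - u(y)) (φ(x) - φ(y)) / |x - y|^{n+2s} dx dy`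
for `φ` smooth. -/
def form [NeZero n] (s : ℝ) (Ω : Set (E n)) (u φ : E n → ℝ) : ℝ :=
  (∫ x in Ω, inner ℝ (wgrad u x) (gradient φ x)) +
    Cns n s / 2 * ∫ p in DOmega Ω,
      (u p.1 - u p.2) * (φ p.1 - φ p.2) / ‖p.1 - p.2‖ ^ ((n : ℝ) + 2 * s)

/-- `ℒu = -Δu + (-Δ)ˢu` is the measure `μ` in `Ω`, in the sense of distributions. -/
def OperatorEqMeasure [NeZero n] (s : ℝ) (Ω : Set (E n)) (u : E n → ℝ)
    (μ : Measure (E n)) : Prop :=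
  ∀ φ : E n → ℝ, IsTest Ω φ → form s Ω u φ = ∫ x in Ω, φ x ∂μ

/-- `∂Ω ∩ closure P₂`. -/
def neumannBdry (Ω P₂ : Set (E n)) : Set (E n) := frontier Ω ∩ closure P₂

/-- The surface measure `dσ` on `∂Ω ∩ closure P₂`. -/
def surface (Ω P₂ : Set (E n)) : Measure (E n) :=
  (Measure.euclideanHausdorffMeasure (n - 1)).restrict (neumannBdry Ω P₂)

/-- `g` is the weak outer normal derivative `∂u/∂ν` on `∂Ω ∩ closure P₂` of a function with
`ℒu = μ` in `Ω`. As usual for functions that are only weakly differentiable, it is defined by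
Green's formula
`form u φ = ∫_Ω φ dμ + ∫_{∂Ω ∩ closure P₂} φ g dσ + ∫_{P₂} φ 𝒩ₛ u dx`
for all smooth `φ` with compact support in `Ω ∪ P₂`; for `u` smooth up to the boundary of `Ω` the
formula holds with the classical `∂u/∂ν` by the divergence theorem. -/
def HasWeakNormalDeriv [NeZero n] (s : ℝ) (Ω P₂ : Set (E n)) (u : E n → ℝ)
    (μ : Measure (E n)) (g : E n → ℝ) : Prop :=
  AEStronglyMeasurable g (surface Ω P₂) ∧
  ∀ φ : E n → ℝ, IsTest (Ω ∪ P₂) φ →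
    Integrable (fun x => φ x * g x) (surface Ω P₂) ∧
    IntegrableOn (fun x => φ x * nonlocalNormal s Ω u x) P₂ volume ∧
    form s Ω u φ = (∫ x in Ω, φ x ∂μ) + (∫ x, φ x * g x ∂(surface Ω P₂)) +
      ∫ x in P₂, φ x * nonlocalNormal s Ω u x

/-- The weight `|v|² / u ∈ [0, ∞]` for `u ≥ 0`, with `0 / 0 = 0` and `a / 0 = ∞` for `a > 0`. -/
def quot (u v : E n → ℝ) (x : E n) : ℝ≥0∞ :=
  ENNReal.ofReal (v x ^ 2) / ENNReal.ofReal (u x)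

/-- The extended integral `∫ w f dm` of a weight `w ≥ 0` against a signed function `f`: the
integral of `w f⁺` minus that of `w f⁻`, each in `[0, ∞]`. -/
def extIntegral (m : Measure (E n)) (w : E n → ℝ≥0∞) (f : E n → ℝ) : EReal :=
  ((∫⁻ x, w x * ENNReal.ofReal (f x) ∂m : ℝ≥0∞) : EReal) -
    ((∫⁻ x, w x * ENNReal.ofReal (-f x) ∂m : ℝ≥0∞) : EReal)

end MixedPicone

end

open MeasureTheory Filter Topology
open scoped ENNReal ContDiff

noncomputable section

namespace MixedPicone

variable {n : ℕ}

/-! ### Convergence criteria in `L²`. -/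

section Lp

variable {α F : Type*} [MeasurableSpace α] [NormedAddCommGroup F] {ν : Measure α}

/-! At bottom the theorem is two pointwise inequalities. For `u ≥ 0` and any `w`, the form of `u`
tested with `w² / (u + ε)` is at most the energy of `w`: locally by expanding a square
(`inner_picone_le`), nonlocally by an exact identity for differences (`mul_sub_le_sq_sub`). With `w
= v`, Green's formula would turn the form into the three integrals on the left, and `ε → 0` would
finish. Two obstacles remain: `v² / (u + ε)` is not a smooth test function, and convergence in
energy says nothing, a priori, almost everywhere for `ℒu` or for surface measure.

Test functions. `picone δ ε U V φ` is built from smooth approximations `U` of `u` and `V` of `v` and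
from a separate test function `φ`. Its numerator is the square of `cut δ V φ`, which vanishes with
`φ` and is at most `2|φ|`. Hence the whole function is bounded by a multiple of `φ²`. Since `φ²` is
again a test function, the definition of the weak normal derivative makes `φ² ∂_ν u` and `φ² 𝒩ₛ u`
integrable. With `φ`, `δ`, `ε` fixed one may therefore let `U → u`, `V → v` by dominated
convergence, and the Picone inequalities are applied only in this limit, where `u ≥ 0`
(`lintegral_picone_le`). In a second limit `φ → v` and `δ = ε → 0`. Because `|cut δ v φ| ≤ |v|`, the
negative parts stay below those with weight `v² / u`; Fatou's lemma handles the positive parts; and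
bounds on `cut` uniform in `δ` show that its energy does not exceed that of `v` in the limit
(`lintegral_quot_le`).

Measures. Both limits need approximations converging almost everywhere for `μ` on `Ω` and for `σ`.
`CapControlled m` expresses that smooth functions with small `H¹` norm reach `1` only on sets of
small `m` measure. For quasicontinuous limits this upgrades energy convergence to convergence in
`m`-measure (`CapControlled.tendstoInMeasure`), and a subsequence converges almost everywhere. For
`μ` the property follows by testing the equation with a truncated, localized function
(`capControlled_of_operatorEqMeasure`). For `σ` a one-dimensional estimate along coordinate lines
bounds the projection of a superlevel set, and the boundary is locally a Lipschitz image of its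
projection (`capControlled_surface`). -/

theorem eLpNorm_two_sq (f : α → F) : eLpNorm f 2 ν ^ 2 = ∫⁻ x, ‖f x‖ₑ ^ 2 ∂ν := by
  have := eLpNorm_nnreal_pow_eq_lintegral (f := f) (μ := ν) (p := 2) (by norm_num)
  simpa using this

theorem lintegral_ofReal_norm_sq (f : α → F) :
    ∫⁻ x, ENNReal.ofReal (‖f x‖ ^ 2) ∂ν = eLpNorm f 2 ν ^ 2 := by
  rw [eLpNorm_two_sq]
  refine lintegral_congr fun x => ?_
  rw [ENNReal.ofReal_pow (norm_nonneg _), ofReal_norm]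

theorem lintegral_ofReal_sq (f : α → ℝ) :
    ∫⁻ x, ENNReal.ofReal (f x ^ 2) ∂ν = eLpNorm f 2 ν ^ 2 := by
  rw [← lintegral_ofReal_norm_sq]; simp

/-- Dominated convergence in `L²` with a majorant that is fixed up to an `L²`-null sequence. -/
theorem tendsto_eLpNorm_two_of_dominated {d : ℕ → α → F} {r : ℕ → α → ℝ} {q : α → ℝ}
    (hd : ∀ k, AEStronglyMeasurable (d k) ν) (hq : MemLp q 2 ν)
    (hr : Tendsto (fun k => eLpNorm (r k) 2 ν) atTop (𝓝 0))
    (hrm : ∀ k, AEStronglyMeasurable (r k) ν)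
    (hle : ∀ k, ∀ᵐ x ∂ν, ‖d k x‖ ≤ |r k x| + |q x|)
    (h0 : ∀ᵐ x ∂ν, Tendsto (fun k => d k x) atTop (𝓝 0)) :
    Tendsto (fun k => eLpNorm (d k) 2 ν) atTop (𝓝 0) := by
  -- Truncating at `|q|` leaves a part to which dominated convergence applies; what is cut off is at
  -- most `|r k|`.
  set e : ℕ → α → ℝ := fun k x => min ‖d k x‖ |q x| with he
  have hem : ∀ k, AEStronglyMeasurable (e k) ν := fun k =>
    (hd k).norm.inf hq.1.norm
  have h1 : Tendsto (fun k => eLpNorm (e k) 2 ν) atTop (𝓝 0) := by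
    have h2 : Tendsto (fun k => ∫⁻ x, ‖e k x‖ₑ ^ 2 ∂ν) atTop (𝓝 (∫⁻ _, 0 ∂ν)) := by
      refine tendsto_lintegral_of_dominated_convergence' (fun x => ‖q x‖ₑ ^ 2)
        (fun k => (hem k).enorm.pow_const 2) (fun k => ?_) ?_ ?_
      · refine Eventually.of_forall fun x => ?_
        have : ‖e k x‖ ≤ ‖q x‖ := by
          rw [he, Real.norm_of_nonneg (by positivity)]
          exact min_le_right _ _
        exact pow_le_pow_left' (enorm_le_iff_norm_le.2 this) 2
      · rw [← eLpNorm_two_sq]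
        exact (ENNReal.pow_lt_top hq.2).ne
      · filter_upwards [h0] with x hx
        have : Tendsto (fun k => e k x) atTop (𝓝 0) := by
          refine squeeze_zero (fun k => by positivity) (fun k => min_le_left _ _) ?_
          simpa using hx.norm
        have h3 := (ENNReal.continuous_pow 2).continuousAt.tendsto.comp this.enorm
        simpa [Function.comp_def] using h3
    simp only [lintegral_zero, ← eLpNorm_two_sq] at h2
    have h4 := (ENNReal.continuous_rpow_const (y := (1/2 : ℝ))).continuousAt.tendsto.comp h2
    refine (h4.congr fun k => ?_).trans (by simp)
    simp only [Function.comp]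
    rw [← ENNReal.rpow_natCast, ← ENNReal.rpow_mul]
    norm_num
  refine tendsto_of_tendsto_of_tendsto_of_le_of_le tendsto_const_nhds
    (by simpa using h1.add hr) (fun _ => zero_le) fun k => ?_
  calc eLpNorm (d k) 2 ν ≤ eLpNorm (fun x => e k x + ‖r k x‖) 2 ν := by
        refine eLpNorm_mono_ae ?_
        filter_upwards [hle k] with x hx
        rw [Real.norm_of_nonneg (by positivity)]
        rcases le_total ‖d k x‖ |q x| with h | h
        · simp [he, min_eq_left h]
        · simp only [he, min_eq_right h, Real.norm_eq_abs]; linarith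
    _ ≤ eLpNorm (e k) 2 ν + eLpNorm (fun x => ‖r k x‖) 2 ν :=
        eLpNorm_add_le (hem k) (hrm k).norm (by norm_num)
    _ = _ := by rw [eLpNorm_norm]

/-- Almost everywhere convergence without loss of norm is strong convergence. -/
theorem tendsto_eLpNorm_two_sub_of_le {f : ℕ → α → F} {g : α → F}
    (hf : ∀ k, AEStronglyMeasurable (f k) ν) (hg : MemLp g 2 ν)
    (hle : ∀ k, eLpNorm (f k) 2 ν ≤ eLpNorm g 2 ν)
    (h0 : ∀ᵐ x ∂ν, Tendsto (fun k => f k x) atTop (𝓝 (g x))) :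
    Tendsto (fun k => eLpNorm (f k - g) 2 ν) atTop (𝓝 0) := by
  set M : ℝ≥0∞ := ∫⁻ x, ‖g x‖ₑ ^ 2 ∂ν with hM
  have hMt : M ≠ ⊤ := by
    rw [hM, ← eLpNorm_two_sq]; exact (ENNReal.pow_lt_top hg.2).ne
  have hfM : ∀ k, ∫⁻ x, ‖f k x‖ₑ ^ 2 ∂ν ≤ M := fun k => by
    rw [hM, ← eLpNorm_two_sq, ← eLpNorm_two_sq]; gcongr; exact hle k
  have hpt : ∀ a b : F, ‖a - b‖ₑ ^ 2 ≤ 2 * ‖a‖ₑ ^ 2 + 2 * ‖b‖ₑ ^ 2 := fun a b => by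
    have h1 : ‖a - b‖ ^ 2 ≤ 2 * ‖a‖ ^ 2 + 2 * ‖b‖ ^ 2 := by
      nlinarith [norm_sub_le a b, sq_nonneg (‖a‖ - ‖b‖), norm_nonneg (a - b), norm_nonneg a,
        norm_nonneg b]
    have h2 := ENNReal.ofReal_le_ofReal h1
    rw [ENNReal.ofReal_add (by positivity) (by positivity),
      ENNReal.ofReal_mul (by norm_num), ENNReal.ofReal_mul (by norm_num),
      ENNReal.ofReal_pow (by positivity), ENNReal.ofReal_pow (by positivity),
      ENNReal.ofReal_pow (by positivity)] at h2
    simpa using h2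
  set D : ℕ → ℝ≥0∞ := fun k => ∫⁻ x, ‖f k x - g x‖ₑ ^ 2 ∂ν with hD
  have hDle : ∀ k, D k ≤ 4 * M := fun k => by
    calc D k ≤ ∫⁻ x, (2 * ‖f k x‖ₑ ^ 2 + 2 * ‖g x‖ₑ ^ 2) ∂ν := lintegral_mono fun x => hpt _ _
      _ = 2 * (∫⁻ x, ‖f k x‖ₑ ^ 2 ∂ν) + 2 * M := by
        rw [lintegral_add_left' (((hf k).enorm.pow_const 2).const_mul 2),
          lintegral_const_mul' _ _ (by simp), lintegral_const_mul' _ _ (by simp)]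
      _ ≤ 2 * M + 2 * M := by gcongr; exact hfM k
      _ = 4 * M := by ring
  have hD0 : Tendsto D atTop (𝓝 0) := by
    -- Fatou's lemma for the nonnegative functions `2|f k|² + 2|g|² - |f k - g|²`, whose pointwise
    -- limit is `4|g|²`. As `4M` is finite, `D k` cannot stay above a positive number infinitely
    -- often.
    have hfat : ∫⁻ x, 4 * ‖g x‖ₑ ^ 2 ∂ν ≤ liminf (fun k => 4 * M - D k) atTop := by
      calc ∫⁻ x, 4 * ‖g x‖ₑ ^ 2 ∂ν
          ≤ ∫⁻ x, liminf (fun k => 2 * ‖f k x‖ₑ ^ 2 + 2 * ‖g x‖ₑ ^ 2 - ‖f k x - g x‖ₑ ^ 2) atTop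
            ∂ν := by
            refine lintegral_mono_ae ?_
            filter_upwards [h0] with x hx
            have h1 : Tendsto (fun k => ‖f k x‖ₑ ^ 2) atTop (𝓝 (‖g x‖ₑ ^ 2)) :=
              ((ENNReal.continuous_pow 2).tendsto _).comp hx.enorm
            have h2 : Tendsto (fun k => ‖f k x - g x‖ₑ ^ 2) atTop (𝓝 0) := by
              have := ((ENNReal.continuous_pow 2).tendsto _).comp (hx.sub_const (g x)).enorm
              simpa [Function.comp_def] using this
            have h3 : Tendsto (fun k => 2 * ‖f k x‖ₑ ^ 2 + 2 * ‖g x‖ₑ ^ 2 - ‖f k x - g x‖ₑ ^ 2)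
                atTop (𝓝 (2 * ‖g x‖ₑ ^ 2 + 2 * ‖g x‖ₑ ^ 2 - 0)) := by
              refine ENNReal.Tendsto.sub ((ENNReal.Tendsto.const_mul h1 (by simp)).add_const _) h2
                (Or.inr (by simp))
            rw [h3.liminf_eq]
            simp only [tsub_zero]
            rw [← add_mul]; norm_num
        _ ≤ liminf (fun k => ∫⁻ x, (2 * ‖f k x‖ₑ ^ 2 + 2 * ‖g x‖ₑ ^ 2 - ‖f k x - g x‖ₑ ^ 2) ∂ν)
            atTop := by
            refine lintegral_liminf_le' fun k => ?_
            exact ((((hf k).enorm.pow_const 2).const_mul 2).add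
              ((hg.1.enorm.pow_const 2).const_mul 2)).sub (((hf k).sub hg.1).enorm.pow_const 2)
        _ ≤ liminf (fun k => 4 * M - D k) atTop := by
            refine liminf_le_liminf (Eventually.of_forall fun k => ?_)
            have hms : AEMeasurable (fun x => ‖f k x - g x‖ₑ ^ 2) ν :=
              ((hf k).sub hg.1).enorm.pow_const 2
            rw [lintegral_sub' hms
              ((hDle k).trans_lt (ENNReal.mul_lt_top (by simp) hMt.lt_top)).ne
              (Eventually.of_forall fun x => hpt _ _)]
            refine tsub_le_tsub_right ?_ _
            rw [lintegral_add_left' (((hf k).enorm.pow_const 2).const_mul 2),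
              lintegral_const_mul' _ _ (by simp), lintegral_const_mul' _ _ (by simp)]
            calc _ ≤ 2 * M + 2 * M := by gcongr; exact hfM k
              _ = 4 * M := by ring
    rw [lintegral_const_mul' _ _ (by simp)] at hfat
    change 4 * M ≤ _ at hfat
    have h4M : 4 * M ≠ ⊤ := ENNReal.mul_ne_top (by simp) hMt
    rw [ENNReal.tendsto_nhds_zero]
    intro ε hε
    by_contra hcon
    rw [not_eventually] at hcon
    have hfr : ∃ᶠ k in atTop, 4 * M - D k ≤ 4 * M - ε := hcon.mono fun k hk =>
      tsub_le_tsub_left (not_le.1 hk).le _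
    have h5 : 4 * M ≤ 4 * M - ε := hfat.trans (liminf_le_of_frequently_le' hfr)
    have hεM : ε ≤ 4 * M := by
      obtain ⟨k, hk⟩ := hcon.exists
      exact (not_le.1 hk).le.trans (hDle k)
    have h6 : 4 * M - ε < 4 * M := ENNReal.sub_lt_self h4M (hε.trans_le hεM).ne' hε.ne'
    exact absurd h5 (not_le.2 h6)
  have h4 := (ENNReal.continuous_rpow_const (y := (1/2 : ℝ))).continuousAt.tendsto.comp hD0
  refine (h4.congr fun k => ?_).trans (by simp)
  simp only [Function.comp, hD]
  have : ∫⁻ x, ‖f k x - g x‖ₑ ^ 2 ∂ν = eLpNorm (f k - g) 2 ν ^ 2 := by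
    rw [eLpNorm_two_sq]; rfl
  rw [this, ← ENNReal.rpow_natCast, ← ENNReal.rpow_mul]
  norm_num

end Lp

section Inner

variable {α F : Type*} [MeasurableSpace α] [NormedAddCommGroup F] [InnerProductSpace ℝ F]
  {ν : Measure α}

theorem eLpNorm_one_inner_le {f g : α → F} (hf : AEStronglyMeasurable f ν)
    (hg : AEStronglyMeasurable g ν) :
    eLpNorm (fun x => inner ℝ (f x) (g x)) 1 ν ≤ eLpNorm f 2 ν * eLpNorm g 2 ν := by
  have := eLpNorm_le_eLpNorm_mul_eLpNorm'_of_norm (p := 2) (q := 2) (r := 1) hf hg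
    (fun a b => inner ℝ a b) 1 (Eventually.of_forall fun x => by
      simpa using norm_inner_le_norm (𝕜 := ℝ) (f x) (g x))
  simpa using this

theorem integrable_inner_of_memLp_two {f g : α → F} (hf : MemLp f 2 ν) (hg : MemLp g 2 ν) :
    Integrable (fun x => (inner ℝ (f x) (g x) : ℝ)) ν := by
  rw [← memLp_one_iff_integrable]
  exact ⟨hf.1.inner hg.1, (eLpNorm_one_inner_le hf.1 hg.1).trans_lt
    (ENNReal.mul_lt_top hf.2 hg.2)⟩

theorem tendsto_integral_inner {f : α → F} {g : ℕ → α → F} {g' : α → F} (hf : MemLp f 2 ν)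
    (hg : ∀ k, MemLp (g k) 2 ν) (hg' : MemLp g' 2 ν)
    (h : Tendsto (fun k => eLpNorm (g k - g') 2 ν) atTop (𝓝 0)) :
    Tendsto (fun k => ∫ x, (inner ℝ (f x) (g k x) : ℝ) ∂ν) atTop
      (𝓝 (∫ x, (inner ℝ (f x) (g' x) : ℝ) ∂ν)) := by
  refine tendsto_integral_of_L1' _ (hf.1.inner hg'.1)
    (Eventually.of_forall fun k => integrable_inner_of_memLp_two hf (hg k)) ?_
  have h1 : Tendsto (fun k => eLpNorm f 2 ν * eLpNorm (g k - g') 2 ν) atTop (𝓝 0) := by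
    simpa using ENNReal.Tendsto.const_mul h (Or.inr hf.2.ne)
  refine tendsto_of_tendsto_of_tendsto_of_le_of_le tendsto_const_nhds h1 (fun _ => zero_le)
    fun k => ?_
  refine le_trans (le_of_eq ?_) (eLpNorm_one_inner_le hf.1 ((hg k).sub hg').1)
  congr 1
  ext x
  simp [inner_sub_right]

end Inner

/-! ### Calculus of test functions and weak gradients. -/

theorem IsTest.continuous {D : Set (E n)} {φ : E n → ℝ} (h : IsTest D φ) : Continuous φ :=
  h.1.continuous

theorem IsTest.mono {D D' : Set (E n)} {φ : E n → ℝ} (h : IsTest D φ) (hD : D ⊆ D') :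
    IsTest D' φ := ⟨h.1, h.2.1, h.2.2.trans hD⟩

theorem continuous_gradient {φ : E n → ℝ} (h : ContDiff ℝ ∞ φ) : Continuous (gradient φ) := by
  have h1 : Continuous (fderiv ℝ φ) := h.continuous_fderiv (by simp)
  exact (InnerProductSpace.toDual ℝ (E n)).symm.continuous.comp h1

theorem gradient_eq_zero_of_notMem_tsupport {φ : E n → ℝ} {x : E n} (hx : x ∉ tsupport φ) :
    gradient φ x = 0 := by
  have h1 : fderiv ℝ φ x = 0 := by
    by_contra h
    exact hx (support_fderiv_subset ℝ h)
  simp [gradient, h1]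

theorem hasCompactSupport_gradient {φ : E n → ℝ} (h : HasCompactSupport φ) :
    HasCompactSupport (gradient φ) :=
  HasCompactSupport.intro h fun _ hx => gradient_eq_zero_of_notMem_tsupport hx

theorem IsTest.memLp {D : Set (E n)} {φ : E n → ℝ} (h : IsTest D φ) (p : ℝ≥0∞) :
    MemLp φ p volume := h.continuous.memLp_of_hasCompactSupport h.2.1

theorem IsTest.memLp_gradient {D : Set (E n)} {φ : E n → ℝ} (h : IsTest D φ) (p : ℝ≥0∞) :
    MemLp (gradient φ) p volume :=
  (continuous_gradient h.1).memLp_of_hasCompactSupport (hasCompactSupport_gradient h.2.1)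

theorem hasCompactSupport_fderiv_apply {φ : E n → ℝ} (h : HasCompactSupport φ) (e : E n) :
    HasCompactSupport (fun x => fderiv ℝ φ x e) := h.fderiv_apply ℝ e

theorem continuous_fderiv_apply' {φ : E n → ℝ} (h : ContDiff ℝ ∞ φ) (e : E n) :
    Continuous (fun x => fderiv ℝ φ x e) :=
  (h.continuous_fderiv (by simp)).clm_apply continuous_const

/-- Weak gradients are determined almost everywhere. -/
theorem HasWeakGradient.ae_eq {u u' : E n → ℝ} {G G' : E n → E n} (h : HasWeakGradient u G)
    (h' : HasWeakGradient u' G') (huu : u =ᵐ[volume] u') : G =ᵐ[volume] G' := by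
  refine ae_eq_of_integral_contDiff_smul_eq h.2.1 h'.2.1 fun φ hφ hφc => ?_
  have ht : IsTest Set.univ φ := ⟨hφ, hφc, Set.subset_univ _⟩
  have key : ∀ (w : E n → ℝ) (H : E n → E n), HasWeakGradient w H → ∀ e : E n,
      inner ℝ (∫ x, φ x • H x) e = -∫ x, w x * fderiv ℝ φ x e := by
    intro w H hH e
    rw [hH.2.2 φ ht e, neg_neg, real_inner_comm, ← integral_inner
      (hH.2.1.integrable_smul_left_of_hasCompactSupport hφ.continuous hφc)]
    refine integral_congr_ae (Eventually.of_forall fun x => ?_)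
    simp only [inner_smul_right]
    rw [real_inner_comm, mul_comm]
  refine ext_inner_right ℝ fun e => ?_
  rw [key u G h e, key u' G' h' e]
  congr 1
  refine integral_congr_ae ?_
  filter_upwards [huu] with x hx
  rw [hx]

theorem hasWeakGradient_wgrad {u : E n → ℝ} (h : ∃ G, HasWeakGradient u G) :
    HasWeakGradient u (wgrad u) := by
  rw [wgrad, dif_pos h]; exact h.choose_spec

theorem HasWeakGradient.wgrad_ae_eq {u : E n → ℝ} {G : E n → E n} (h : HasWeakGradient u G) :
    wgrad u =ᵐ[volume] G :=
  (hasWeakGradient_wgrad ⟨G, h⟩).ae_eq h (ae_eq_refl _)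

theorem hasWeakGradient_gradient {φ : E n → ℝ} (h : ContDiff ℝ ∞ φ) :
    HasWeakGradient φ (gradient φ) := by
  refine ⟨h.continuous.locallyIntegrable, (continuous_gradient h).locallyIntegrable,
    fun ψ hψ e => ?_⟩
  have hd : Differentiable ℝ φ := h.differentiable (by simp)
  have hd' : Differentiable ℝ ψ := hψ.1.differentiable (by simp)
  rw [integral_mul_fderiv_eq_neg_fderiv_mul_of_integrable]
  · simp only [inner_gradient_left]
  · exact ((continuous_fderiv_apply' h e).mul hψ.continuous).integrable_of_hasCompactSupport
      hψ.2.1.mul_left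
  · exact (h.continuous.mul (continuous_fderiv_apply' hψ.1 e)).integrable_of_hasCompactSupport
      (hasCompactSupport_fderiv_apply hψ.2.1 e).mul_left
  · exact (h.continuous.mul hψ.continuous).integrable_of_hasCompactSupport hψ.2.1.mul_left
  · exact fun x _ => hd x
  · exact fun x _ => hd' x

theorem integrable_mul_fderiv {u : E n → ℝ} (hu : LocallyIntegrable u volume) {φ : E n → ℝ}
    (hφ : IsTest Set.univ φ) (e : E n) : Integrable (fun x => u x * fderiv ℝ φ x e) :=
  hu.integrable_smul_right_of_hasCompactSupport (continuous_fderiv_apply' hφ.1 e)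
    (hasCompactSupport_fderiv_apply hφ.2.1 e)

theorem integrable_inner_mul {G : E n → E n} (hG : LocallyIntegrable G volume) {φ : E n → ℝ}
    (hφ : IsTest Set.univ φ) (e : E n) : Integrable (fun x => inner ℝ (G x) e * φ x) := by
  have h1 := (hG.integrable_smul_left_of_hasCompactSupport hφ.continuous hφ.2.1).inner_const
    (𝕜 := ℝ) e
  refine h1.congr (Eventually.of_forall fun x => ?_)
  simp [inner_smul_left, mul_comm]

theorem HasWeakGradient.sub {u v : E n → ℝ} {G H : E n → E n} (hu : HasWeakGradient u G)
    (hv : HasWeakGradient v H) : HasWeakGradient (u - v) (G - H) := by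
  refine ⟨hu.1.sub hv.1, hu.2.1.sub hv.2.1, fun φ hφ e => ?_⟩
  simp only [Pi.sub_apply, sub_mul, inner_sub_left]
  rw [integral_sub (integrable_mul_fderiv hu.1 hφ e) (integrable_mul_fderiv hv.1 hφ e),
    integral_sub (integrable_inner_mul hu.2.1 hφ e) (integrable_inner_mul hv.2.1 hφ e),
    hu.2.2 φ hφ e, hv.2.2 φ hφ e]
  ring

theorem HasWeakGradient.add {u v : E n → ℝ} {G H : E n → E n} (hu : HasWeakGradient u G)
    (hv : HasWeakGradient v H) : HasWeakGradient (u + v) (G + H) := by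
  refine ⟨hu.1.add hv.1, hu.2.1.add hv.2.1, fun φ hφ e => ?_⟩
  simp only [Pi.add_apply, add_mul, inner_add_left]
  rw [integral_add (integrable_mul_fderiv hu.1 hφ e) (integrable_mul_fderiv hv.1 hφ e),
    integral_add (integrable_inner_mul hu.2.1 hφ e) (integrable_inner_mul hv.2.1 hφ e),
    hu.2.2 φ hφ e, hv.2.2 φ hφ e]
  ring

theorem IsTest.mul_left {D : Set (E n)} {φ χ : E n → ℝ} (hχ : ContDiff ℝ ∞ χ) (hφ : IsTest D φ) :
    IsTest D (fun x => χ x * φ x) :=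
  ⟨hχ.mul hφ.1, hφ.2.1.mul_left, (tsupport_mul_subset_right (f := χ) (g := φ)).trans hφ.2.2⟩

/-- The product rule for a smooth and a weakly differentiable function. -/
theorem HasWeakGradient.smooth_mul {u : E n → ℝ} {G : E n → E n} (hu : HasWeakGradient u G)
    {χ : E n → ℝ} (hχ : ContDiff ℝ ∞ χ) :
    HasWeakGradient (fun x => χ x * u x) (fun x => χ x • G x + u x • gradient χ x) := by
  have hl : ∀ {F : Type} [NormedAddCommGroup F] [NormedSpace ℝ F] {w : E n → F}
      (_ : LocallyIntegrable w volume), LocallyIntegrable (fun x => χ x • w x) volume := by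
    intro F _ _ w hw
    rw [locallyIntegrable_iff]
    exact fun K hK => (hw.integrableOn_isCompact hK).continuousOn_smul
      hχ.continuous.continuousOn hK
  have hr : LocallyIntegrable (fun x => u x • gradient χ x) volume := by
    rw [locallyIntegrable_iff]
    exact fun K hK => (hu.1.integrableOn_isCompact hK).smul_continuousOn
      (continuous_gradient hχ).continuousOn hK
  refine ⟨hl hu.1, (hl hu.2.1).add hr, fun φ hφ e => ?_⟩
  have hd : Differentiable ℝ χ := hχ.differentiable (by simp)
  have hd' : Differentiable ℝ φ := hφ.1.differentiable (by simp)
  have h1 := hu.2.2 _ (hφ.mul_left hχ) e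
  have h2 : ∀ x, fderiv ℝ (fun x => χ x * φ x) x e
      = χ x * fderiv ℝ φ x e + fderiv ℝ χ x e * φ x := fun x => by
    rw [fderiv_fun_mul (hd x) (hd' x)]
    simp [mul_comm]
  simp only [h2, mul_add] at h1
  have i1 : Integrable (fun x => u x * (χ x * fderiv ℝ φ x e)) := by
    refine (integrable_mul_fderiv (hl hu.1) hφ e).congr (Eventually.of_forall fun x => ?_)
    simp only [smul_eq_mul]; ring
  have i2 : Integrable (fun x => u x * (fderiv ℝ χ x e * φ x)) := by
    refine (integrable_inner_mul hr hφ e).congr (Eventually.of_forall fun x => ?_)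
    simp only [inner_smul_left, inner_gradient_left]
    simp; ring
  have i3 := integrable_inner_mul (hl hu.2.1) hφ e
  have i4 := integrable_inner_mul hr hφ e
  rw [integral_add i1 i2] at h1
  simp only [inner_add_left, add_mul]
  rw [integral_add i3 i4]
  have e1 : ∫ x, χ x * u x * fderiv ℝ φ x e = ∫ x, u x * (χ x * fderiv ℝ φ x e) :=
    integral_congr_ae (Eventually.of_forall fun x => by ring)
  have e2 : ∫ x, inner ℝ (u x • gradient χ x) e * φ x = ∫ x, u x * (fderiv ℝ χ x e * φ x) :=
    integral_congr_ae (Eventually.of_forall fun x => by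
      simp only [inner_smul_left, inner_gradient_left]; simp; ring)
  have e3 : ∫ x, inner ℝ (χ x • G x) e * φ x = ∫ x, inner ℝ (G x) e * (χ x * φ x) :=
    integral_congr_ae (Eventually.of_forall fun x => by
      simp only [inner_smul_left]; simp; ring)
  rw [e1, e2, e3]
  linarith

/-! ### Mollification. -/

section Mollifier

open scoped Convolution

variable {F : Type*} [NormedAddCommGroup F] [NormedSpace ℝ F]

/-- A bump function supported in the ball of radius `1 / (k + 1)`. -/
def bump (n k : ℕ) : ContDiffBump (0 : E n) where
  rIn := 1 / (2 * (k + 1))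
  rOut := 1 / (k + 1)
  rIn_pos := by positivity
  rIn_lt_rOut := by
    have : (0 : ℝ) < k + 1 := by positivity
    exact one_div_lt_one_div_of_lt this (by linarith)

/-- The mollifier: a probability density supported in the ball of radius `1 / (k + 1)`. -/
def rho (n k : ℕ) : E n → ℝ := (bump n k).normed volume

/-- The mollification of a function at scale `1 / (k + 1)`. -/
def moll (k : ℕ) (f : E n → F) : E n → F :=
  rho n k ⋆[ContinuousLinearMap.lsmul ℝ ℝ, volume] f

theorem rho_nonneg (k : ℕ) (x : E n) : 0 ≤ rho n k x := (bump n k).nonneg_normed x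

theorem rho_contDiff (k : ℕ) : ContDiff ℝ ∞ (rho n k) := (bump n k).contDiff_normed (n := ⊤)

theorem rho_hasCompactSupport (k : ℕ) : HasCompactSupport (rho n k) :=
  (bump n k).hasCompactSupport_normed

theorem integral_rho (k : ℕ) : ∫ x, rho n k x = 1 := (bump n k).integral_normed

theorem integrable_rho (k : ℕ) : Integrable (rho n k) := (bump n k).integrable_normed

theorem lintegral_rho (k : ℕ) : ∫⁻ x, ENNReal.ofReal (rho n k x) = 1 := by
  rw [← ofReal_integral_eq_lintegral_ofReal (integrable_rho k)
    (Eventually.of_forall (rho_nonneg k)), integral_rho, ENNReal.ofReal_one]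

theorem moll_apply (k : ℕ) (f : E n → F) (x : E n) :
    moll k f x = ∫ t, rho n k (x - t) • f t := by
  rw [moll, convolution_lsmul_swap]

theorem moll_apply' (k : ℕ) (f : E n → F) (x : E n) :
    moll k f x = ∫ t, rho n k t • f (x - t) := rfl

theorem moll_contDiff [CompleteSpace F] (k : ℕ) {f : E n → F} (hf : LocallyIntegrable f volume) :
    ContDiff ℝ ∞ (moll k f) :=
  (rho_hasCompactSupport k).contDiff_convolution_left (n := ⊤) _ (rho_contDiff k) hf

theorem isTest_rho_sub (k : ℕ) (x : E n) : IsTest Set.univ (fun t => rho n k (x - t)) := by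
  refine ⟨(rho_contDiff k).comp (contDiff_const.sub contDiff_id), ?_, Set.subset_univ _⟩
  exact (rho_hasCompactSupport k).comp_homeomorph (Homeomorph.subLeft x)

/-- Mollification commutes with weak differentiation. -/
theorem gradient_moll (k : ℕ) {f : E n → ℝ} {G : E n → E n} (h : HasWeakGradient f G) (x : E n) :
    gradient (moll k f) x = moll k G x := by
  refine ext_inner_right ℝ fun e => ?_
  rw [inner_gradient_left]
  have h1 : HasFDerivAt (moll k f) _ x :=
    (rho_hasCompactSupport k).hasFDerivAt_convolution_left (ContinuousLinearMap.lsmul ℝ ℝ)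
    ((rho_contDiff k).of_le (by simp)) h.1 x
  have hint : Integrable (fun t => rho n k (x - t) • G t) :=
    h.2.1.integrable_smul_left_of_hasCompactSupport (isTest_rho_sub k x).continuous
      (isTest_rho_sub k x).2.1
  have hr : inner ℝ (moll k G x) e = ∫ t, inner ℝ (G t) e * rho n k (x - t) := by
    rw [moll_apply, real_inner_comm, ← integral_inner hint]
    refine integral_congr_ae (Eventually.of_forall fun t => ?_)
    simp only [inner_smul_right]
    rw [real_inner_comm, mul_comm]
  rw [hr]
  have h2 := h.2.2 _ (isTest_rho_sub k x) e
  -- The sign produced by the reflection `t ↦ x - t` cancels the one in the definition of the weak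
  -- gradient.
  have h3 : ∀ t, fderiv ℝ (fun t => rho n k (x - t)) t e = - fderiv ℝ (rho n k) (x - t) e := by
    intro t
    have hd : HasFDerivAt (rho n k) (fderiv ℝ (rho n k) (x - t)) (x - t) :=
      ((rho_contDiff k).differentiable (by simp) _).hasFDerivAt
    have := hd.comp t ((hasFDerivAt_const x t).sub (hasFDerivAt_id t))
    have h4 := this.fderiv
    simp only [Function.comp_def] at h4
    erw [h4]
    simp
  simp only [h3, mul_neg, integral_neg, neg_inj] at h2
  rw [h1.fderiv, ← h2, convolution_eq_swap]
  have hint2 : Integrable (fun t => f t • fderiv ℝ (rho n k) (x - t)) := by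
    refine h.1.integrable_smul_right_of_hasCompactSupport ?_ ?_
    · exact ((rho_contDiff k).continuous_fderiv (by simp)).comp (continuous_const.sub continuous_id)
    · exact ((rho_hasCompactSupport k).fderiv ℝ).comp_homeomorph (Homeomorph.subLeft x)
  rw [ContinuousLinearMap.integral_apply]
  · refine integral_congr_ae (Eventually.of_forall fun t => ?_)
    simp [ContinuousLinearMap.precompL, mul_comm]
  · refine hint2.congr (Eventually.of_forall fun t => ?_)
    ext e
    simp [ContinuousLinearMap.precompL, mul_comm]

theorem tendsto_moll_ae [CompleteSpace F] {f : E n → F} (hf : LocallyIntegrable f volume) :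
    ∀ᵐ x, Tendsto (fun k => moll k f x) atTop (𝓝 (f x)) := by
  refine ContDiffBump.ae_convolution_tendsto_right_of_locallyIntegrable (K := 2) (φ := bump n)
    ?_ (Eventually.of_forall fun k => ?_) hf
  · exact tendsto_one_div_add_atTop_nhds_zero_nat
  -- The ratio of outer to inner radius must stay bounded for Lebesgue differentiation; here it is
  -- always `2`.
  · change 1 / ((k : ℝ) + 1) ≤ 2 * (1 / (2 * (k + 1)))
    have : (k : ℝ) + 1 ≠ 0 := by positivity
    exact le_of_eq (by field_simp)

/-- Jensen's inequality for the probability measure with density `rho n k`, in the form of the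
comparison of `L¹` and `L²` norms, followed by Tonelli and translation invariance. -/
theorem eLpNorm_moll_le (k : ℕ) {f : E n → F} (hf : AEStronglyMeasurable f volume) :
    eLpNorm (moll k f) 2 volume ≤ eLpNorm f 2 volume := by
  have hsq : eLpNorm (moll k f) 2 volume ^ 2 ≤ eLpNorm f 2 volume ^ 2 := by
    rw [eLpNorm_two_sq, eLpNorm_two_sq]
    have hrm : Measurable fun t => ENNReal.ofReal (rho n k t) :=
      (rho_contDiff k).continuous.measurable.ennreal_ofReal
    set ν : Measure (E n) := volume.withDensity fun t => ENNReal.ofReal (rho n k t) with hν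
    have hprob : IsProbabilityMeasure ν := ⟨by
      rw [hν, withDensity_apply _ MeasurableSet.univ, Measure.restrict_univ, lintegral_rho]⟩
    have hpt : ∀ x, ‖moll k f x‖ₑ ^ 2 ≤ ∫⁻ t, ENNReal.ofReal (rho n k t) * ‖f (x - t)‖ₑ ^ 2 := by
      intro x
      have hfm : AEStronglyMeasurable (fun t => f (x - t)) volume :=
        hf.comp_quasiMeasurePreserving (quasiMeasurePreserving_sub_left volume x)
      have hfν : AEStronglyMeasurable (fun t => f (x - t)) ν :=
        hfm.mono_ac (withDensity_absolutelyContinuous _ _)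
      have h1 : ‖moll k f x‖ₑ ≤ ∫⁻ t, ‖f (x - t)‖ₑ ∂ν := by
        rw [moll_apply', hν, lintegral_withDensity_eq_lintegral_mul₀ hrm.aemeasurable hfm.enorm]
        refine (enorm_integral_le_lintegral_enorm _).trans (le_of_eq (lintegral_congr fun t => ?_))
        rw [enorm_smul, Real.enorm_of_nonneg (rho_nonneg k t)]
        rfl
      have h2 : eLpNorm (fun t => f (x - t)) 1 ν ≤ eLpNorm (fun t => f (x - t)) 2 ν :=
        eLpNorm_le_eLpNorm_of_exponent_le (by norm_num) hfν
      rw [eLpNorm_one_eq_lintegral_enorm] at h2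
      calc ‖moll k f x‖ₑ ^ 2 ≤ eLpNorm (fun t => f (x - t)) 2 ν ^ 2 :=
            pow_le_pow_left' (h1.trans h2) 2
        _ = _ := by
            rw [eLpNorm_two_sq, hν, lintegral_withDensity_eq_lintegral_mul₀ hrm.aemeasurable
              (hfm.enorm.pow_const 2)]
            rfl
    have hmeas : AEMeasurable (Function.uncurry fun x t : E n =>
        ENNReal.ofReal (rho n k t) * ‖f (x - t)‖ₑ ^ 2) (volume.prod volume) := by
      refine AEMeasurable.mul (hrm.comp measurable_snd).aemeasurable ?_
      have : AEStronglyMeasurable (fun p : E n × E n => f (p.1 - p.2)) (volume.prod volume) :=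
        hf.comp_quasiMeasurePreserving (quasiMeasurePreserving_sub volume volume)
      exact this.enorm.pow_const 2
    calc ∫⁻ x, ‖moll k f x‖ₑ ^ 2
        ≤ ∫⁻ x, ∫⁻ t, ENNReal.ofReal (rho n k t) * ‖f (x - t)‖ₑ ^ 2 := lintegral_mono hpt
      _ = ∫⁻ t, ∫⁻ x, ENNReal.ofReal (rho n k t) * ‖f (x - t)‖ₑ ^ 2 :=
          lintegral_lintegral_swap hmeas
      _ = ∫⁻ t, ENNReal.ofReal (rho n k t) * ∫⁻ x, ‖f x‖ₑ ^ 2 := by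
          refine lintegral_congr fun t => ?_
          rw [lintegral_const_mul' _ _ ENNReal.ofReal_ne_top,
            lintegral_sub_right_eq_self (fun x => ‖f x‖ₑ ^ 2) t]
      _ = ∫⁻ x, ‖f x‖ₑ ^ 2 := by
          rw [lintegral_mul_const _ hrm, lintegral_rho, one_mul]
  by_contra hlt
  exact absurd hsq (not_le.2 (ENNReal.pow_lt_pow_left two_ne_zero (not_le.1 hlt)))

/-- Convergence at almost every point together with contractivity excludes any loss of norm, so no
density argument is needed. -/
theorem tendsto_eLpNorm_moll_sub [CompleteSpace F] {f : E n → F} (hf : MemLp f 2 volume) :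
    Tendsto (fun k => eLpNorm (moll k f - f) 2 volume) atTop (𝓝 0) :=
  have hl := hf.locallyIntegrable (by norm_num)
  tendsto_eLpNorm_two_sub_of_le (fun k => (moll_contDiff k hl).continuous.aestronglyMeasurable) hf
    (fun k => eLpNorm_moll_le k hf.1) (tendsto_moll_ae hl)

/-- Mollification preserves lower bounds, up to the mollification radius. -/
theorem le_moll (k : ℕ) {f : E n → ℝ} (hf : LocallyIntegrable f volume) {x : E n} {c : ℝ}
    (h : ∀ᵐ t, t ∈ Metric.ball x (1 / (k + 1)) → c ≤ f t) : c ≤ moll k f x := by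
  have h1 : ∫ t, rho n k (x - t) = 1 := by
    rw [integral_sub_left_eq_self (rho n k) volume x, integral_rho]
  rw [moll_apply, ← mul_one c, ← h1, ← integral_const_mul]
  refine integral_mono_ae (((integrable_rho k).comp_sub_left x).const_mul c)
    (hf.integrable_smul_left_of_hasCompactSupport (isTest_rho_sub k x).continuous
      (isTest_rho_sub k x).2.1) ?_
  filter_upwards [h] with t ht
  simp only [smul_eq_mul]
  by_cases hb : t ∈ Metric.ball x (1 / (k + 1))
  · rw [mul_comm]
    exact mul_le_mul_of_nonneg_left (ht hb) (rho_nonneg k _)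
  · have : rho n k (x - t) = 0 := by
      have hs : x - t ∉ Function.support (rho n k) := by
        rw [rho, ContDiffBump.support_normed_eq]
        simpa [bump, dist_eq_norm, norm_sub_rev] using hb
      simpa using hs
    simp [this]

end Mollifier

/-! ### Closedness and chain rule for weak gradients. -/

/-- Weak gradients pass to limits in `L²`. -/
theorem HasWeakGradient.of_tendsto {f : ℕ → E n → ℝ} {G : ℕ → E n → E n} {g : E n → ℝ}
    {H : E n → E n} (h : ∀ k, HasWeakGradient (f k) (G k)) (hf : ∀ k, MemLp (f k) 2 volume)
    (hG : ∀ k, MemLp (G k) 2 volume) (hg : MemLp g 2 volume) (hH : MemLp H 2 volume)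
    (h1 : Tendsto (fun k => eLpNorm (f k - g) 2 volume) atTop (𝓝 0))
    (h2 : Tendsto (fun k => eLpNorm (G k - H) 2 volume) atTop (𝓝 0)) : HasWeakGradient g H := by
  refine ⟨hg.locallyIntegrable (by norm_num), hH.locallyIntegrable (by norm_num),
    fun φ hφ e => ?_⟩
  have m1 : MemLp (fun x => fderiv ℝ φ x e) 2 volume :=
    (continuous_fderiv_apply' hφ.1 e).memLp_of_hasCompactSupport
      (hasCompactSupport_fderiv_apply hφ.2.1 e)
  have m2 : MemLp (fun x => φ x • e) 2 volume :=
    (hφ.continuous.smul continuous_const).memLp_of_hasCompactSupport hφ.2.1.smul_right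
  have t1 := tendsto_integral_inner m1 hf hg h1
  have t2 := tendsto_integral_inner m2 hG hH h2
  have t3 : Tendsto (fun k => -∫ x, inner ℝ (φ x • e) (G k x)) atTop
      (𝓝 (∫ x, inner ℝ (fderiv ℝ φ x e) (g x))) := by
    refine t1.congr fun k => ?_
    simp only [inner_smul_left, RCLike.inner_apply, conj_trivial]
    rw [(h k).2.2 φ hφ e]
    congr 1
    exact integral_congr_ae (Eventually.of_forall fun x => by
      simp only; rw [real_inner_comm, mul_comm])
  have := tendsto_nhds_unique t3 t2.neg
  simp only [inner_smul_left, RCLike.inner_apply, conj_trivial] at this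
  rw [this]
  congr 1
  exact integral_congr_ae (Eventually.of_forall fun x => by
    simp only; rw [real_inner_comm, mul_comm])

theorem gradient_comp {S : ℝ → ℝ} {f : E n → ℝ} {x : E n} {S' : ℝ} (hS : HasDerivAt S S' (f x))
    (hf : DifferentiableAt ℝ f x) : gradient (fun y => S (f y)) x = S' • gradient f x := by
  have h := hS.comp_hasFDerivAt x hf.hasFDerivAt
  refine ext_inner_right ℝ fun e => ?_
  rw [inner_gradient_left, inner_smul_left, inner_gradient_left]
  have h2 := h.fderiv
  simp only [Function.comp_def] at h2
  rw [h2]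
  simp

/-- The chain rule for weakly differentiable functions in `H¹`. -/
theorem HasWeakGradient.comp {f : E n → ℝ} {G : E n → E n} (h : HasWeakGradient f G)
    (hf : MemLp f 2 volume) (hG : MemLp G 2 volume) {S : ℝ → ℝ} (hS : ContDiff ℝ ∞ S)
    (hS0 : S 0 = 0) {L : ℝ} (hL : ∀ t, |deriv S t| ≤ L) :
    HasWeakGradient (fun x => S (f x)) (fun x => deriv S (f x) • G x) := by
  have hL0 : 0 ≤ L := (abs_nonneg _).trans (hL 0)
  have hSd : Differentiable ℝ S := hS.differentiable (by simp)
  have hS' : Continuous (deriv S) := hS.continuous_deriv (by simp)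
  have hlip : ∀ a b, |S a - S b| ≤ L * |a - b| := fun a b => by
    have := convex_univ.norm_image_sub_le_of_norm_deriv_le (f := S) (C := L) (x := b) (y := a)
      (fun x _ => hSd x) (fun x _ => hL x) (Set.mem_univ _) (Set.mem_univ _)
    simpa using this
  have hc : ∀ k, Continuous (moll k f) := fun k => (moll_contDiff k h.1).continuous
  have hcG : ∀ k, Continuous (moll k G) := fun k => (moll_contDiff k h.2.1).continuous
  have hmf : ∀ k, MemLp (moll k f) 2 volume := fun k =>
    ⟨(hc k).aestronglyMeasurable, (eLpNorm_moll_le k hf.1).trans_lt hf.2⟩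
  have hmG : ∀ k, MemLp (moll k G) 2 volume := fun k =>
    ⟨(hcG k).aestronglyMeasurable, (eLpNorm_moll_le k hG.1).trans_lt hG.2⟩
  have memS : ∀ w : E n → ℝ, MemLp w 2 volume → MemLp (fun x => S (w x)) 2 volume := fun w hw =>
    MemLp.of_le_mul (c := L) hw (hS.continuous.comp_aestronglyMeasurable hw.1)
      (Eventually.of_forall fun x => by simpa [hS0] using hlip (w x) 0)
  have memG : ∀ (w : E n → ℝ) (H : E n → E n), MemLp w 2 volume → MemLp H 2 volume →
      MemLp (fun x => deriv S (w x) • H x) 2 volume := fun w H hw hH =>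
    MemLp.of_le_mul (c := L) hH ((hS'.comp_aestronglyMeasurable hw.1).smul hH.1)
      (Eventually.of_forall fun x => by
        rw [norm_smul]; exact mul_le_mul_of_nonneg_right (hL _) (norm_nonneg _))
  refine HasWeakGradient.of_tendsto (f := fun k x => S (moll k f x))
    (G := fun k x => deriv S (moll k f x) • moll k G x) (fun k => ?_) (fun k => memS _ (hmf k))
    (fun k => memG _ _ (hmf k) (hmG k)) (memS _ hf) (memG _ _ hf hG) ?_ ?_
  · have h1 : ContDiff ℝ ∞ (fun x => S (moll k f x)) := hS.comp (moll_contDiff k h.1)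
    convert! hasWeakGradient_gradient h1 using 1
    ext1 x
    rw [gradient_comp (hSd _).hasDerivAt ((moll_contDiff k h.1).differentiable (by simp) _),
      gradient_moll k h]
  · have h1 : Tendsto (fun k => ENNReal.ofReal L * eLpNorm (moll k f - f) 2 volume) atTop
        (𝓝 0) := by
      simpa using ENNReal.Tendsto.const_mul (tendsto_eLpNorm_moll_sub hf)
        (Or.inr (ENNReal.ofReal_ne_top (r := L)))
    refine tendsto_of_tendsto_of_tendsto_of_le_of_le tendsto_const_nhds h1 (fun _ => zero_le)
      fun k => ?_
    exact eLpNorm_le_mul_eLpNorm_of_ae_le_mul (Eventually.of_forall fun x => hlip _ _) 2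
  · have hr : Tendsto (fun k => eLpNorm (fun x => L * ‖(moll k G - G) x‖) 2 volume) atTop
        (𝓝 0) := by
      have h1 : Tendsto (fun k => ENNReal.ofReal L * eLpNorm (moll k G - G) 2 volume) atTop
          (𝓝 0) := by
        simpa using ENNReal.Tendsto.const_mul (tendsto_eLpNorm_moll_sub hG)
          (Or.inr (ENNReal.ofReal_ne_top (r := L)))
      refine tendsto_of_tendsto_of_tendsto_of_le_of_le tendsto_const_nhds h1 (fun _ => zero_le)
        fun k => ?_
      exact eLpNorm_le_mul_eLpNorm_of_ae_le_mul (Eventually.of_forall fun x => by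
        simp [abs_of_nonneg hL0]) 2
    refine tendsto_eLpNorm_two_of_dominated
      (q := fun x => 2 * L * ‖G x‖) (fun k => ((memG _ _ (hmf k) (hmG k)).sub (memG _ _ hf hG)).1)
      (hG.norm.const_mul _) hr
      (fun k => (((hmG k).sub hG).norm.const_mul L).1) (fun k => ?_) ?_
    · refine Eventually.of_forall fun x => ?_
      -- The first summand is small in `L²`; the second is dominated by `2L‖G‖` and tends to zero
      -- pointwise.
      have e1 : deriv S (moll k f x) • moll k G x - deriv S (f x) • G x
          = deriv S (moll k f x) • (moll k G x - G x)
            + (deriv S (moll k f x) - deriv S (f x)) • G x := by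
        rw [smul_sub, sub_smul]; abel
      simp only [Pi.sub_apply]
      rw [e1, abs_of_nonneg (by positivity), abs_of_nonneg (by positivity)]
      refine (norm_add_le _ _).trans (add_le_add ?_ ?_)
      · rw [norm_smul]; exact mul_le_mul_of_nonneg_right (hL _) (norm_nonneg _)
      · rw [norm_smul]
        refine mul_le_mul_of_nonneg_right ?_ (norm_nonneg _)
        refine (norm_sub_le _ _).trans ?_
        have := hL (moll k f x); have := hL (f x)
        simp only [Real.norm_eq_abs]; linarith
    · filter_upwards [tendsto_moll_ae h.1, tendsto_moll_ae h.2.1] with x h3 h4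
      have := ((hS'.tendsto _).comp h3).smul h4
      simpa using this.sub_const (deriv S (f x) • G x)

/-! ### Capacity and measures continuous with respect to it. -/

theorem gradSq_eq (u : E n → ℝ) : gradSq u = eLpNorm (wgrad u) 2 volume ^ 2 :=
  lintegral_ofReal_norm_sq _

theorem exists_of_sobolevCap_lt {A : Set (E n)} {c : ℝ≥0∞} (h : sobolevCap A < c ^ 2) :
    ∃ f : E n → ℝ, HasWeakGradient f (wgrad f) ∧ MemLp f 2 volume ∧ MemLp (wgrad f) 2 volume ∧
      eLpNorm f 2 volume ≤ c ∧ eLpNorm (wgrad f) 2 volume ≤ c ∧ ∀ᵐ x, x ∈ A → 1 ≤ f x := by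
  simp only [sobolevCap, iInf_lt_iff] at h
  obtain ⟨f, ⟨hf, ⟨G, hG, hG2⟩, O, hO, hAO, h1⟩, hlt⟩ := h
  rw [gradSq_eq, lintegral_ofReal_sq] at hlt
  have hsq : ∀ a : ℝ≥0∞, a ^ 2 ≤ c ^ 2 → a ≤ c := fun a ha => by
    by_contra hlt
    exact absurd ha (not_le.2 (ENNReal.pow_lt_pow_left two_ne_zero (not_le.1 hlt)))
  refine ⟨f, hasWeakGradient_wgrad ⟨G, hG⟩, hf, (memLp_congr_ae hG.wgrad_ae_eq).2 hG2,
    hsq _ (le_self_add.trans hlt.le), hsq _ (le_add_self.trans hlt.le), ?_⟩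
  filter_upwards [(ae_restrict_iff' hO.measurableSet).1 h1] with x hx hxA using hx (hAO hxA)

/-- The measure `m` is continuous with respect to the `H¹` capacity. -/
def CapControlled (m : Measure (E n)) : Prop :=
  ∀ η : ℝ≥0∞, 0 < η → ∃ ε : ℝ≥0∞, 0 < ε ∧ ε ≠ ⊤ ∧ ∀ φ : E n → ℝ, ContDiff ℝ ∞ φ →
    eLpNorm φ 2 volume ≤ ε → eLpNorm (gradient φ) 2 volume ≤ ε → m {x | 1 ≤ φ x} ≤ η

/-- Passes from smooth to weakly differentiable functions. A mollification of `f` is at least `1` at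
points whose ball of the mollification radius lies in `O`; such points exhaust `O`, and mollifying
does not increase the norms. -/
theorem measure_le_of_one_le {m : Measure (E n)} {η ε : ℝ≥0∞}
    (hm : ∀ φ : E n → ℝ, ContDiff ℝ ∞ φ → eLpNorm φ 2 volume ≤ ε →
      eLpNorm (gradient φ) 2 volume ≤ ε → m {x | 1 ≤ φ x} ≤ η)
    {f : E n → ℝ} {G : E n → E n} (h : HasWeakGradient f G) (hf : eLpNorm f 2 volume ≤ ε)
    (hG : eLpNorm G 2 volume ≤ ε) {O : Set (E n)} (hO : IsOpen O)
    (h1 : ∀ᵐ x, x ∈ O → 1 ≤ f x) : m O ≤ η := by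
  set V : ℕ → Set (E n) := fun k => {x | Metric.ball x (1 / ((k : ℝ) + 1)) ⊆ O} with hV
  have hmono : Monotone V := fun k l hkl x hx =>
    (Metric.ball_subset_ball (by
      have : (0 : ℝ) < k + 1 := by positivity
      exact one_div_le_one_div_of_le this (by exact_mod_cast Nat.succ_le_succ hkl))).trans hx
  have hun : O ⊆ ⋃ k, V k := fun x hx => by
    obtain ⟨r, hr, hb⟩ := Metric.isOpen_iff.1 hO x hx
    obtain ⟨k, hk⟩ := exists_nat_one_div_lt hr
    exact Set.mem_iUnion.2 ⟨k, (Metric.ball_subset_ball hk.le).trans hb⟩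
  refine (measure_mono hun).trans ?_
  rw [hmono.measure_iUnion]
  refine iSup_le fun k => ?_
  have hg : gradient (moll k f) = moll k G := funext fun x => gradient_moll k h x
  refine le_trans (measure_mono fun x hx => ?_) (hm (moll k f) (moll_contDiff k h.1)
    ((eLpNorm_moll_le k h.1.aestronglyMeasurable).trans hf)
    (by rw [hg]; exact (eLpNorm_moll_le k h.2.1.aestronglyMeasurable).trans hG))
  refine le_moll k h.1 ?_
  filter_upwards [h1] with t ht htb using ht (hx htb)

/-- A smooth substitute of `|t|` that vanishes quadratically at `0`. -/
def softAbs (t : ℝ) : ℝ := 3 * (√(1 + t ^ 2) - 1)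

theorem hasDerivAt_softAbs (t : ℝ) : HasDerivAt softAbs (3 * (t / √(1 + t ^ 2))) t := by
  have h0 : (1 + t ^ 2) ≠ 0 := by positivity
  have h1 : HasDerivAt (fun t : ℝ => 1 + t ^ 2) (2 * t) t := by
    simpa using (hasDerivAt_pow 2 t).const_add 1
  have h2 := ((h1.sqrt h0).sub_const 1).const_mul 3
  convert! h2 using 1
  field_simp

theorem contDiff_softAbs : ContDiff ℝ ∞ softAbs := by
  refine contDiff_const.mul ((ContDiff.sqrt (by fun_prop) fun t => ?_).sub contDiff_const)
  positivity

theorem abs_deriv_softAbs_le (t : ℝ) : |deriv softAbs t| ≤ 3 := by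
  rw [(hasDerivAt_softAbs t).deriv, abs_mul, abs_div, abs_of_nonneg (Real.sqrt_nonneg _)]
  have h1 : |t| ≤ √(1 + t ^ 2) := Real.abs_le_sqrt (by linarith)
  have h2 : 0 < √(1 + t ^ 2) := Real.sqrt_pos.2 (by positivity)
  have h3 : |t| / √(1 + t ^ 2) ≤ 1 := (div_le_one h2).2 h1
  norm_num; linarith

theorem softAbs_zero : softAbs 0 = 0 := by simp [softAbs]

theorem softAbs_nonneg (t : ℝ) : 0 ≤ softAbs t := by
  have : 1 ≤ √(1 + t ^ 2) := Real.one_le_sqrt.2 (by nlinarith [sq_nonneg t])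
  rw [softAbs]; linarith

/-- This is what the factor `3` in `softAbs` is for: `3(√2 - 1) ≥ 1`, because `√2 ≥ 4/3`. -/
theorem one_le_softAbs {t : ℝ} (ht : 1 ≤ |t|) : 1 ≤ softAbs t := by
  have h : (4 : ℝ) / 3 ≤ √(1 + t ^ 2) := by
    apply Real.le_sqrt_of_sq_le
    have : 1 ≤ t ^ 2 := by nlinarith [sq_abs t]
    linarith
  rw [softAbs]; linarith

theorem abs_softAbs_le (t : ℝ) : |softAbs t| ≤ 3 * |t| := by
  have h1 : √(1 + t ^ 2) ≤ 1 + |t| := by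
    apply Real.sqrt_le_iff.2
    exact ⟨by positivity, by nlinarith [sq_abs t, abs_nonneg t]⟩
  rw [abs_of_nonneg (softAbs_nonneg t), softAbs]; linarith

theorem eLpNorm_softAbs_le (f : E n → ℝ) :
    eLpNorm (fun x => softAbs (f x)) 2 volume ≤ 3 * eLpNorm f 2 volume := by
  have := eLpNorm_le_mul_eLpNorm_of_ae_le_mul (μ := volume) (f := fun x => softAbs (f x)) (g := f)
    (c := 3) (Eventually.of_forall fun x => abs_softAbs_le (f x)) 2
  simpa using this

theorem eLpNorm_deriv_softAbs_le (f : E n → ℝ) (G : E n → E n) :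
    eLpNorm (fun x => deriv softAbs (f x) • G x) 2 volume ≤ 3 * eLpNorm G 2 volume := by
  have := eLpNorm_le_mul_eLpNorm_of_ae_le_mul (μ := volume)
    (f := fun x => deriv softAbs (f x) • G x) (g := G)
    (c := 3) (Eventually.of_forall fun x => by
      rw [norm_smul]; exact mul_le_mul_of_nonneg_right (abs_deriv_softAbs_le _) (norm_nonneg _)) 2
  simpa using this

/-- The capacitary weak type estimate for a quasicontinuous function in `H¹`. -/
theorem CapControlled.exists_measure_le {m : Measure (E n)} (hm : CapControlled m) {η : ℝ≥0∞}
    (hη : 0 < η) : ∃ ε : ℝ≥0∞, 0 < ε ∧ ∀ (b : E n → ℝ) (G : E n → E n), IsQuasicontinuous b →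
      HasWeakGradient b G → eLpNorm b 2 volume ≤ ε → eLpNorm G 2 volume ≤ ε →
      m {x | 1 < |b x|} ≤ η := by
  obtain ⟨ε, hε, hεt, hmε⟩ := hm η hη
  have hε6 : 0 < ε / 6 := ENNReal.div_pos hε.ne' (by simp)
  have hε6t : ε / 6 ≠ ⊤ := ENNReal.div_ne_top hεt (by simp)
  -- Two functions are added below, and `softAbs` triples the norm bound of each.
  have h6 : 3 * (ε / 6) + 3 * (ε / 6) = ε := by
    rw [← add_mul]; norm_num
    exact ENNReal.mul_div_cancel (by simp) (by simp)
  refine ⟨ε / 6, hε6, fun b G hbq hb hbn hGn => ?_⟩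
  have hbL : MemLp b 2 volume := ⟨hb.1.aestronglyMeasurable, hbn.trans_lt hε6t.lt_top⟩
  have hGL : MemLp G 2 volume := ⟨hb.2.1.aestronglyMeasurable, hGn.trans_lt hε6t.lt_top⟩
  obtain ⟨O, hO, hcap, hcont⟩ := hbq ((ε / 6) ^ 2) (by positivity)
  obtain ⟨f, hfw, hfL, hfG, hfn, hfGn, hf1⟩ := exists_of_sobolevCap_lt hcap
  have hopen : IsOpen {t : ℝ | 1 < |t|} := isOpen_lt continuous_const continuous_abs
  -- Off `O` the set `{1 < |b|}` is relatively open, so `O ∪ U` is an open set containing it. There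
  -- `softAbs f + softAbs b ≥ 1` almost everywhere: `f` serves on `O` and `b` on the rest.
  obtain ⟨U, hU, hUO⟩ := continuousOn_iff'.1 hcont _ hopen
  have w1 := hfw.comp hfL hfG contDiff_softAbs softAbs_zero abs_deriv_softAbs_le
  have w2 := hb.comp hbL hGL contDiff_softAbs softAbs_zero abs_deriv_softAbs_le
  have hle : m (O ∪ U) ≤ η := by
    refine measure_le_of_one_le hmε (w1.add w2) ?_ ?_ (hO.union hU) ?_
    · refine (eLpNorm_add_le w1.1.aestronglyMeasurable w2.1.aestronglyMeasurable
        (by norm_num)).trans ?_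
      rw [← h6]
      exact add_le_add ((eLpNorm_softAbs_le f).trans (by gcongr))
        ((eLpNorm_softAbs_le b).trans (by gcongr))
    · refine (eLpNorm_add_le w1.2.1.aestronglyMeasurable w2.2.1.aestronglyMeasurable
        (by norm_num)).trans ?_
      rw [← h6]
      exact add_le_add ((eLpNorm_deriv_softAbs_le f _).trans (by gcongr))
        ((eLpNorm_deriv_softAbs_le b G).trans (by gcongr))
    · filter_upwards [hf1] with x hx hxOU
      by_cases hxO : x ∈ O
      · have := one_le_softAbs ((hx hxO).trans (le_abs_self _))
        have := softAbs_nonneg (b x)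
        simp only [Pi.add_apply]; linarith
      · have hxU : x ∈ U := hxOU.resolve_left hxO
        have : x ∈ b ⁻¹' {t | 1 < |t|} ∩ Oᶜ := by rw [hUO]; exact ⟨hxU, hxO⟩
        have := one_le_softAbs (le_of_lt (show 1 < |b x| from this.1))
        have := softAbs_nonneg (f x)
        simp only [Pi.add_apply]; linarith
  refine (measure_mono fun x hx => ?_).trans hle
  by_cases hxO : x ∈ O
  · exact Or.inl hxO
  · have : x ∈ U ∩ Oᶜ := by rw [← hUO]; exact ⟨hx, hxO⟩
    exact Or.inr this.1

/-- Quasicontinuous functions that are nonnegative almost everywhere are nonnegative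
quasi-everywhere. -/
theorem CapControlled.ae_nonneg {m : Measure (E n)} (hm : CapControlled m) {u : E n → ℝ}
    (hu : IsQuasicontinuous u) (h0 : ∀ᵐ x, 0 ≤ u x) : ∀ᵐ x ∂m, 0 ≤ u x := by
  rw [ae_iff]
  refine le_antisymm (le_of_forall_pos_le_add fun η hη => ?_) zero_le
  rw [zero_add]
  obtain ⟨ε, hε, hεt, hmε⟩ := hm η hη
  obtain ⟨O, hO, hcap, hcont⟩ := hu (ε ^ 2) (by positivity)
  obtain ⟨f, hfw, hfL, hfG, hfn, hfGn, hf1⟩ := exists_of_sobolevCap_lt hcap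
  -- The part of `U` outside `O` lies in `{u < 0}`, hence is Lebesgue null. So `f ≥ 1` almost
  -- everywhere on the open set `O ∪ U`, and the capacity bound on `O` alone suffices.
  obtain ⟨U, hU, hUO⟩ := continuousOn_iff'.1 hcont _ (isOpen_Iio (a := (0 : ℝ)))
  have hle : m (O ∪ U) ≤ η := by
    refine measure_le_of_one_le hmε hfw hfn hfGn (hO.union hU) ?_
    filter_upwards [hf1, h0] with x hx hx0 hxOU
    by_cases hxO : x ∈ O
    · exact hx hxO
    · have : x ∈ u ⁻¹' Set.Iio 0 ∩ Oᶜ := by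
        rw [hUO]; exact ⟨hxOU.resolve_left hxO, hxO⟩
      exact absurd this.1 (not_lt.2 hx0)
  refine (measure_mono fun x hx => ?_).trans hle
  by_cases hxO : x ∈ O
  · exact Or.inl hxO
  · have : x ∈ U ∩ Oᶜ := by rw [← hUO]; exact ⟨not_le.1 hx, hxO⟩
    exact Or.inr this.1

theorem IsQuasicontinuous.continuous_mul_sub {v χ φ : E n → ℝ} (hv : IsQuasicontinuous v)
    (hχ : Continuous χ) (hφ : Continuous φ) :
    IsQuasicontinuous (fun x => χ x * (φ x - v x)) := fun ε hε => by
  obtain ⟨O, hO, hcap, hcont⟩ := hv ε hε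
  exact ⟨O, hO, hcap, hχ.continuousOn.mul (hφ.continuousOn.sub hcont)⟩

theorem exists_isTest_one_of_isCompact {K D : Set (E n)} (hK : IsCompact K) (hD : IsOpen D)
    (hKD : K ⊆ D) : ∃ χ : E n → ℝ, IsTest D χ ∧ (∀ x, 0 ≤ χ x) ∧ (∀ x, χ x ≤ 1) ∧
      ∀ x ∈ K, χ x = 1 := by
  obtain ⟨K', hK', hKK', hK'D⟩ := exists_compact_between hK hD hKD
  obtain ⟨χ, h1, h2, h3, h4⟩ := exists_contMDiff_support_eq_eq_one_iff (n := ⊤)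
    (modelWithCornersSelf ℝ (E n)) (isOpen_interior (s := K')) hK.isClosed hKK'
  refine ⟨χ, ⟨h1.contDiff, ?_, ?_⟩, fun x => (h2 ⟨x, rfl⟩).1, fun x => (h2 ⟨x, rfl⟩).2,
    fun x hx => (h4 x).1 hx⟩
  · refine HasCompactSupport.of_support_subset_isCompact hK' ?_
    rw [h3]; exact interior_subset
  · refine (closure_minimal ?_ hK'.isClosed).trans hK'D
    rw [h3]; exact interior_subset

/-- On functions with bounded support, the `L²` norm is dominated by `Lᵖ` norms, `p ≥ 2`. -/
theorem exists_eLpNorm_mul_le {F : Type*} [NormedAddCommGroup F] [NormedSpace ℝ F]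
    {χ : E n → F} (hχ : Continuous χ) (hχc : HasCompactSupport χ)
    {p : ℝ≥0∞} (hp : 2 ≤ p) : ∃ C : ℝ≥0∞, C ≠ ⊤ ∧ ∀ w : E n → ℝ, AEStronglyMeasurable w volume →
      eLpNorm (fun x => w x • χ x) 2 volume ≤ C * eLpNorm w p volume := by
  obtain ⟨M, hM⟩ := hχc.exists_bound_of_continuous hχ
  set K := tsupport χ
  have hK : MeasurableSet K := (isClosed_tsupport _).measurableSet
  have hKf : volume K < ⊤ := hχc.isCompact.measure_lt_top
  set r : ℝ := 1 / (2 : ℝ≥0∞).toReal - 1 / p.toReal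
  have hr : 0 ≤ r := by
    by_cases hpt : p = ⊤
    · simp [r, hpt]
    · have : (2 : ℝ≥0∞).toReal ≤ p.toReal := ENNReal.toReal_mono hpt hp
      exact sub_nonneg.2 (one_div_le_one_div_of_le (by norm_num) this)
  refine ⟨ENNReal.ofReal M * (volume K) ^ r, ENNReal.mul_ne_top ENNReal.ofReal_ne_top
    (ENNReal.rpow_lt_top_of_nonneg hr hKf.ne).ne, fun w hw => ?_⟩
  have h1 : eLpNorm (fun x => w x • χ x) 2 volume
      ≤ ENNReal.ofReal M * eLpNorm (K.indicator w) 2 volume := by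
    refine eLpNorm_le_mul_eLpNorm_of_ae_le_mul (Eventually.of_forall fun x => ?_) 2
    by_cases hx : x ∈ K
    · rw [Set.indicator_of_mem hx, norm_smul, mul_comm]
      exact mul_le_mul_of_nonneg_right (hM x) (norm_nonneg _)
    · rw [Set.indicator_of_notMem hx, image_eq_zero_of_notMem_tsupport hx]; simp
  refine h1.trans ?_
  rw [mul_assoc, eLpNorm_indicator_eq_eLpNorm_restrict hK]
  gcongr
  have h2 := eLpNorm_le_eLpNorm_mul_rpow_measure_univ (μ := volume.restrict K) hp hw.restrict
  rw [Measure.restrict_apply_univ, mul_comm] at h2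
  exact h2.trans (by gcongr; exact Measure.restrict_le_self)

/-- Convergence in the energy space of smooth functions to a quasicontinuous function implies
convergence in measure for each measure that is continuous with respect to the capacity. -/
theorem CapControlled.tendstoInMeasure {m : Measure (E n)} (hm : CapControlled m)
    {K : Set (E n)} (hK : IsCompact K) (hmK : m Kᶜ = 0) {p : ℝ≥0∞} (hp : 2 ≤ p)
    {v : E n → ℝ} (hvq : IsQuasicontinuous v) (hv : HasWeakGradient v (wgrad v))
    {φ : ℕ → E n → ℝ} (hφ : ∀ k, ContDiff ℝ ∞ (φ k))
    (h1 : Tendsto (fun k => eLpNorm (φ k - v) p volume) atTop (𝓝 0))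
    (h2 : Tendsto (fun k => eLpNorm (gradient (φ k) - wgrad v) 2 volume) atTop (𝓝 0)) :
    TendstoInMeasure m φ atTop v := by
  -- The functions converge only in `Lᵖ`, with `p` possibly above `2`. Multiplying by a cut-off
  -- equal to `1` on the set carrying `m` makes the `L²` norms available.
  obtain ⟨χ, hχ, hχ0, hχ1, hχK⟩ := exists_isTest_one_of_isCompact hK isOpen_univ (Set.subset_univ _)
  obtain ⟨C₁, hC₁, hb₁⟩ := exists_eLpNorm_mul_le hχ.continuous hχ.2.1 hp
  obtain ⟨C₂, hC₂, hb₂⟩ := exists_eLpNorm_mul_le (continuous_gradient hχ.1)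
    (hasCompactSupport_gradient hχ.2.1) hp
  have hw : ∀ k, HasWeakGradient (φ k - v) (gradient (φ k) - wgrad v) := fun k =>
    (hasWeakGradient_gradient (hφ k)).sub hv
  rw [tendstoInMeasure_iff_norm]
  intro lam hlam
  rw [ENNReal.tendsto_nhds_zero]
  intro η hη
  obtain ⟨ε, hε, hmε⟩ := hm.exists_measure_le hη
  -- The weak type estimate concerns a strict inequality `1 < |b|`; scaling by `2 / lam` turns `lam
  -- ≤ |φ k - v|` into `2 ≤ |b|` on `K`.
  set c : ℝ := 2 / lam with hc
  have hcpos : 0 < c := by positivity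
  have t1 : Tendsto (fun k => ENNReal.ofReal c * (C₁ * eLpNorm (φ k - v) p volume)) atTop
      (𝓝 0) := by
    have := ENNReal.Tendsto.const_mul (ENNReal.Tendsto.const_mul h1 (Or.inr hC₁))
      (Or.inr (ENNReal.ofReal_ne_top (r := c)))
    simpa using this
  have t2 : Tendsto (fun k => ENNReal.ofReal c * (eLpNorm (gradient (φ k) - wgrad v) 2 volume
      + C₂ * eLpNorm (φ k - v) p volume)) atTop (𝓝 0) := by
    have := ENNReal.Tendsto.const_mul (h2.add (ENNReal.Tendsto.const_mul h1 (Or.inr hC₂)))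
      (Or.inr (ENNReal.ofReal_ne_top (r := c)))
    simpa using this
  filter_upwards [(ENNReal.tendsto_nhds_zero.1 t1) ε hε, (ENNReal.tendsto_nhds_zero.1 t2) ε hε]
    with k hk1 hk2
  have hχ' : ContDiff ℝ ∞ (fun x => c * χ x) := contDiff_const.mul hχ.1
  have hgc : ∀ x, gradient (fun x => c * χ x) x = c • gradient χ x := fun x =>
    gradient_comp (S := fun t => c * t) (by simpa using (hasDerivAt_id (χ x)).const_mul c)
      (hχ.1.differentiable (by simp) x)
  have hq := hvq.continuous_mul_sub hχ'.continuous (hφ k).continuous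
  have hg := (hw k).smooth_mul hχ'
  have hwm := (hw k).1.aestronglyMeasurable
  have hle := hmε _ _ hq hg ?_ ?_
  · have hsub : {x | lam ≤ ‖φ k x - v x‖} ⊆ {x | 1 < |c * χ x * (φ k x - v x)|} ∪ Kᶜ := by
      intro x hx
      by_cases hxK : x ∈ K
      · left
        have hx' : lam ≤ |φ k x - v x| := hx
        simp only [Set.mem_ofPred_eq, hχK x hxK, abs_mul, abs_of_pos hcpos, abs_one, mul_one]
        calc (1 : ℝ) < 2 := by norm_num
          _ = c * lam := by rw [hc]; field_simp
          _ ≤ _ := by gcongr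
      · exact Or.inr hxK
    calc m {x | lam ≤ ‖φ k x - v x‖} ≤ m {x | 1 < |c * χ x * (φ k x - v x)|} + m Kᶜ :=
          (measure_mono hsub).trans (measure_union_le _ _)
      _ ≤ η := by rw [hmK, add_zero]; exact hle
  · refine le_trans ?_ hk1
    refine le_trans (eLpNorm_le_mul_eLpNorm_of_ae_le_mul (g := fun x => (φ k - v) x • χ x) (c := c)
      (Eventually.of_forall fun x => ?_) 2) ?_
    · simp [abs_of_pos hcpos]
      exact le_of_eq (by ring)
    · gcongr
      exact hb₁ _ hwm
  · refine le_trans ?_ hk2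
    refine le_trans (eLpNorm_le_mul_eLpNorm_of_ae_le_mul (c := c)
      (g := (fun x => χ x • (gradient (φ k) - wgrad v) x) + fun x => (φ k - v) x • gradient χ x)
      (Eventually.of_forall fun x => ?_) 2) ?_
    · have e1 : (c * χ x) • (gradient (φ k) - wgrad v) x
          + (φ k - v) x • gradient (fun x => c * χ x) x
          = c • (χ x • (gradient (φ k) - wgrad v) x + (φ k - v) x • gradient χ x) := by
        rw [hgc, smul_add, smul_smul, smul_smul, smul_smul, mul_comm c ((φ k - v) x)]
      rw [e1, norm_smul, Real.norm_of_nonneg hcpos.le]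
      rfl
    · gcongr
      refine (eLpNorm_add_le (hχ.continuous.aestronglyMeasurable.smul
        (hw k).2.1.aestronglyMeasurable)
        (hwm.smul (continuous_gradient hχ.1).aestronglyMeasurable) (by norm_num)).trans ?_
      refine add_le_add (eLpNorm_mono fun x => ?_) (hb₂ _ hwm)
      rw [Pi.smul_apply', norm_smul, Real.norm_of_nonneg (hχ0 x)]
      exact mul_le_of_le_one_left (norm_nonneg _) (hχ1 x)

/-! ### The nonlocal energy as an `L²` norm. -/

/-- The difference `u(x) - u(y)`. -/
def dif (u : E n → ℝ) (p : E n × E n) : ℝ := u p.1 - u p.2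

/-- The measure `(C_{n,s} / 2) |x - y|^{-n-2s} dx dy` on `D_Ω`. -/
def kern [NeZero n] (s : ℝ) (Ω : Set (E n)) : Measure (E n × E n) :=
  (volume.restrict (DOmega Ω)).withDensity fun p =>
    ENNReal.ofReal (Cns n s / 2 / ‖p.1 - p.2‖ ^ ((n : ℝ) + 2 * s))

theorem measurable_kern_density [NeZero n] (s : ℝ) : Measurable fun p : E n × E n =>
    ENNReal.ofReal (Cns n s / 2 / ‖p.1 - p.2‖ ^ ((n : ℝ) + 2 * s)) := by
  fun_prop

theorem Cns_nonneg [NeZero n] (s : ℝ) : 0 ≤ Cns n s :=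
  inv_nonneg.2 (integral_nonneg fun ζ =>
    div_nonneg (sub_nonneg.2 (Real.cos_le_one _)) (by positivity))

theorem kern_absolutelyContinuous [NeZero n] (s : ℝ) (Ω : Set (E n)) :
    kern s Ω ≪ (volume : Measure (E n × E n)) :=
  (withDensity_absolutelyContinuous _ _).trans Measure.restrict_le_self.absolutelyContinuous

theorem lintegral_kern [NeZero n] (s : ℝ) (Ω : Set (E n)) (F : E n × E n → ℝ≥0∞) :
    ∫⁻ p, F p ∂(kern s Ω) = ∫⁻ p in DOmega Ω,
      ENNReal.ofReal (Cns n s / 2 / ‖p.1 - p.2‖ ^ ((n : ℝ) + 2 * s)) * F p := by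
  rw [kern, lintegral_withDensity_eq_lintegral_mul_non_measurable _ (measurable_kern_density s)
    (Eventually.of_forall fun _ => ENNReal.ofReal_lt_top)]
  rfl

/-- With the kernel absorbed into `kern`, the function `dif u` plays the role of a gradient, and the
local and nonlocal parts obey the same `L²` convergence lemmas. -/
theorem ofReal_mul_gagliardo [NeZero n] (s : ℝ) (Ω : Set (E n)) (u : E n → ℝ) :
    ENNReal.ofReal (Cns n s / 2) * gagliardo s Ω u = eLpNorm (dif u) 2 (kern s Ω) ^ 2 := by
  have h0 : 0 ≤ Cns n s / 2 := by have := Cns_nonneg (n := n) s; positivity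
  rw [← lintegral_ofReal_sq, lintegral_kern, gagliardo,
    ← lintegral_const_mul' _ _ ENNReal.ofReal_ne_top]
  refine lintegral_congr fun p => ?_
  rw [← ENNReal.ofReal_mul h0, ← ENNReal.ofReal_mul (by positivity)]
  congr 1
  rw [dif]; ring

theorem scalarSq_eq [NeZero n] (s : ℝ) (Ω : Set (E n)) (u : E n → ℝ) :
    scalarSq s Ω u = eLpNorm (wgrad u) 2 volume ^ 2 + eLpNorm (dif u) 2 (kern s Ω) ^ 2 := by
  rw [scalarSq, gradSq_eq, ofReal_mul_gagliardo]

theorem scalarSq_le_etaSq [NeZero n] (s : ℝ) (Ω : Set (E n)) (u : E n → ℝ) :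
    scalarSq s Ω u ≤ etaSq s Ω u := by
  have := Cns_nonneg (n := n) s
  rw [scalarSq, etaSq]
  gcongr
  linarith

theorem form_eq [NeZero n] (s : ℝ) (Ω : Set (E n)) (u φ : E n → ℝ) :
    form s Ω u φ = (∫ x in Ω, inner ℝ (wgrad u x) (gradient φ x)) +
      ∫ p, inner ℝ (dif u p) (dif φ p) ∂(kern s Ω) := by
  have h0 : 0 ≤ Cns n s / 2 := by have := Cns_nonneg (n := n) s; positivity
  rw [form, kern, integral_withDensity_eq_integral_toReal_smul (measurable_kern_density s)
    (Eventually.of_forall fun _ => ENNReal.ofReal_lt_top), ← integral_const_mul]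
  congr 1
  refine integral_congr_ae (Eventually.of_forall fun p => ?_)
  simp only [smul_eq_mul, RCLike.inner_apply, conj_trivial, dif]
  rw [ENNReal.toReal_ofReal (by positivity)]
  ring

theorem aestronglyMeasurable_dif [NeZero n] {u : E n → ℝ} (hu : AEStronglyMeasurable u volume)
    (s : ℝ) (Ω : Set (E n)) : AEStronglyMeasurable (dif u) (kern s Ω) := by
  have h : AEStronglyMeasurable (dif u) (volume : Measure (E n × E n)) :=
    (hu.comp_fst (ν := volume)).sub (hu.comp_snd (μ := volume))
  exact h.mono_ac (kern_absolutelyContinuous s Ω)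

theorem ae_kern_of_ae [NeZero n] {P : E n → Prop} (h : ∀ᵐ x, P x) (s : ℝ) (Ω : Set (E n)) :
    ∀ᵐ p ∂(kern s Ω), P p.1 ∧ P p.2 := by
  refine (kern_absolutelyContinuous s Ω).ae_le ?_
  have h1 : ∀ᵐ p ∂(volume : Measure (E n × E n)), P p.1 :=
    (Measure.quasiMeasurePreserving_fst (μ := volume) (ν := volume)).ae h
  have h2 : ∀ᵐ p ∂(volume : Measure (E n × E n)), P p.2 :=
    (Measure.quasiMeasurePreserving_snd (μ := volume) (ν := volume)).ae h
  filter_upwards [h1, h2] with p a b using ⟨a, b⟩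

/-! ### Control of the nonlocal energy by the `H¹` norm. -/

section Embedding

theorem sq_add_le (a b : ℝ≥0∞) : (a + b) ^ 2 ≤ 2 * a ^ 2 + 2 * b ^ 2 := by
  have := ENNReal.rpow_add_le_mul_rpow_add_rpow a b (p := 2) (by norm_num)
  simp only [ENNReal.rpow_ofNat] at this
  norm_num at this
  rwa [mul_add] at this

/-- The fundamental theorem of calculus on the segment from `x - h` to `x`, Jensen in the segment
parameter, then Tonelli and translation invariance. -/
theorem lintegral_sub_translate_sq_le {ψ : E n → ℝ} (hψ : IsTest Set.univ ψ) (h : E n) :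
    ∫⁻ x, ‖ψ x - ψ (x - h)‖ₑ ^ 2 ≤ ‖h‖ₑ ^ 2 * eLpNorm (gradient ψ) 2 volume ^ 2 := by
  have hg := continuous_gradient hψ.1
  have hd : Differentiable ℝ ψ := hψ.1.differentiable (by simp)
  set I : Set ℝ := Set.Icc 0 1
  have hpt : ∀ x, ‖ψ x - ψ (x - h)‖ₑ ^ 2
      ≤ ∫⁻ t in I, ‖h‖ₑ ^ 2 * ‖gradient ψ (x - h + t • h)‖ₑ ^ 2 := by
    intro x
    have hderiv : ∀ t : ℝ, HasDerivAt (fun t : ℝ => ψ (x - h + t • h))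
        (inner ℝ (gradient ψ (x - h + t • h)) h) t := by
      intro t
      have h1 : HasDerivAt (fun t : ℝ => x - h + t • h) h t := by
        simpa using ((hasDerivAt_id t).smul_const h).const_add (x - h)
      have h2 := (hd (x - h + t • h)).hasFDerivAt.comp_hasDerivAt t h1
      rw [inner_gradient_left]
      exact h2
    have hcont : Continuous fun t : ℝ => (inner ℝ (gradient ψ (x - h + t • h)) h : ℝ) :=
      (hg.comp (by fun_prop)).inner continuous_const
    have hftc := intervalIntegral.integral_eq_sub_of_hasDerivAt (a := 0) (b := 1)
      (fun t _ => hderiv t) (hcont.intervalIntegrable _ _)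
    have e1 : ψ x - ψ (x - h) = ∫ t in (0 : ℝ)..1, inner ℝ (gradient ψ (x - h + t • h)) h := by
      rw [hftc]; simp
    have hle : ‖ψ x - ψ (x - h)‖ₑ
        ≤ ∫⁻ t in I, ‖(‖h‖ * ‖gradient ψ (x - h + t • h)‖)‖ₑ := by
      rw [e1, intervalIntegral.integral_of_le zero_le_one, ← integral_Icc_eq_integral_Ioc]
      refine (enorm_integral_le_lintegral_enorm _).trans (lintegral_mono fun t => ?_)
      rw [enorm_le_iff_norm_le, norm_mul, norm_norm, norm_norm, mul_comm]
      exact norm_inner_le_norm (𝕜 := ℝ) _ _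
    have hprob : IsProbabilityMeasure (volume.restrict I) := ⟨by simp [I]⟩
    have hm : AEStronglyMeasurable (fun t : ℝ => ‖h‖ * ‖gradient ψ (x - h + t • h)‖)
        (volume.restrict I) :=
      (continuous_const.mul (hg.comp (by fun_prop)).norm).aestronglyMeasurable
    have h2 := eLpNorm_le_eLpNorm_of_exponent_le (p := 1) (q := 2) (by norm_num) hm
    rw [eLpNorm_one_eq_lintegral_enorm] at h2
    calc ‖ψ x - ψ (x - h)‖ₑ ^ 2 ≤ _ := pow_le_pow_left' (hle.trans h2) 2
      _ = _ := by
        rw [eLpNorm_two_sq]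
        refine lintegral_congr fun t => ?_
        rw [enorm_mul, mul_pow]; simp
  have hmeas : AEMeasurable (Function.uncurry fun (x : E n) (t : ℝ) =>
      ‖h‖ₑ ^ 2 * ‖gradient ψ (x - h + t • h)‖ₑ ^ 2) (volume.prod (volume.restrict I)) := by
    have : Continuous fun p : E n × ℝ => gradient ψ (p.1 - h + p.2 • h) :=
      hg.comp (by fun_prop)
    exact ((this.enorm.measurable.pow_const 2).const_mul _).aemeasurable
  calc ∫⁻ x, ‖ψ x - ψ (x - h)‖ₑ ^ 2
      ≤ ∫⁻ x, ∫⁻ t in I, ‖h‖ₑ ^ 2 * ‖gradient ψ (x - h + t • h)‖ₑ ^ 2 := lintegral_mono hpt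
    _ = ∫⁻ t in I, ∫⁻ x, ‖h‖ₑ ^ 2 * ‖gradient ψ (x - h + t • h)‖ₑ ^ 2 :=
        lintegral_lintegral_swap hmeas
    _ = ∫⁻ t in I, ‖h‖ₑ ^ 2 * eLpNorm (gradient ψ) 2 volume ^ 2 := by
        refine lintegral_congr fun t => ?_
        rw [lintegral_const_mul' _ _ (by simp), eLpNorm_two_sq]
        congr 1
        have : ∀ x, x - h + t • h = x + (t • h - h) := fun x => by abel
        simp only [this]
        exact lintegral_add_right_eq_self (fun x => ‖gradient ψ x‖ₑ ^ 2) _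
    _ = _ := by simp [I]

/-- In polar coordinates the integrand is `r^(1-2s)` near `0`, integrable since `s < 1`, and
`r^(-1-2s)` at infinity, integrable since `s > 0`. -/
theorem lintegral_min_div_rpow_lt_top [NeZero n] {s : ℝ} (hs0 : 0 < s) (hs1 : s < 1) :
    ∫⁻ h : E n, ENNReal.ofReal (min (‖h‖ ^ 2) 1 / ‖h‖ ^ ((n : ℝ) + 2 * s)) < ⊤ := by
  have hn0 : 0 < n := Nat.pos_of_neZero n
  have hint : Integrable (fun h : E n => min (‖h‖ ^ 2) 1 / ‖h‖ ^ ((n : ℝ) + 2 * s)) := by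
    rw [integrable_fun_norm_addHaar (μ := (volume : Measure (E n)))
      (f := fun r : ℝ => min (r ^ 2) 1 / r ^ ((n : ℝ) + 2 * s))]
    simp only [finrank_euclideanSpace, Fintype.card_fin]
    rw [← Set.Ioc_union_Ioi_eq_Ioi (zero_le_one (α := ℝ))]
    have hpow : ∀ r : ℝ, 0 < r → r ^ (n - 1) = r ^ ((n : ℝ) - 1) := fun r hr => by
      rw [← Real.rpow_natCast, Nat.cast_sub hn0]; simp
    refine IntegrableOn.union ?_ ?_
    · have h1 : IntegrableOn (fun r : ℝ => r ^ (1 - 2 * s)) (Set.Ioc 0 1) := by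
        rw [← intervalIntegrable_iff_integrableOn_Ioc_of_le zero_le_one]
        exact intervalIntegral.intervalIntegrable_rpow' (by linarith)
      refine h1.congr_fun (fun r hr => ?_) measurableSet_Ioc
      have hr0 : 0 < r := hr.1
      simp only [smul_eq_mul]
      rw [min_eq_left (by nlinarith [hr.2]), hpow r hr0, ← Real.rpow_natCast, ← Real.rpow_sub hr0,
        ← Real.rpow_add hr0]
      congr 1; push_cast; ring
    · have h1 : IntegrableOn (fun r : ℝ => r ^ (-1 - 2 * s)) (Set.Ioi 1) :=
        integrableOn_Ioi_rpow_of_lt (by linarith) one_pos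
      refine h1.congr_fun (fun r hr => ?_) measurableSet_Ioi
      have hr1 : 1 < r := hr
      have hr0 : 0 < r := by linarith
      simp only [smul_eq_mul]
      rw [min_eq_right (by nlinarith), hpow r hr0, one_div, ← Real.rpow_neg hr0.le,
        ← Real.rpow_add hr0]
      congr 1; ring
  exact hint.lintegral_lt_top

/-- The embedding of `H¹` into the fractional energy space. -/
theorem exists_eLpNorm_dif_le [NeZero n] {s : ℝ} (hs0 : 0 < s) (hs1 : s < 1) (Ω : Set (E n)) :
    ∃ C : ℝ≥0∞, C ≠ ⊤ ∧ ∀ ψ : E n → ℝ, IsTest Set.univ ψ →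
      eLpNorm (dif ψ) 2 (kern s Ω) ≤
        C * (eLpNorm ψ 2 volume + eLpNorm (gradient ψ) 2 volume) := by
  set c : ℝ := Cns n s / 2
  have hc : 0 ≤ c := by have := Cns_nonneg (n := n) s; positivity
  set J := ∫⁻ h : E n, ENNReal.ofReal (min (‖h‖ ^ 2) 1 / ‖h‖ ^ ((n : ℝ) + 2 * s)) with hJ
  have hJt : J < ⊤ := lintegral_min_div_rpow_lt_top hs0 hs1
  set B := 4 * (ENNReal.ofReal c * J) with hB
  have hBt : B < ⊤ := ENNReal.mul_lt_top (by simp) (ENNReal.mul_lt_top ENNReal.ofReal_lt_top hJt)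
  refine ⟨1 + B, by simp [hBt.ne], fun ψ hψ => ?_⟩
  set a := eLpNorm ψ 2 volume
  set b := eLpNorm (gradient ψ) 2 volume
  -- Short translations are paid for by the gradient, long ones by the function itself.
  have hshift : ∀ h, ∫⁻ x, ‖ψ x - ψ (x - h)‖ₑ ^ 2 ≤ ENNReal.ofReal (min (‖h‖ ^ 2) 1) *
      (4 * (a + b) ^ 2) := by
    intro h
    rcases le_total (‖h‖ ^ 2) 1 with h1 | h1
    · rw [min_eq_left h1]
      refine (lintegral_sub_translate_sq_le hψ h).trans ?_
      rw [ENNReal.ofReal_pow (norm_nonneg _), ofReal_norm]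
      gcongr
      calc b ^ 2 ≤ (a + b) ^ 2 := pow_le_pow_left' le_add_self 2
        _ ≤ 4 * (a + b) ^ 2 := le_mul_of_one_le_left zero_le (by norm_num)
    · rw [min_eq_right h1, ENNReal.ofReal_one, one_mul]
      have hm : Measurable fun x => ‖ψ x‖ₑ := hψ.continuous.measurable.enorm
      calc ∫⁻ x, ‖ψ x - ψ (x - h)‖ₑ ^ 2 ≤ ∫⁻ x, (2 * ‖ψ x‖ₑ ^ 2 + 2 * ‖ψ (x - h)‖ₑ ^ 2) := by
            refine lintegral_mono fun x => ?_
            exact (pow_le_pow_left' (enorm_sub_le) 2).trans (sq_add_le _ _)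
        _ = 4 * a ^ 2 := by
            rw [lintegral_add_left (by fun_prop), lintegral_const_mul' _ _ (by simp),
              lintegral_const_mul' _ _ (by simp),
              lintegral_sub_right_eq_self (fun x => ‖ψ x‖ₑ ^ 2) h, ← eLpNorm_two_sq, ← add_mul]
            norm_num [a]
        _ ≤ _ := by gcongr; exact le_self_add
  have hkey : eLpNorm (dif ψ) 2 (kern s Ω) ^ 2 ≤ B * (a + b) ^ 2 := by
    set k : E n → ℝ≥0∞ := fun h => ENNReal.ofReal (c / ‖h‖ ^ ((n : ℝ) + 2 * s)) with hk
    have hkm : Measurable k := by fun_prop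
    have hFm : Measurable fun p : E n × E n => k (p.1 - p.2) * ‖ψ p.1 - ψ p.2‖ₑ ^ 2 :=
      (hkm.comp (by fun_prop)).mul
        (((hψ.continuous.measurable.comp measurable_fst).sub
          (hψ.continuous.measurable.comp measurable_snd)).enorm.pow_const 2)
    have hGm : Measurable (Function.uncurry fun x h : E n => k h * ‖ψ x - ψ (x - h)‖ₑ ^ 2) :=
      (hkm.comp measurable_snd).mul
        (((hψ.continuous.measurable.comp measurable_fst).sub
          (hψ.continuous.measurable.comp (measurable_fst.sub measurable_snd))).enorm.pow_const 2)
    rw [eLpNorm_two_sq, lintegral_kern]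
    calc ∫⁻ p in DOmega Ω, ENNReal.ofReal (c / ‖p.1 - p.2‖ ^ ((n : ℝ) + 2 * s)) * ‖dif ψ p‖ₑ ^ 2
        ≤ ∫⁻ p : E n × E n, k (p.1 - p.2) * ‖ψ p.1 - ψ p.2‖ₑ ^ 2 := setLIntegral_le_lintegral _ _
      _ = ∫⁻ x, ∫⁻ y, k (x - y) * ‖ψ x - ψ y‖ₑ ^ 2 := by
          rw [Measure.volume_eq_prod, lintegral_prod _ hFm.aemeasurable]
      _ = ∫⁻ x, ∫⁻ h, k h * ‖ψ x - ψ (x - h)‖ₑ ^ 2 := by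
          refine lintegral_congr fun x => ?_
          rw [← lintegral_sub_left_eq_self (fun h => k h * ‖ψ x - ψ (x - h)‖ₑ ^ 2) x]
          simp
      _ = ∫⁻ h, ∫⁻ x, k h * ‖ψ x - ψ (x - h)‖ₑ ^ 2 := lintegral_lintegral_swap hGm.aemeasurable
      _ ≤ ∫⁻ h, k h * (ENNReal.ofReal (min (‖h‖ ^ 2) 1) * (4 * (a + b) ^ 2)) := by
          refine lintegral_mono fun h => ?_
          rw [lintegral_const_mul' _ _ ENNReal.ofReal_ne_top]
          gcongr
          exact hshift h
      _ = ∫⁻ h : E n, ENNReal.ofReal (min (‖h‖ ^ 2) 1 / ‖h‖ ^ ((n : ℝ) + 2 * s)) *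
            (ENNReal.ofReal c * (4 * (a + b) ^ 2)) := by
          refine lintegral_congr fun h => ?_
          generalize 4 * (a + b) ^ 2 = D
          rw [hk, ← mul_assoc, ← ENNReal.ofReal_mul (by positivity), ← mul_assoc,
            ← ENNReal.ofReal_mul (by positivity)]
          congr 2
          ring
      _ = B * (a + b) ^ 2 := by
          rw [lintegral_mul_const _ (by fun_prop), hB]; ring
  by_contra hlt
  have h1 := ENNReal.pow_lt_pow_left two_ne_zero (not_le.1 hlt)
  refine absurd (hkey.trans ?_) (not_le.2 h1)
  -- The constant `1 + B` replaces `√B`, since `B ≤ (1 + B)²`.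
  rw [mul_pow]
  gcongr
  calc B ≤ 1 + B := le_add_self
    _ ≤ (1 + B) ^ 2 := by
      rw [sq]; exact le_mul_of_one_le_left zero_le le_self_add

end Embedding

/-! ### Capacity control of the measure `ℒu`. -/

theorem differentiable_softAbs : Differentiable ℝ softAbs :=
  fun t => (hasDerivAt_softAbs t).differentiableAt

theorem gradient_mul {f g : E n → ℝ} {x : E n} (hf : DifferentiableAt ℝ f x)
    (hg : DifferentiableAt ℝ g x) :
    gradient (fun y => f y * g y) x = f x • gradient g x + g x • gradient f x := by
  refine ext_inner_right ℝ fun e => ?_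
  rw [inner_add_left, inner_smul_left, inner_smul_left, inner_gradient_left, inner_gradient_left,
    inner_gradient_left, fderiv_fun_mul hf hg]
  simp

/-- The localized truncation `χ softAbs(φ)` of a smooth function. -/
theorem IsTest.softAbs_mul {D : Set (E n)} {χ φ : E n → ℝ} (hχ : IsTest D χ)
    (hφ : ContDiff ℝ ∞ φ) : IsTest D (fun x => softAbs (φ x) * χ x) :=
  hχ.mul_left (contDiff_softAbs.comp hφ)

/-- Converts an arbitrary smooth `φ` into a test function on `D` at the cost of a constant depending
on `χ` only. Where `χ = 1`, the new function is still at least `1` on `{φ ≥ 1}`; it is nonnegative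
when `χ` is. -/
theorem IsTest.exists_softAbs_mul_le {D : Set (E n)} {χ : E n → ℝ} (hχ : IsTest D χ) :
    ∃ C : ℝ≥0∞, C ≠ ⊤ ∧ ∀ φ : E n → ℝ, ContDiff ℝ ∞ φ →
      eLpNorm (fun x => softAbs (φ x) * χ x) 2 volume +
        eLpNorm (gradient fun x => softAbs (φ x) * χ x) 2 volume ≤
      C * (eLpNorm φ 2 volume + eLpNorm (gradient φ) 2 volume) := by
  obtain ⟨M₁, hM₁⟩ := hχ.2.1.exists_bound_of_continuous hχ.continuous
  obtain ⟨M₂, hM₂⟩ := (hasCompactSupport_gradient hχ.2.1).exists_bound_of_continuous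
    (continuous_gradient hχ.1)
  set M := max M₁ M₂
  have hM0 : 0 ≤ M := (norm_nonneg _).trans ((hM₁ 0).trans (le_max_left _ _))
  have h1 : ∀ x, |χ x| ≤ M := fun x => (hM₁ x).trans (le_max_left _ _)
  have h2 : ∀ x, ‖gradient χ x‖ ≤ M := fun x => (hM₂ x).trans (le_max_right _ _)
  set c := ENNReal.ofReal (3 * M)
  refine ⟨c + c, ENNReal.add_ne_top.2 ⟨ENNReal.ofReal_ne_top, ENNReal.ofReal_ne_top⟩,
    fun φ hφ => ?_⟩
  set a := eLpNorm φ 2 volume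
  set b := eLpNorm (gradient φ) 2 volume
  have e1 : eLpNorm (fun x => softAbs (φ x) * χ x) 2 volume ≤ c * a := by
    refine eLpNorm_le_mul_eLpNorm_of_ae_le_mul (Eventually.of_forall fun x => ?_) 2
    rw [norm_mul]
    calc ‖softAbs (φ x)‖ * ‖χ x‖ ≤ (3 * |φ x|) * M :=
          mul_le_mul (abs_softAbs_le _) (h1 x) (norm_nonneg _) (by positivity)
      _ = 3 * M * ‖φ x‖ := by rw [Real.norm_eq_abs]; ring
  have e2 : eLpNorm (gradient fun x => softAbs (φ x) * χ x) 2 volume ≤ c * (a + b) := by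
    have hd : Differentiable ℝ φ := hφ.differentiable (by simp)
    have hd' : Differentiable ℝ χ := hχ.1.differentiable (by simp)
    have := eLpNorm_le_mul_eLpNorm_of_ae_le_mul (μ := volume) (c := 3 * M)
      (f := gradient fun x => softAbs (φ x) * χ x) (g := fun x => ‖φ x‖ + ‖gradient φ x‖)
      (Eventually.of_forall fun x => ?_) 2
    · refine this.trans ?_
      gcongr
      refine (eLpNorm_add_le hφ.continuous.norm.aestronglyMeasurable
        (continuous_gradient hφ).norm.aestronglyMeasurable (by norm_num)).trans ?_
      rw [eLpNorm_norm, eLpNorm_norm]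
    · rw [gradient_mul (f := fun x => softAbs (φ x)) ((differentiable_softAbs _).comp x (hd x))
        (hd' x),
        gradient_comp (differentiable_softAbs _).hasDerivAt (hd x),
        Real.norm_of_nonneg (by positivity)]
      refine (norm_add_le _ _).trans ?_
      rw [norm_smul, norm_smul, norm_smul]
      have a1 : ‖softAbs (φ x)‖ * ‖gradient χ x‖ ≤ (3 * |φ x|) * M :=
        mul_le_mul (abs_softAbs_le _) (h2 x) (norm_nonneg _) (by positivity)
      have a2 : ‖χ x‖ * (‖deriv softAbs (φ x)‖ * ‖gradient φ x‖) ≤ M * (3 * ‖gradient φ x‖) := by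
        refine mul_le_mul (h1 x) ?_ (by positivity) hM0
        exact mul_le_mul_of_nonneg_right (abs_deriv_softAbs_le _) (norm_nonneg _)
      calc _ ≤ (3 * |φ x|) * M + M * (3 * ‖gradient φ x‖) := add_le_add a1 a2
        _ = _ := by rw [Real.norm_eq_abs]; ring
  calc _ ≤ c * (a + b) + c * (a + b) := add_le_add (e1.trans (by gcongr; exact le_self_add)) e2
    _ = _ := by ring

theorem MemLp.dif_test [NeZero n] {s : ℝ} (hs0 : 0 < s) (hs1 : s < 1) (Ω : Set (E n))
    {D : Set (E n)} {ψ : E n → ℝ} (hψ : IsTest D ψ) : MemLp (dif ψ) 2 (kern s Ω) := by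
  obtain ⟨C, hC, hb⟩ := exists_eLpNorm_dif_le hs0 hs1 Ω
  refine ⟨aestronglyMeasurable_dif hψ.continuous.aestronglyMeasurable s Ω,
    (hb ψ (hψ.mono (Set.subset_univ _))).trans_lt ?_⟩
  exact ENNReal.mul_lt_top hC.lt_top (ENNReal.add_lt_top.2 ⟨(hψ.memLp 2).2,
    (hψ.memLp_gradient 2).2⟩)

/-- Cauchy–Schwarz in both parts of the form, with the embedding of `H¹` for the nonlocal one. -/
theorem exists_form_le [NeZero n] {s : ℝ} (hs0 : 0 < s) (hs1 : s < 1) {Ω : Set (E n)}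
    {u : E n → ℝ} (hu : MemLp (wgrad u) 2 volume) (hd : MemLp (dif u) 2 (kern s Ω)) :
    ∃ C : ℝ≥0∞, C ≠ ⊤ ∧ ∀ ψ : E n → ℝ, IsTest Set.univ ψ →
      ENNReal.ofReal (form s Ω u ψ) ≤
        C * (eLpNorm ψ 2 volume + eLpNorm (gradient ψ) 2 volume) := by
  obtain ⟨C, hC, hb⟩ := exists_eLpNorm_dif_le hs0 hs1 Ω
  refine ⟨eLpNorm (wgrad u) 2 volume + eLpNorm (dif u) 2 (kern s Ω) * C, ?_, fun ψ hψ => ?_⟩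
  · exact ENNReal.add_ne_top.2 ⟨hu.2.ne, ENNReal.mul_ne_top hd.2.ne hC⟩
  · have hle : ∀ {α F : Type} [MeasurableSpace α] [NormedAddCommGroup F] [InnerProductSpace ℝ F]
        {ν : Measure α} {f g : α → F}, AEStronglyMeasurable f ν → AEStronglyMeasurable g ν →
        ENNReal.ofReal (∫ x, inner ℝ (f x) (g x) ∂ν) ≤ eLpNorm f 2 ν * eLpNorm g 2 ν := by
      intro α F _ _ _ ν f g hf hg
      refine le_trans ?_ (eLpNorm_one_inner_le hf hg)
      rw [eLpNorm_one_eq_lintegral_enorm]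
      refine le_trans ?_ (enorm_integral_le_lintegral_enorm _)
      rw [← ofReal_norm]
      exact ENNReal.ofReal_le_ofReal (le_abs_self _)
    set a := eLpNorm ψ 2 volume
    set b := eLpNorm (gradient ψ) 2 volume
    rw [form_eq]
    calc _ ≤ _ := ENNReal.ofReal_add_le
      _ ≤ eLpNorm (wgrad u) 2 volume * b + eLpNorm (dif u) 2 (kern s Ω) * (C * (a + b)) := by
        refine add_le_add ?_ ?_
        · refine (hle hu.1.restrict (hψ.memLp_gradient 2).1.restrict).trans ?_
          exact mul_le_mul' (eLpNorm_mono_measure _ Measure.restrict_le_self)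
            (eLpNorm_mono_measure _ Measure.restrict_le_self)
        · refine (hle hd.1 (MemLp.dif_test hs0 hs1 Ω hψ).1).trans ?_
          gcongr
          exact hb ψ hψ
      _ ≤ eLpNorm (wgrad u) 2 volume * (a + b) + eLpNorm (dif u) 2 (kern s Ω) * (C * (a + b)) := by
        gcongr; exact le_add_self
      _ = _ := by ring

/-- A finite measure that is the image of a finite energy function under the operator is
continuous with respect to the capacity. -/
theorem capControlled_of_operatorEqMeasure [NeZero n] {s : ℝ} (hs0 : 0 < s) (hs1 : s < 1)
    {Ω : Set (E n)} (hΩ : IsOpen Ω)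
    {u : E n → ℝ} (hu : MemLp (wgrad u) 2 volume) (hd : MemLp (dif u) 2 (kern s Ω))
    {μ : Measure (E n)} [IsFiniteMeasure μ] (hμ : OperatorEqMeasure s Ω u μ) :
    CapControlled (μ.restrict Ω) := by
  intro η hη
  have hη2 : η / 2 ≠ 0 := (ENNReal.half_pos hη.ne').ne'
  -- The equation can only be tested with functions supported in `Ω`. Finiteness of `μ` leaves at
  -- most `η / 2` outside a compact `K`, and a cut-off equal to `1` on `K` is used inside.
  obtain ⟨K, hKΩ, hK, hKη⟩ := hΩ.measurableSet.exists_isCompact_sdiff_lt (measure_ne_top μ Ω) hη2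
  obtain ⟨χ, hχ, hχ0, hχ1, hχK⟩ := exists_isTest_one_of_isCompact hK hΩ hKΩ
  obtain ⟨C₁, hC₁, hb₁⟩ := hχ.exists_softAbs_mul_le
  obtain ⟨C₂, hC₂, hb₂⟩ := exists_form_le hs0 hs1 hu hd
  set M := C₂ * (C₁ * 2) with hM
  have hMt : M ≠ ⊤ := ENNReal.mul_ne_top hC₂ (ENNReal.mul_ne_top hC₁ (by simp))
  have hη1 : min (η / 2) 1 ≠ 0 := (lt_min (pos_iff_ne_zero.2 hη2) one_pos).ne'
  have hη1t : min (η / 2) 1 ≠ ⊤ := ((min_le_right _ _).trans_lt (by simp)).ne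
  -- The minimum with `1` keeps the threshold finite for infinite `η`, and `M + 1` avoids dividing
  -- by zero.
  refine ⟨min (η / 2) 1 / (M + 1), ENNReal.div_pos hη1 (by simp [hMt]),
    ENNReal.div_ne_top hη1t (by simp), fun φ hφ hφ1 hφ2 => ?_⟩
  set ε := min (η / 2) 1 / (M + 1)
  have hMε : M * ε ≤ η / 2 := by
    calc M * ε ≤ (M + 1) * ε := by gcongr; exact le_self_add
      _ = min (η / 2) 1 := ENNReal.mul_div_cancel (by simp) (by simp [hMt])
      _ ≤ η / 2 := min_le_left _ _
  set ψ : E n → ℝ := fun x => softAbs (φ x) * χ x with hψdef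
  have hψ : IsTest Ω ψ := hχ.softAbs_mul hφ
  have hψ0 : ∀ x, 0 ≤ ψ x := fun x => mul_nonneg (softAbs_nonneg _) (hχ0 x)
  have hint : Integrable ψ (μ.restrict Ω) :=
    hψ.continuous.integrable_of_hasCompactSupport hψ.2.1
  -- By the equation, `∫ ψ dμ` is the form at `ψ`, which the `H¹` norm of `φ` controls. Chebyshev's
  -- inequality then bounds the superlevel set in `K`.
  have h1 : ∫⁻ x in Ω, ENNReal.ofReal (ψ x) ∂μ ≤ η / 2 := by
    rw [← ofReal_integral_eq_lintegral_ofReal hint (Eventually.of_forall hψ0), ← hμ ψ hψ]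
    refine (hb₂ ψ (hψ.mono (Set.subset_univ _))).trans ?_
    calc C₂ * _ ≤ C₂ * (C₁ * (ε + ε)) := by
          gcongr
          exact (hb₁ φ hφ).trans (by gcongr)
      _ = M * ε := by rw [hM]; ring
      _ ≤ η / 2 := hMε
  have hsub : {x | 1 ≤ φ x} ⊆ ({x | 1 ≤ φ x} ∩ K) ∪ (Ω \ K) ∪ Ωᶜ := by
    intro x hx
    by_cases hxK : x ∈ K
    · exact Or.inl (Or.inl ⟨hx, hxK⟩)
    · by_cases hxΩ : x ∈ Ω
      · exact Or.inl (Or.inr ⟨hxΩ, hxK⟩)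
      · exact Or.inr hxΩ
  have hmeas : MeasurableSet ({x | 1 ≤ φ x} ∩ K) :=
    (measurableSet_le measurable_const hφ.continuous.measurable).inter hK.measurableSet
  have h2 : (μ.restrict Ω) ({x | 1 ≤ φ x} ∩ K) ≤ η / 2 := by
    refine le_trans ?_ h1
    rw [← lintegral_indicator_one hmeas]
    refine lintegral_mono fun x => ?_
    by_cases hx : x ∈ {x | 1 ≤ φ x} ∩ K
    · rw [Set.indicator_of_mem hx]
      have : 1 ≤ ψ x := by
        rw [hψdef]
        simp only [hχK x hx.2, mul_one]
        exact one_le_softAbs (le_trans hx.1 (le_abs_self _))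
      simpa using ENNReal.ofReal_le_ofReal this
    · rw [Set.indicator_of_notMem hx]; exact zero_le
  have h3 : (μ.restrict Ω) (Ω \ K) ≤ η / 2 :=
    (Measure.restrict_apply_le _ _).trans hKη.le
  have h4 : (μ.restrict Ω) Ωᶜ = 0 := by
    rw [Measure.restrict_apply hΩ.measurableSet.compl]; simp
  calc (μ.restrict Ω) {x | 1 ≤ φ x} ≤ _ := measure_mono hsub
    _ ≤ (μ.restrict Ω) ({x | 1 ≤ φ x} ∩ K) + (μ.restrict Ω) (Ω \ K) + (μ.restrict Ω) Ωᶜ :=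
      (measure_union_le _ _).trans (by gcongr; exact measure_union_le _ _)
    _ ≤ η / 2 + η / 2 + 0 := by rw [h4]; gcongr
    _ = η := by rw [add_zero, ENNReal.add_halves]

/-! ### Capacity control of the surface measure. -/

section Trace

/-- `f(t₀)²` is the integral of `2 f f'` over `(-∞, t₀]`, and `2|f f'| ≤ f² + f'²`. -/
theorem one_le_lintegral_of_one_le {f : ℝ → ℝ} (hf : ContDiff ℝ 1 f) (hc : HasCompactSupport f)
    {t₀ : ℝ} (h : 1 ≤ f t₀) : 1 ≤ ∫⁻ t, (‖f t‖ₑ ^ 2 + ‖deriv f t‖ₑ ^ 2) := by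
  have hd : Differentiable ℝ f := hf.differentiable (by simp)
  have h2 : HasCompactSupport (fun t => f t ^ 2) := hc.comp_left (g := fun a => a ^ 2) (by simp)
  have h3 := h2.integral_Iic_deriv_eq (hf.pow 2) t₀
  have hder : ∀ t, deriv (fun t => f t ^ 2) t = 2 * f t * deriv f t := fun t => by
    have := ((hd t).hasDerivAt.fun_pow 2).deriv
    simpa using this
  calc (1 : ℝ≥0∞) = ENNReal.ofReal 1 := by simp
    _ ≤ ENNReal.ofReal (f t₀ ^ 2) := ENNReal.ofReal_le_ofReal (by nlinarith)
    _ ≤ ‖f t₀ ^ 2‖ₑ := by rw [← ofReal_norm]; exact ENNReal.ofReal_le_ofReal (le_abs_self _)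
    _ ≤ ∫⁻ t in Set.Iic t₀, ‖deriv (fun t => f t ^ 2) t‖ₑ := by
        rw [← h3]; exact enorm_integral_le_lintegral_enorm _
    _ ≤ ∫⁻ t, ‖deriv (fun t => f t ^ 2) t‖ₑ := setLIntegral_le_lintegral _ _
    _ ≤ _ := by
        refine lintegral_mono fun t => ?_
        have e1 : ‖deriv (fun t => f t ^ 2) t‖ ≤ ‖f t‖ ^ 2 + ‖deriv f t‖ ^ 2 := by
          rw [hder, norm_mul, norm_mul]
          have : ‖(2 : ℝ)‖ = 2 := by norm_num
          rw [this]
          nlinarith [sq_nonneg (‖f t‖ - ‖deriv f t‖)]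
        have e2 := ENNReal.ofReal_le_ofReal e1
        rw [ENNReal.ofReal_add (by positivity) (by positivity),
          ENNReal.ofReal_pow (by positivity), ENNReal.ofReal_pow (by positivity)] at e2
        simpa [Real.enorm_eq_ofReal_abs] using e2

variable {m : ℕ}

/-- The projection that forgets the `i`-th coordinate. -/
def dropCoord (i : Fin (m + 1)) (x : E (m + 1)) : Fin m → ℝ := fun j => x (i.succAbove j)

/-- The point with `i`-th coordinate `t` and remaining coordinates `z`. -/
def insCoord (i : Fin (m + 1)) (t : ℝ) (z : Fin m → ℝ) : E (m + 1) :=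
  WithLp.toLp 2 (Fin.insertNth (α := fun _ => ℝ) i t z)

theorem insCoord_eq (i : Fin (m + 1)) (t : ℝ) (z : Fin m → ℝ) :
    insCoord i t z = insCoord i 0 z + t • EuclideanSpace.single i (1 : ℝ) := by
  ext j
  refine i.succAboveCases ?_ (fun k => ?_) j <;> simp [insCoord]

theorem insCoord_dropCoord (i : Fin (m + 1)) (x : E (m + 1)) :
    insCoord i (x i) (dropCoord i x) = x := by
  ext j
  refine i.succAboveCases ?_ (fun k => ?_) j <;> simp [insCoord, dropCoord]

theorem lintegral_insCoord (i : Fin (m + 1)) {F : E (m + 1) → ℝ≥0∞} (hF : Measurable F) :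
    ∫⁻ z, ∫⁻ t, F (insCoord i t z) = ∫⁻ x, F x := by
  have h1 := (PiLp.volume_preserving_toLp (Fin (m + 1))).lintegral_comp hF
  have h2 := ((volume_preserving_piFinSuccAbove (fun _ : Fin (m + 1) => ℝ) i).symm _).lintegral_comp
    (f := fun x => F (WithLp.toLp 2 x)) (hF.comp (PiLp.volume_preserving_toLp _).measurable)
  rw [← h1, ← h2, Measure.volume_eq_prod, lintegral_prod_symm']
  · rfl
  · exact (hF.comp (PiLp.volume_preserving_toLp _).measurable).comp (MeasurableEquiv.measurable _)

/-- The projections of superlevel sets are controlled by the `H¹` norm. -/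
theorem volume_image_dropCoord_le (i : Fin (m + 1)) {ψ : E (m + 1) → ℝ}
    (hψ : IsTest Set.univ ψ) : volume (dropCoord i '' {x | 1 ≤ ψ x}) ≤
      eLpNorm ψ 2 volume ^ 2 + eLpNorm (gradient ψ) 2 volume ^ 2 := by
  set F : E (m + 1) → ℝ≥0∞ := fun x => ‖ψ x‖ₑ ^ 2 + ‖gradient ψ x‖ₑ ^ 2 with hF
  have hm1 : Measurable fun x => ‖ψ x‖ₑ ^ 2 := hψ.continuous.measurable.enorm.pow_const 2
  have hFm : Measurable F := hm1.add ((continuous_gradient hψ.1).measurable.enorm.pow_const 2)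
  have hd : Differentiable ℝ ψ := hψ.1.differentiable (by simp)
  -- A line in direction `i` that meets the superlevel set carries one-dimensional energy at least
  -- `1`. The bound on the set of such lines is then Chebyshev and Tonelli.
  have hsub : dropCoord i '' {x | 1 ≤ ψ x} ⊆ {z | 1 ≤ ∫⁻ t, F (insCoord i t z)} := by
    rintro _ ⟨x, hx, rfl⟩
    set a := insCoord i 0 (dropCoord i x)
    set e : E (m + 1) := EuclideanSpace.single i (1 : ℝ)
    have he : ‖e‖ = 1 := by simp [e]
    set f : ℝ → ℝ := fun t => ψ (a + t • e) with hf
    have hiso : Isometry fun t : ℝ => a + t • e := by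
      refine Isometry.of_dist_eq fun t r => ?_
      rw [dist_add_left, dist_eq_norm, ← sub_smul, norm_smul, he, mul_one, dist_eq_norm]
    have hcs : HasCompactSupport f := hψ.2.1.comp_isClosedEmbedding hiso.isClosedEmbedding
    have hsm : ContDiff ℝ 1 f :=
      (hψ.1.of_le (by simp)).comp (contDiff_const.add (contDiff_id.smul contDiff_const))
    have hderiv : ∀ t, deriv f t = inner ℝ (gradient ψ (a + t • e)) e := fun t => by
      have h1 : HasDerivAt (fun t : ℝ => a + t • e) e t := by
        simpa using ((hasDerivAt_id t).smul_const e).const_add a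
      rw [inner_gradient_left]
      exact ((hd (a + t • e)).hasFDerivAt.comp_hasDerivAt t h1).deriv
    have h1 : 1 ≤ f (x i) := by
      simp only [hf, a, e]
      rw [← insCoord_eq, insCoord_dropCoord]; exact hx
    refine (one_le_lintegral_of_one_le hsm hcs h1).trans (lintegral_mono fun t => ?_)
    rw [insCoord_eq]
    change ‖f t‖ₑ ^ 2 + ‖deriv f t‖ₑ ^ 2 ≤ ‖f t‖ₑ ^ 2 + ‖gradient ψ (a + t • e)‖ₑ ^ 2
    rw [hderiv]
    gcongr
    rw [enorm_le_iff_norm_le]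
    exact (norm_inner_le_norm (𝕜 := ℝ) _ _).trans (by rw [he, mul_one])
  have hmeas : Measurable fun z => ∫⁻ t, F (insCoord i t z) := by
    refine Measurable.lintegral_prod_left' (f := fun p : ℝ × (Fin m → ℝ) =>
      F (insCoord i p.1 p.2)) ?_
    refine hFm.comp ((PiLp.volume_preserving_toLp _).measurable.comp ?_)
    exact (MeasurableEquiv.piFinSuccAbove (fun _ : Fin (m + 1) => ℝ) i).symm.measurable
  calc volume (dropCoord i '' {x | 1 ≤ ψ x}) ≤ 1 * volume {z | 1 ≤ ∫⁻ t, F (insCoord i t z)} := by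
        rw [one_mul]; exact measure_mono hsub
    _ ≤ ∫⁻ z, ∫⁻ t, F (insCoord i t z) := mul_meas_ge_le_lintegral₀ hmeas.aemeasurable _
    _ = ∫⁻ x, F x := lintegral_insCoord i hFm
    _ = _ := by rw [hF, lintegral_add_left hm1, eLpNorm_two_sq, eLpNorm_two_sq]

/-- Near each point of a smooth boundary, some coordinate projection is antilipschitz on the
boundary. -/
theorem HasSmoothBoundary.exists_antilipschitz {Ω : Set (E (m + 1))} (hΩ : IsOpen Ω)
    (h : HasSmoothBoundary Ω) {x : E (m + 1)} (hx : x ∈ frontier Ω) :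
    ∃ (i : Fin (m + 1)) (r : ℝ) (L : NNReal), 0 < r ∧ ∀ y ∈ frontier Ω ∩ Metric.ball x r,
      ∀ z ∈ frontier Ω ∩ Metric.ball x r, dist y z ≤ L * dist (dropCoord i y) (dropCoord i z) := by
  obtain ⟨V, ρ, hV, hxV, hρ, hρ0, hΩV⟩ := h x hx
  have hzero : ∀ y ∈ frontier Ω, y ∈ V → ρ y = 0 := by
    intro y hy hyV
    have hyΩ : y ∉ Ω := fun hyΩ => by
      have := hy.2; rw [hΩ.interior_eq] at this; exact this hyΩ
    refine le_antisymm ?_ ?_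
    · by_contra hpos
      have hcont : ContinuousAt ρ y := (hρ.continuousOn).continuousAt (hV.mem_nhds hyV)
      have hnear : ∀ᶠ z in 𝓝 y, 0 < ρ z ∧ z ∈ V :=
        (hcont.eventually (lt_mem_nhds (not_le.1 hpos))).and (hV.mem_nhds hyV)
      obtain ⟨z, hz, hzΩ⟩ := mem_closure_iff_nhds.1 hy.1 _ hnear
      have : z ∈ {y | y ∈ V ∧ ρ y < 0} := by rw [← hΩV]; exact ⟨hzΩ, hz.2⟩
      exact absurd this.2 (not_lt.2 hz.1.le)
    · by_contra hneg
      have : y ∈ Ω ∩ V := by rw [hΩV]; exact ⟨hyV, not_le.1 hneg⟩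
      exact hyΩ this.1
  set A := fderiv ℝ ρ x with hA
  have hsum : ∀ v : E (m + 1), v = ∑ j, v j • EuclideanSpace.single j (1 : ℝ) := fun v => by
    conv_lhs => rw [← (EuclideanSpace.basisFun (Fin (m + 1)) ℝ).sum_repr v]
    simp
  -- The discarded coordinate is one in which `ρ` has a nonzero derivative at `x`, as for the
  -- implicit function theorem.
  obtain ⟨i, hi⟩ : ∃ i, A (EuclideanSpace.single i (1 : ℝ)) ≠ 0 := by
    by_contra hcon
    push Not at hcon
    refine hρ0 x hxV (ContinuousLinearMap.ext fun v => ?_)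
    rw [hsum v, map_sum]
    simp only [map_smul]
    exact Finset.sum_eq_zero fun j _ => by rw [← hA, hcon j]; simp
  set a := A (EuclideanSpace.single i (1 : ℝ)) with ha
  have ha0 : 0 < |a| := abs_pos.2 hi
  have hcd : ContinuousAt (fderiv ℝ ρ) x :=
    (hρ.continuousOn_fderiv_of_isOpen hV (by simp)).continuousAt (hV.mem_nhds hxV)
  have hev : ∀ᶠ y in 𝓝 x, ‖fderiv ℝ ρ y - A‖ < |a| / 2 ∧ y ∈ V := by
    refine Filter.Eventually.and ?_ (hV.mem_nhds hxV)
    have := Metric.tendsto_nhds.1 hcd (|a| / 2) (by positivity)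
    simpa [dist_eq_norm] using this
  obtain ⟨r, hr, hball⟩ := Metric.eventually_nhds_iff_ball.1 hev
  -- As `ρ` vanishes at both points, the mean value inequality gives `|A(y - z)| ≤ |a|/2 · ‖y - z‖`.
  -- So the `i`-th coordinate of `y - z` is controlled by the others up to half of `‖y - z‖`, which
  -- is absorbed on the left; this doubles the constant.
  have hmain : ∀ y ∈ frontier Ω ∩ Metric.ball x r, ∀ z ∈ frontier Ω ∩ Metric.ball x r,
      |a| * dist y z ≤ (2 * m * (‖A‖ + |a|)) * dist (dropCoord i y) (dropCoord i z) := by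
    intro y hy z hz
    have h1 := Convex.norm_image_sub_le_of_norm_fderiv_le' (𝕜 := ℝ) (f := ρ) (φ := A)
      (s := Metric.ball x r) (C := |a| / 2)
      (fun w hw => (hρ.differentiableOn (by simp)).differentiableAt
        (hV.mem_nhds (hball w hw).2)) (fun w hw => (hball w hw).1.le)
      (convex_ball _ _) hz.2 hy.2
    rw [hzero y hy.1 (hball y hy.2).2, hzero z hz.1 (hball z hz.2).2] at h1
    simp only [sub_self, zero_sub, norm_neg] at h1
    set v := y - z with hv
    set P := dist (dropCoord i y) (dropCoord i z) with hP
    have hcoord : ∀ j, |v (i.succAbove j)| ≤ P := fun j => by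
      have := dist_le_pi_dist (dropCoord i y) (dropCoord i z) j
      simpa [dropCoord, Real.dist_eq, hv] using this
    have hnorm1 : ∀ j : Fin (m + 1), ‖EuclideanSpace.single j (1 : ℝ)‖ = 1 := fun j => by simp
    have hnv : ‖v‖ ≤ |v i| + m * P := by
      conv_lhs => rw [hsum v]
      refine (norm_sum_le _ _).trans ?_
      rw [Fin.sum_univ_succAbove _ i]
      simp only [norm_smul, hnorm1, mul_one, Real.norm_eq_abs]
      gcongr
      refine (Finset.sum_le_sum fun j _ => hcoord j).trans ?_
      simp
    have hAv : |A v - v i * a| ≤ m * (‖A‖ * P) := by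
      have : A v - v i * a = ∑ j, v (i.succAbove j) *
          A (EuclideanSpace.single (i.succAbove j) (1 : ℝ)) := by
        have hexp : A v = ∑ j, v j * A (EuclideanSpace.single j (1 : ℝ)) := by
          conv_lhs => rw [hsum v]
          rw [map_sum]
          simp only [map_smul, smul_eq_mul]
        rw [hexp, Fin.sum_univ_succAbove _ i, ha]
        ring
      rw [this]
      refine (Finset.abs_sum_le_sum_abs _ _).trans ?_
      refine (Finset.sum_le_sum (g := fun _ => ‖A‖ * P) fun j _ => ?_).trans (by simp)
      rw [abs_mul, mul_comm]
      refine mul_le_mul ?_ (hcoord j) (abs_nonneg _) (norm_nonneg _)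
      have := A.le_opNorm (EuclideanSpace.single (i.succAbove j) (1 : ℝ))
      rwa [hnorm1, mul_one] at this
    have h2 : |v i| * |a| ≤ |a| / 2 * ‖v‖ + m * (‖A‖ * P) := by
      rw [← abs_mul]
      calc |v i * a| = |A v - (A v - v i * a)| := by ring_nf
        _ ≤ |A v| + |A v - v i * a| := abs_sub _ _
        _ ≤ _ := add_le_add h1 hAv
    rw [dist_eq_norm, ← hv]
    nlinarith [mul_le_mul_of_nonneg_left hnv ha0.le]
  refine ⟨i, r, Real.toNNReal (2 * m * (‖A‖ + |a|) / |a|), hr, fun y hy z hz => ?_⟩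
  rw [Real.coe_toNNReal _ (by positivity), div_mul_eq_mul_div, le_div_iff₀ ha0, mul_comm]
  exact hmain y hy z hz

theorem CapControlled.mono {μ ν : Measure (E n)} (h : CapControlled ν) (hle : μ ≤ ν) :
    CapControlled μ := fun η hη => by
  obtain ⟨ε, h1, h2, h3⟩ := h η hη
  exact ⟨ε, h1, h2, fun φ a b c => (hle _).trans (h3 φ a b c)⟩

theorem CapControlled.add {μ ν : Measure (E n)} (hμ : CapControlled μ) (hν : CapControlled ν) :
    CapControlled (μ + ν) := fun η hη => by
  obtain ⟨ε, h1, h2, h3⟩ := hμ (η / 2) (ENNReal.half_pos hη.ne')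
  obtain ⟨δ, h4, h5, h6⟩ := hν (η / 2) (ENNReal.half_pos hη.ne')
  refine ⟨min ε δ, lt_min h1 h4, ((min_le_left _ _).trans_lt h2.lt_top).ne, fun φ a b c => ?_⟩
  rw [Measure.add_apply, ← ENNReal.add_halves η]
  exact add_le_add (h3 φ a (b.trans (min_le_left _ _)) (c.trans (min_le_left _ _)))
    (h6 φ a (b.trans (min_le_right _ _)) (c.trans (min_le_right _ _)))

theorem capControlled_zero : CapControlled (0 : Measure (E n)) :=
  fun η _ => ⟨1, one_pos, by simp, fun φ _ _ _ => by simp⟩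

/-- A quadratic estimate on test functions implies continuity with respect to the capacity. -/
theorem capControlled_of_isCompact {μ : Measure (E n)} {K : Set (E n)} (hK : IsCompact K)
    {C : ℝ≥0∞} (hC : C ≠ ⊤) (h : ∀ ψ : E n → ℝ, IsTest Set.univ ψ →
      μ ({x | 1 ≤ ψ x}) ≤ C * (eLpNorm ψ 2 volume ^ 2 + eLpNorm (gradient ψ) 2 volume ^ 2))
    (hμK : μ Kᶜ = 0) : CapControlled μ := by
  intro η hη
  obtain ⟨χ, hχ, hχ0, hχ1, hχK⟩ := exists_isTest_one_of_isCompact hK isOpen_univ (Set.subset_univ _)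
  obtain ⟨C₁, hC₁, hb₁⟩ := hχ.exists_softAbs_mul_le
  set M := C * (8 * C₁ ^ 2) with hM
  have hMt : M ≠ ⊤ := ENNReal.mul_ne_top hC (ENNReal.mul_ne_top (by simp) (ENNReal.pow_ne_top hC₁))
  have h0 : min η 1 ≠ 0 := (lt_min hη one_pos).ne'
  -- The threshold is at most `1`, so one of the two factors `ε` in the quadratic bound can be
  -- dropped; `8` is twice the square of `2` in `C₁ * (2 * ε)`.
  refine ⟨min η 1 / (M + 1), ENNReal.div_pos h0 (by simp [hMt]), ENNReal.div_ne_top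
    ((min_le_right _ _).trans_lt (by simp)).ne (by simp), fun φ hφ hφ1 hφ2 => ?_⟩
  set ε := min η 1 / (M + 1) with hε
  have hε1 : ε ≤ 1 := by
    refine ENNReal.div_le_of_le_mul ?_
    rw [one_mul]; exact (min_le_right _ _).trans le_add_self
  have hMε : M * ε ≤ η := by
    calc M * ε ≤ (M + 1) * ε := by gcongr; exact le_self_add
      _ = min η 1 := ENNReal.mul_div_cancel (by simp) (by simp [hMt])
      _ ≤ η := min_le_left _ _
  have hψ : IsTest Set.univ (fun x => softAbs (φ x) * χ x) := hχ.softAbs_mul hφ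
  have hsub : {x | 1 ≤ φ x} ⊆ {x | 1 ≤ softAbs (φ x) * χ x} ∪ Kᶜ := by
    intro x hx
    by_cases hxK : x ∈ K
    · left
      simp only [Set.mem_ofPred_eq, hχK x hxK, mul_one]
      exact one_le_softAbs (le_trans hx (le_abs_self _))
    · exact Or.inr hxK
  have hb : ∀ a b : ℝ≥0∞, a + b ≤ C₁ * (2 * ε) → a ^ 2 + b ^ 2 ≤ 8 * C₁ ^ 2 * ε := by
    intro a b hab
    have h1 : a ≤ C₁ * (2 * ε) := le_self_add.trans hab
    have h2 : b ≤ C₁ * (2 * ε) := le_add_self.trans hab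
    calc a ^ 2 + b ^ 2 ≤ (C₁ * (2 * ε)) ^ 2 + (C₁ * (2 * ε)) ^ 2 := by gcongr
      _ = 8 * C₁ ^ 2 * ε * ε := by ring
      _ ≤ 8 * C₁ ^ 2 * ε * 1 := by gcongr
      _ = _ := mul_one _
  calc μ {x | 1 ≤ φ x} ≤ μ {x | 1 ≤ softAbs (φ x) * χ x} + μ Kᶜ :=
        (measure_mono hsub).trans (measure_union_le _ _)
    _ ≤ C * (8 * C₁ ^ 2 * ε) := by
        rw [hμK, add_zero]
        refine (h _ hψ).trans ?_
        gcongr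
        refine hb _ _ ((hb₁ φ hφ).trans ?_)
        gcongr
        rw [two_mul]; exact add_le_add hφ1 hφ2
    _ = M * ε := by rw [hM]; ring
    _ ≤ η := hMε

/-- The surface measure of a smooth bounded open set is continuous with respect to the
capacity. -/
theorem capControlled_surface {Ω : Set (E (m + 1))} (hΩ : IsOpen Ω) (hb : Bornology.IsBounded Ω)
    (h : HasSmoothBoundary Ω) :
    CapControlled ((Measure.euclideanHausdorffMeasure m : Measure (E (m + 1))).restrict
      (frontier Ω)) := by
  -- Capacity control passes to smaller measures and to sums, so by compactness it is enough to have
  -- it near each boundary point.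
  have hcomp : IsCompact (frontier Ω) := Metric.isCompact_of_isClosed_isBounded isClosed_frontier
    (hb.closure.subset frontier_subset_closure)
  refine hcomp.induction_on (p := fun S => CapControlled
    ((Measure.euclideanHausdorffMeasure m : Measure (E (m + 1))).restrict S)) ?_ ?_ ?_ ?_
  · simpa using capControlled_zero
  · exact fun S T hST hT => hT.mono (Measure.restrict_mono_set _ hST)
  · exact fun S T hS hT => (hS.add hT).mono (Measure.restrict_union_le _ _)
  · intro x hx
    obtain ⟨i, r, L, hr, hL⟩ := h.exists_antilipschitz hΩ hx
    refine ⟨frontier Ω ∩ Metric.ball x r,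
      inter_mem_nhdsWithin _ (Metric.ball_mem_nhds x hr), ?_⟩
    set T := frontier Ω ∩ Metric.ball x r
    have hT : MeasurableSet T := isClosed_frontier.measurableSet.inter measurableSet_ball
    rw [Measure.euclideanHausdorffMeasure_def]
    set c := Measure.addHaarScalarFactor (volume : Measure (EuclideanSpace ℝ (Fin m)))
      (Measure.hausdorffMeasure m)
    refine capControlled_of_isCompact (C := c * (L : ℝ≥0∞) ^ (m : ℝ)) hcomp
      (ENNReal.mul_ne_top (by simp) (ENNReal.rpow_lt_top_of_nonneg (by simp) (by simp)).ne)
      (fun ψ hψ => ?_) ?_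
    · have hms : MeasurableSet {x | 1 ≤ ψ x} :=
        measurableSet_le measurable_const hψ.continuous.measurable
      rw [Measure.restrict_apply hms, Measure.smul_apply]
      set S := {x | 1 ≤ ψ x} ∩ T
      have hinj : Set.InjOn (dropCoord i) S := fun y hy z hz hyz => by
        have := hL y hy.2 z hz.2
        rw [hyz, dist_self, mul_zero] at this
        exact dist_le_zero.1 this
      -- The inverse of the projection is Lipschitz on the projected set, so the Hausdorff measure
      -- of `S` is at most `L^m` times that of its projection.
      have hlip : LipschitzOnWith L (Function.invFunOn (dropCoord i) S) (dropCoord i '' S) := by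
        refine LipschitzOnWith.of_dist_le_mul ?_
        rintro _ ⟨y, hy, rfl⟩ _ ⟨z, hz, rfl⟩
        rw [hinj.leftInvOn_invFunOn hy, hinj.leftInvOn_invFunOn hz]
        exact hL y hy.2 z hz.2
      have himg := hlip.hausdorffMeasure_image_le (d := m) (by simp)
      rw [hinj.leftInvOn_invFunOn.image_image] at himg
      -- The sup norm on the target of `dropCoord` makes Hausdorff measure equal Lebesgue measure
      -- exactly; the Euclidean normalization of `σ` enters only through `c`.
      have hvol : (Measure.hausdorffMeasure m : Measure (Fin m → ℝ)) = volume := by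
        have := hausdorffMeasure_pi_real (ι := Fin m)
        simpa using this
      rw [hvol] at himg
      rw [mul_assoc]
      change (c : ℝ≥0∞) * _ ≤ _
      gcongr
      refine himg.trans ?_
      gcongr
      exact (measure_mono (Set.image_mono Set.inter_subset_left)).trans
        (volume_image_dropCoord_le i hψ)
    · rw [Measure.restrict_apply hcomp.measurableSet.compl]
      have : (frontier Ω)ᶜ ∩ T = ∅ := by
        ext y; simp only [Set.mem_inter_iff, Set.mem_compl_iff, Set.mem_empty_iff_false, iff_false]
        exact fun hy => hy.1 hy.2.1
      rw [this]; simp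

end Trace

/-! ### Approximation by test functions in energy and almost everywhere. -/

theorem tendsto_zero_of_sq {a : ℕ → ℝ≥0∞} (h : Tendsto (fun k => a k ^ 2) atTop (𝓝 0)) :
    Tendsto a atTop (𝓝 0) := by
  have h4 := (ENNReal.continuous_rpow_const (y := (1/2 : ℝ))).continuousAt.tendsto.comp h
  refine (h4.congr fun k => ?_).trans (by simp)
  simp only [Function.comp]
  rw [← ENNReal.rpow_natCast, ← ENNReal.rpow_mul]
  norm_num

theorem memLp_of_tendsto_sub {α F : Type*} [MeasurableSpace α] [NormedAddCommGroup F]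
    {ν : Measure α} {f : ℕ → α → F} {g : α → F} (hf : ∀ k, MemLp (f k) 2 ν)
    (hg : AEStronglyMeasurable g ν)
    (h : Tendsto (fun k => eLpNorm (f k - g) 2 ν) atTop (𝓝 0)) : MemLp g 2 ν := by
  obtain ⟨k, hk⟩ := (h.eventually (gt_mem_nhds (zero_lt_one (α := ℝ≥0∞)))).exists
  have : MemLp (f k - g) 2 ν := ⟨(hf k).1.sub hg, hk.trans (by simp)⟩
  simpa using (hf k).sub this

/-- `φ` is a sequence of test functions on `D` that converges to `u` in energy, almost everywhere,
and `m`-almost everywhere. -/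
structure EnergyApprox [NeZero n] (s : ℝ) (Ω D : Set (E n)) (m : Measure (E n)) (u : E n → ℝ)
    (φ : ℕ → E n → ℝ) : Prop where
  test : ∀ k, IsTest D (φ k)
  grad : Tendsto (fun k => eLpNorm (gradient (φ k) - wgrad u) 2 volume) atTop (𝓝 0)
  dif : Tendsto (fun k => eLpNorm (dif (φ k) - dif u) 2 (kern s Ω)) atTop (𝓝 0)
  ae : ∀ᵐ x, Tendsto (fun k => φ k x) atTop (𝓝 (u x))
  ae' : ∀ᵐ x ∂m, Tendsto (fun k => φ k x) atTop (𝓝 (u x))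

/-- Splits convergence in `η` into its local and nonlocal halves. Uniqueness of weak gradients
identifies the gradient of `φ k - u` with the difference of the gradients. -/
theorem MemX.exists_tendsto [NeZero n] {s : ℝ} {Ω D : Set (E n)} {u : E n → ℝ}
    (h : MemX s Ω D u) : ∃ φ : ℕ → E n → ℝ, (∀ k, IsTest D (φ k)) ∧
      Tendsto (fun k => eLpNorm (φ k - u) (ENNReal.ofReal (2 * n / (n - 2))) volume) atTop (𝓝 0) ∧
      Tendsto (fun k => eLpNorm (gradient (φ k) - wgrad u) 2 volume) atTop (𝓝 0) ∧
      Tendsto (fun k => eLpNorm (MixedPicone.dif (φ k) - MixedPicone.dif u) 2 (kern s Ω)) atTop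
        (𝓝 0) := by
  obtain ⟨hL, hG, φ, hφ, h1, h2⟩ := h
  have hw := hasWeakGradient_wgrad hG
  have h3 : Tendsto (fun k => scalarSq s Ω (φ k - u)) atTop (𝓝 0) :=
    tendsto_of_tendsto_of_tendsto_of_le_of_le tendsto_const_nhds h2 (fun _ => zero_le)
      fun k => scalarSq_le_etaSq _ _ _
  simp only [scalarSq_eq] at h3
  refine ⟨φ, hφ, h1, tendsto_zero_of_sq ?_, tendsto_zero_of_sq ?_⟩
  · refine tendsto_of_tendsto_of_tendsto_of_le_of_le tendsto_const_nhds h3 (fun _ => zero_le)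
      fun k => ?_
    refine le_trans (le_of_eq ?_) le_self_add
    rw [eLpNorm_congr_ae ((hasWeakGradient_gradient (hφ k).1).sub hw).wgrad_ae_eq]
  · refine tendsto_of_tendsto_of_tendsto_of_le_of_le tendsto_const_nhds h3 (fun _ => zero_le)
      fun k => ?_
    refine le_trans (le_of_eq ?_) le_add_self
    congr 2
    ext p
    simp [MixedPicone.dif]; ring

theorem MemX.memLp_wgrad [NeZero n] {s : ℝ} {Ω D : Set (E n)} {u : E n → ℝ}
    (h : MemX s Ω D u) : MemLp (wgrad u) 2 volume := by
  obtain ⟨φ, hφ, -, h2, -⟩ := h.exists_tendsto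
  exact memLp_of_tendsto_sub (fun k => (hφ k).memLp_gradient 2)
    (hasWeakGradient_wgrad h.2.1).2.1.aestronglyMeasurable h2

theorem MemX.memLp_dif [NeZero n] {s : ℝ} (hs0 : 0 < s) (hs1 : s < 1) {Ω D : Set (E n)}
    {u : E n → ℝ} (h : MemX s Ω D u) : MemLp (MixedPicone.dif u) 2 (kern s Ω) := by
  obtain ⟨φ, hφ, -, -, h2⟩ := h.exists_tendsto
  exact memLp_of_tendsto_sub (fun k => MemLp.dif_test hs0 hs1 Ω (hφ k))
    (aestronglyMeasurable_dif h.1.1 s Ω) h2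

theorem two_le_sobolev_exponent (hn : 2 < n) : 2 ≤ ENNReal.ofReal (2 * n / (n - 2)) := by
  have h2 : (2 : ℝ) < n := by exact_mod_cast hn
  have : (2 : ℝ) ≤ 2 * n / (n - 2) := by
    rw [le_div_iff₀ (by linarith)]; linarith
  simpa using ENNReal.ofReal_le_ofReal this

/-- Two successive subsequences: capacity control gives convergence in `m`-measure, and convergence
in `L^{2n/(n-2)}` gives convergence in Lebesgue measure. The capacity step needs this exponent to be
at least `2`. -/
theorem MemX.exists_energyApprox [NeZero n] (hn : 2 < n) {s : ℝ}
    {Ω D : Set (E n)} {u : E n → ℝ} (h : MemX s Ω D u) (hq : IsQuasicontinuous u)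
    {m : Measure (E n)} (hm : CapControlled m) {K : Set (E n)} (hK : IsCompact K)
    (hmK : m Kᶜ = 0) : ∃ φ, EnergyApprox s Ω D m u φ := by
  obtain ⟨φ, hφ, h1, h2, h3⟩ := h.exists_tendsto
  have hp := two_le_sobolev_exponent hn
  have t1 : TendstoInMeasure m φ atTop u :=
    hm.tendstoInMeasure hK hmK hp hq (hasWeakGradient_wgrad h.2.1) (fun k => (hφ k).1) h1 h2
  obtain ⟨ns, hns, hae⟩ := t1.exists_seq_tendsto_ae
  have t2 : TendstoInMeasure volume (fun k => φ (ns k)) atTop u :=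
    tendstoInMeasure_of_tendsto_eLpNorm (two_pos.trans_le hp).ne'
      (fun k => (hφ _).continuous.aestronglyMeasurable) h.1.1 (h1.comp hns.tendsto_atTop)
  obtain ⟨ms, hms, hae'⟩ := t2.exists_seq_tendsto_ae
  refine ⟨fun k => φ (ns (ms k)), fun k => hφ _, h2.comp (hns.comp hms).tendsto_atTop,
    h3.comp (hns.comp hms).tendsto_atTop, hae', ?_⟩
  filter_upwards [hae] with x hx using hx.comp hms.tendsto_atTop

/-! ### The smooth cut-off, with bounds uniform in `δ`. -/

/-- A smooth cut-off of `b` that is small for small `c` and close to `b` for `c` close to `b`. -/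
def cut (δ b c : ℝ) : ℝ := 2 * b ^ 2 * c / (b ^ 2 + c ^ 2 + δ)

/-- The partial derivative of `cut` in the first variable. -/
def cutFst (δ b c : ℝ) : ℝ :=
  4 * b * c / (b ^ 2 + c ^ 2 + δ) - 4 * b ^ 3 * c / (b ^ 2 + c ^ 2 + δ) ^ 2

/-- The partial derivative of `cut` in the second variable. -/
def cutSnd (δ b c : ℝ) : ℝ :=
  2 * b ^ 2 / (b ^ 2 + c ^ 2 + δ) - 4 * b ^ 2 * c ^ 2 / (b ^ 2 + c ^ 2 + δ) ^ 2

section Cut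

theorem cut_denom_pos {δ : ℝ} (hδ : 0 < δ) (b c : ℝ) : 0 < b ^ 2 + c ^ 2 + δ := by positivity

/-- From `2|b||c| ≤ b² + c²`. This keeps the truncated weight below `v² / u`, as the negative parts
require. -/
theorem abs_cut_le_fst {δ : ℝ} (hδ : 0 < δ) (b c : ℝ) : |cut δ b c| ≤ |b| := by
  have hS := cut_denom_pos hδ b c
  rw [cut, abs_div, abs_of_pos hS, div_le_iff₀ hS, abs_mul, abs_mul, abs_pow, sq_abs]
  have h2 : |(2 : ℝ)| = 2 := by norm_num
  rw [h2]
  have hb := sq_abs b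
  have hc := sq_abs c
  have : 2 * |b| * |c| ≤ b ^ 2 + c ^ 2 + δ := by nlinarith [sq_nonneg (|b| - |c|)]
  calc 2 * b ^ 2 * |c| = |b| * (2 * |b| * |c|) := by rw [← hb]; ring
    _ ≤ _ := mul_le_mul_of_nonneg_left this (abs_nonneg b)

/-- Lets the fixed test function in the second slot supply the integrable majorant. -/
theorem abs_cut_le_snd {δ : ℝ} (hδ : 0 < δ) (b c : ℝ) : |cut δ b c| ≤ 2 * |c| := by
  have hS := cut_denom_pos hδ b c
  rw [cut, abs_div, abs_of_pos hS, div_le_iff₀ hS, abs_mul, abs_mul, abs_pow, sq_abs]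
  have h2 : |(2 : ℝ)| = 2 := by norm_num
  rw [h2]
  have : 0 ≤ |c| * (c ^ 2 + δ) := by positivity
  nlinarith

theorem hasDerivAt_cut_fst {δ : ℝ} (hδ : 0 < δ) (b c : ℝ) :
    HasDerivAt (fun b => cut δ b c) (cutFst δ b c) b := by
  have hS := (cut_denom_pos hδ b c).ne'
  have h1 : HasDerivAt (fun b : ℝ => 2 * b ^ 2 * c) (4 * b * c) b := by
    have := ((hasDerivAt_pow 2 b).const_mul 2).mul_const c
    convert! this using 1
    change 4 * b * c = 2 * (((2 : ℕ) : ℝ) * b ^ 1) * c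
    push_cast; ring
  have h2 : HasDerivAt (fun b : ℝ => b ^ 2 + c ^ 2 + δ) (2 * b) b := by
    have := ((hasDerivAt_pow 2 b).add_const (c ^ 2)).add_const δ
    convert! this using 1
    simp
  convert! h1.fun_div h2 hS using 1
  rw [cutFst]; field_simp; ring

theorem hasDerivAt_cut_snd {δ : ℝ} (hδ : 0 < δ) (b c : ℝ) :
    HasDerivAt (fun c => cut δ b c) (cutSnd δ b c) c := by
  have hS := (cut_denom_pos hδ b c).ne'
  have h1 : HasDerivAt (fun c : ℝ => 2 * b ^ 2 * c) (2 * b ^ 2) c := by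
    simpa using (hasDerivAt_id c).const_mul (2 * b ^ 2)
  have h2 : HasDerivAt (fun c : ℝ => b ^ 2 + c ^ 2 + δ) (2 * c) c := by
    have := ((hasDerivAt_pow 2 c).const_add (b ^ 2)).add_const δ
    convert! this using 1
    simp
  convert! h1.fun_div h2 hS using 1
  rw [cutSnd]; field_simp; ring

theorem abs_cutFst_le {δ : ℝ} (hδ : 0 < δ) (b c : ℝ) : |cutFst δ b c| ≤ 4 := by
  have hS := cut_denom_pos hδ b c
  have hb := sq_abs b
  have hc := sq_abs c
  have h1 : |4 * b * c| ≤ 2 * (b ^ 2 + c ^ 2 + δ) := by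
    rw [abs_mul, abs_mul]
    have h4 : |(4 : ℝ)| = 4 := by norm_num
    rw [h4]; nlinarith [sq_nonneg (|b| - |c|)]
  have e1 : |4 * b * c / (b ^ 2 + c ^ 2 + δ)| ≤ 2 := by
    rwa [abs_div, abs_of_pos hS, div_le_iff₀ hS]
  have e2 : |4 * b ^ 3 * c / (b ^ 2 + c ^ 2 + δ) ^ 2| ≤ 2 := by
    rw [abs_div, abs_of_pos (pow_pos hS 2), div_le_iff₀ (pow_pos hS 2)]
    have : |4 * b ^ 3 * c| = |4 * b * c| * b ^ 2 := by
      have h5 : 4 * b ^ 3 * c = 4 * b * c * b ^ 2 := by ring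
      rw [h5, abs_mul _ (b ^ 2), abs_of_nonneg (sq_nonneg b)]
    rw [this]
    have : b ^ 2 ≤ b ^ 2 + c ^ 2 + δ := by nlinarith [sq_nonneg c]
    calc |4 * b * c| * b ^ 2 ≤ 2 * (b ^ 2 + c ^ 2 + δ) * (b ^ 2 + c ^ 2 + δ) :=
          mul_le_mul h1 this (sq_nonneg _) (by positivity)
      _ = _ := by ring
  rw [cutFst]
  exact (abs_sub _ _).trans (by linarith)

theorem abs_cutSnd_le {δ : ℝ} (hδ : 0 < δ) (b c : ℝ) : |cutSnd δ b c| ≤ 4 := by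
  have hS := cut_denom_pos hδ b c
  have e1 : |2 * b ^ 2 / (b ^ 2 + c ^ 2 + δ)| ≤ 2 := by
    rw [abs_of_nonneg (by positivity), div_le_iff₀ hS]; nlinarith [sq_nonneg c]
  have e2 : |4 * b ^ 2 * c ^ 2 / (b ^ 2 + c ^ 2 + δ) ^ 2| ≤ 2 := by
    rw [abs_of_nonneg (by positivity), div_le_iff₀ (by positivity)]
    have h1 : b ^ 2 ≤ b ^ 2 + c ^ 2 + δ := by nlinarith [sq_nonneg c]
    have h2 : b ^ 2 * c ^ 2 * 2 ≤ (b ^ 2 + c ^ 2) ^ 2 := by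
      nlinarith [sq_nonneg (b ^ 2), sq_nonneg (c ^ 2)]
    have h3 : (b ^ 2 + c ^ 2) ^ 2 ≤ (b ^ 2 + c ^ 2 + δ) ^ 2 :=
      pow_le_pow_left₀ (by positivity) (by linarith) 2
    linarith
  rw [cutSnd]
  exact (abs_sub _ _).trans (by linarith)

/-- The Lipschitz constant does not depend on `δ`; otherwise the nonlocal energy could not be
controlled as `δ → 0`. -/
theorem abs_cut_sub_cut_le {δ : ℝ} (hδ : 0 < δ) (b c : ℝ) (b' c' : ℝ) :
    |cut δ b c - cut δ b' c'| ≤ 4 * (|b - b'| + |c - c'|) := by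
  have h1 : |cut δ b c - cut δ b' c| ≤ 4 * |b - b'| := by
    have := convex_univ.norm_image_sub_le_of_norm_hasDerivWithin_le (f := fun b => cut δ b c)
      (C := 4) (x := b') (y := b)
      (fun x _ => (hasDerivAt_cut_fst hδ x c).hasDerivWithinAt)
      (fun x _ => abs_cutFst_le hδ x c) (Set.mem_univ _) (Set.mem_univ _)
    simpa using this
  have h2 : |cut δ b' c - cut δ b' c'| ≤ 4 * |c - c'| := by
    have := convex_univ.norm_image_sub_le_of_norm_hasDerivWithin_le (f := fun c => cut δ b' c)
      (C := 4) (x := c') (y := c)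
      (fun x _ => (hasDerivAt_cut_snd hδ b' x).hasDerivWithinAt)
      (fun x _ => abs_cutSnd_le hδ b' x) (Set.mem_univ _) (Set.mem_univ _)
    simpa using this
  calc |cut δ b c - cut δ b' c'| ≤ |cut δ b c - cut δ b' c| + |cut δ b' c - cut δ b' c'| :=
        abs_sub_le _ _ _
    _ ≤ _ := by linarith

theorem contDiff_cut {δ : ℝ} (hδ : 0 < δ) : ContDiff ℝ ∞ fun p : ℝ × ℝ => cut δ p.1 p.2 := by
  unfold cut
  exact ContDiff.div (by fun_prop) (by fun_prop) fun p => (cut_denom_pos hδ p.1 p.2).ne'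

theorem continuous_cut {δ : ℝ} (hδ : 0 < δ) : Continuous fun p : ℝ × ℝ => cut δ p.1 p.2 :=
  (contDiff_cut hδ).continuous

theorem continuous_cutFst {δ : ℝ} (hδ : 0 < δ) : Continuous fun p : ℝ × ℝ => cutFst δ p.1 p.2 := by
  unfold cutFst
  refine Continuous.sub (Continuous.div (by fun_prop) (by fun_prop) fun p => ?_)
    (Continuous.div (by fun_prop) (by fun_prop) fun p => ?_)
  · exact (cut_denom_pos hδ p.1 p.2).ne'
  · exact pow_ne_zero 2 (cut_denom_pos hδ p.1 p.2).ne'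

theorem continuous_cutSnd {δ : ℝ} (hδ : 0 < δ) : Continuous fun p : ℝ × ℝ => cutSnd δ p.1 p.2 := by
  unfold cutSnd
  refine Continuous.sub (Continuous.div (by fun_prop) (by fun_prop) fun p => ?_)
    (Continuous.div (by fun_prop) (by fun_prop) fun p => ?_)
  · exact (cut_denom_pos hδ p.1 p.2).ne'
  · exact pow_ne_zero 2 (cut_denom_pos hδ p.1 p.2).ne'

theorem gradient_cut {δ : ℝ} (hδ : 0 < δ) {f g : E n → ℝ} {x : E n} (hf : DifferentiableAt ℝ f x)
    (hg : DifferentiableAt ℝ g x) : gradient (fun y => cut δ (f y) (g y)) x =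
      cutFst δ (f x) (g x) • gradient f x + cutSnd δ (f x) (g x) • gradient g x := by
  have hd : DifferentiableAt ℝ (fun p : ℝ × ℝ => cut δ p.1 p.2) (f x, g x) :=
    (contDiff_cut hδ).differentiable (by simp) _
  set A := fderiv ℝ (fun p : ℝ × ℝ => cut δ p.1 p.2) (f x, g x)
  have hA1 : A (1, 0) = cutFst δ (f x) (g x) := by
    have h1 : HasDerivAt (fun t : ℝ => (t, g x)) ((1 : ℝ), (0 : ℝ)) (f x) :=
      (hasDerivAt_id _).prodMk (hasDerivAt_const _ _)
    exact (hd.hasFDerivAt.comp_hasDerivAt (f := fun t : ℝ => (t, g x)) (f x) h1).unique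
      (hasDerivAt_cut_fst hδ (f x) (g x))
  have hA2 : A (0, 1) = cutSnd δ (f x) (g x) := by
    have h1 : HasDerivAt (fun t : ℝ => (f x, t)) ((0 : ℝ), (1 : ℝ)) (g x) :=
      (hasDerivAt_const _ _).prodMk (hasDerivAt_id _)
    exact (hd.hasFDerivAt.comp_hasDerivAt (f := fun t : ℝ => (f x, t)) (g x) h1).unique
      (hasDerivAt_cut_snd hδ (f x) (g x))
  have h := (hd.hasFDerivAt.comp x (hf.hasFDerivAt.prodMk hg.hasFDerivAt)).fderiv
  simp only [Function.comp_def] at h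
  refine ext_inner_right ℝ fun e => ?_
  rw [inner_gradient_left, inner_add_left, inner_smul_left, inner_smul_left, inner_gradient_left,
    inner_gradient_left, h]
  simp only [ContinuousLinearMap.comp_apply, ContinuousLinearMap.prod_apply, conj_trivial]
  have : (fderiv ℝ f x e, fderiv ℝ g x e)
      = fderiv ℝ f x e • ((1 : ℝ), (0 : ℝ)) + fderiv ℝ g x e • ((0 : ℝ), (1 : ℝ)) := by simp
  rw [this, map_add, map_smul, map_smul]
  change fderiv ℝ f x e • A (1, 0) + fderiv ℝ g x e • A (0, 1) = _
  rw [hA1, hA2]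
  simp [mul_comm]

end Cut

section CutLimits

theorem tendsto_cut {δ c : ℕ → ℝ} {b : ℝ} (hδ : Tendsto δ atTop (𝓝 0))
    (hc : Tendsto c atTop (𝓝 b)) : Tendsto (fun j => cut (δ j) b (c j)) atTop (𝓝 b) := by
  by_cases hb : b = 0
  · subst hb; simp [cut]
  · have hS : Tendsto (fun j => b ^ 2 + c j ^ 2 + δ j) atTop (𝓝 (b ^ 2 + b ^ 2 + 0)) :=
      ((hc.pow 2).const_add _).add hδ
    have h := (hc.const_mul (2 * b ^ 2)).div hS (by positivity)
    have e : 2 * b ^ 2 * b / (b ^ 2 + b ^ 2 + 0) = b := by field_simp; ring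
    rwa [e] at h

/-- The separate partial derivatives need no attention: if `∇c` is close to `∇b`, only their sum
matters. At `b = 0` both vanish identically, so the limit there is `0`. -/
theorem tendsto_cutFst_add_cutSnd {δ c : ℕ → ℝ} {b : ℝ} (hδ : Tendsto δ atTop (𝓝 0))
    (hc : Tendsto c atTop (𝓝 b)) :
    Tendsto (fun j => cutFst (δ j) b (c j) + cutSnd (δ j) b (c j)) atTop
      (𝓝 (if b = 0 then 0 else 1)) := by
  by_cases hb : b = 0
  · subst hb
    simp [cutFst, cutSnd]
  · rw [if_neg hb]
    have hS : Tendsto (fun j => b ^ 2 + c j ^ 2 + δ j) atTop (𝓝 (b ^ 2 + b ^ 2 + 0)) :=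
      ((hc.pow 2).const_add _).add hδ
    have h1 := ((hc.const_mul (4 * b)).div hS (by positivity)).sub
      ((hc.const_mul (4 * b ^ 3)).div (hS.pow 2) (by positivity))
    have h2 := (((tendsto_const_nhds : Tendsto (fun _ : ℕ => 2 * b ^ 2) atTop _)).div hS
      (by positivity)).sub
      (((hc.pow 2).const_mul (4 * b ^ 2)).div (hS.pow 2) (by positivity))
    have e : 4 * b * b / (b ^ 2 + b ^ 2 + 0) - 4 * b ^ 3 * b / (b ^ 2 + b ^ 2 + 0) ^ 2 +
      (2 * b ^ 2 / (b ^ 2 + b ^ 2 + 0) - 4 * b ^ 2 * b ^ 2 / (b ^ 2 + b ^ 2 + 0) ^ 2) = 1 := by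
      field_simp; ring
    have h3 := h1.add h2
    rw [e] at h3
    exact h3

end CutLimits

/-! ### A smooth positive denominator, needed because approximations of `u` may be negative. -/

/-- A smooth positive function that equals `ε + a` for `a ≥ 0`. -/
def shift (ε a : ℝ) : ℝ := ε + a * Real.smoothTransition (2 + 4 * a / ε)

section Shift

theorem shift_of_le {ε : ℝ} (hε : 0 < ε) {a : ℝ} (ha : -(ε / 4) ≤ a) : shift ε a = ε + a := by
  have : 1 ≤ 2 + 4 * a / ε := by
    have : -1 ≤ 4 * a / ε := by rw [le_div_iff₀ hε]; linarith
    linarith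
  rw [shift, Real.smoothTransition.one_of_one_le this, mul_one]

theorem shift_of_le_neg {ε : ℝ} (hε : 0 < ε) {a : ℝ} (ha : a ≤ -(ε / 2)) : shift ε a = ε := by
  have : 2 + 4 * a / ε ≤ 0 := by
    have : 4 * a / ε ≤ -2 := by rw [div_le_iff₀ hε]; linarith
    linarith
  rw [shift, Real.smoothTransition.zero_of_nonpos this, mul_zero, add_zero]

theorem half_le_shift {ε : ℝ} (hε : 0 < ε) (a : ℝ) : ε / 2 ≤ shift ε a := by
  rcases le_total a (-(ε / 2)) with h | h
  · rw [shift_of_le_neg hε h]; linarith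
  · rcases le_total a 0 with h0 | h0
    · have h1 := Real.smoothTransition.le_one (2 + 4 * a / ε)
      rw [shift]; nlinarith
    · rw [shift_of_le hε (by linarith)]; linarith

theorem contDiff_shift (ε : ℝ) : ContDiff ℝ ∞ (shift ε) := by
  unfold shift
  refine contDiff_const.add (contDiff_id.mul (Real.smoothTransition.contDiff.comp ?_))
  exact contDiff_const.add ((contDiff_const.mul contDiff_id).div_const ε)

theorem deriv_shift_of_nonneg {ε : ℝ} (hε : 0 < ε) {a : ℝ} (ha : 0 ≤ a) :
    deriv (shift ε) a = 1 := by
  have h : shift ε =ᶠ[𝓝 a] fun a => ε + a := by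
    filter_upwards [lt_mem_nhds (show -(ε / 4) < a by linarith)] with b hb
      using shift_of_le hε hb.le
  rw [h.deriv_eq]
  simp

/-- The function is constant to the left of `-ε/2` and has slope `1` on the nonnegative axis;
compactness covers the interval between. -/
theorem exists_deriv_shift_le {ε : ℝ} (hε : 0 < ε) :
    ∃ H : ℝ, 0 ≤ H ∧ ∀ a, |deriv (shift ε) a| ≤ H := by
  have hc : Continuous (deriv (shift ε)) := (contDiff_shift ε).continuous_deriv (by simp)
  obtain ⟨M, hM⟩ := isCompact_Icc.exists_bound_of_continuousOn (s := Set.Icc (-ε) 0) hc.continuousOn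
  refine ⟨max M 1, by positivity, fun a => ?_⟩
  by_cases ha : a ∈ Set.Icc (-ε) 0
  · exact (hM a ha).trans (le_max_left _ _)
  · rw [Set.mem_Icc, not_and_or, not_le, not_le] at ha
    rcases ha with ha | ha
    · have h : shift ε =ᶠ[𝓝 a] fun _ => ε := by
        filter_upwards [gt_mem_nhds (show a < -(ε / 2) by linarith)] with b hb
          using shift_of_le_neg hε hb.le
      rw [h.deriv_eq]
      simp
    · rw [deriv_shift_of_nonneg hε ha.le]; simp

end Shift

/-! ### Products and sums of `L²`-convergent sequences. -/

theorem tendsto_const_mul_zero {a : ℕ → ℝ≥0∞} (h : Tendsto a atTop (𝓝 0)) (L : ℝ) :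
    Tendsto (fun k => ENNReal.ofReal L * a k) atTop (𝓝 0) := by
  simpa using ENNReal.Tendsto.const_mul h (Or.inr (ENNReal.ofReal_ne_top (r := L)))

/-- Bounded coefficients that converge almost everywhere preserve `L²` convergence. -/
theorem tendsto_eLpNorm_smul_sub {α F : Type*} [MeasurableSpace α] [NormedAddCommGroup F]
    [NormedSpace ℝ F] {ν : Measure α} {c : ℕ → α → ℝ} {c' : α → ℝ} {X : ℕ → α → F} {X' : α → F}
    {L : ℝ} (hcm : ∀ k, AEStronglyMeasurable (c k) ν) (hcm' : AEStronglyMeasurable c' ν)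
    (hc : ∀ k x, |c k x| ≤ L) (hc' : ∀ x, |c' x| ≤ L)
    (hlim : ∀ᵐ x ∂ν, Tendsto (fun k => c k x) atTop (𝓝 (c' x)))
    (hX : ∀ k, AEStronglyMeasurable (X k) ν) (hX' : MemLp X' 2 ν)
    (h : Tendsto (fun k => eLpNorm (X k - X') 2 ν) atTop (𝓝 0)) :
    Tendsto (fun k => eLpNorm ((fun x => c k x • X k x) - fun x => c' x • X' x) 2 ν) atTop
      (𝓝 0) := by
  have t1 : Tendsto (fun k => eLpNorm (fun x => c k x • (X k - X') x) 2 ν) atTop (𝓝 0) := by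
    refine tendsto_of_tendsto_of_tendsto_of_le_of_le tendsto_const_nhds
      (tendsto_const_mul_zero h L) (fun _ => zero_le) fun k => ?_
    refine eLpNorm_le_mul_eLpNorm_of_ae_le_mul (Eventually.of_forall fun x => ?_) 2
    rw [norm_smul]; exact mul_le_mul_of_nonneg_right (hc k x) (norm_nonneg _)
  have t2 : Tendsto (fun k => eLpNorm (fun x => (c k x - c' x) • X' x) 2 ν) atTop (𝓝 0) := by
    refine tendsto_eLpNorm_two_of_dominated (r := fun _ _ => 0) (q := fun x => 2 * L * ‖X' x‖)
      (fun k => ((hcm k).sub hcm').smul hX'.1) (hX'.norm.const_mul _) (by simp)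
      (fun k => aestronglyMeasurable_const) (fun k => Eventually.of_forall fun x => ?_) ?_
    · have h1 := hc k x
      have h2 := hc' x
      rw [norm_smul, abs_zero, zero_add, abs_mul, abs_norm]
      refine mul_le_mul_of_nonneg_right ?_ (norm_nonneg _)
      refine (abs_sub _ _).trans (le_trans ?_ (le_abs_self _))
      linarith
    · filter_upwards [hlim] with x hx
      simpa using (hx.sub_const (c' x)).smul_const (X' x)
  refine tendsto_of_tendsto_of_tendsto_of_le_of_le tendsto_const_nhds
    (by simpa using t1.add t2) (fun _ => zero_le) fun k => ?_
  refine le_trans (le_of_eq ?_) (eLpNorm_add_le ((hcm k).smul ((hX k).sub hX'.1))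
    (((hcm k).sub hcm').smul hX'.1) (by norm_num))
  congr 1
  ext x
  simp only [Pi.sub_apply, Pi.add_apply, smul_sub, sub_smul]
  abel

theorem tendsto_eLpNorm_add_sub {α F : Type*} [MeasurableSpace α] [NormedAddCommGroup F]
    {ν : Measure α} {X Y : ℕ → α → F} {X' Y' : α → F}
    (hX : ∀ k, AEStronglyMeasurable (X k) ν) (hX' : AEStronglyMeasurable X' ν)
    (hY : ∀ k, AEStronglyMeasurable (Y k) ν) (hY' : AEStronglyMeasurable Y' ν)
    (h1 : Tendsto (fun k => eLpNorm (X k - X') 2 ν) atTop (𝓝 0))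
    (h2 : Tendsto (fun k => eLpNorm (Y k - Y') 2 ν) atTop (𝓝 0)) :
    Tendsto (fun k => eLpNorm ((X k + Y k) - (X' + Y')) 2 ν) atTop (𝓝 0) := by
  refine tendsto_of_tendsto_of_tendsto_of_le_of_le tendsto_const_nhds
    (by simpa using h1.add h2) (fun _ => zero_le) fun k => ?_
  rw [add_sub_add_comm]
  exact eLpNorm_add_le ((hX k).sub hX') ((hY k).sub hY') (by norm_num)

/-! ### Pointwise Picone inequalities and properties of the test function. -/

/-- The test function of the Picone inequality. -/
def picone (δ ε a b c : ℝ) : ℝ := cut δ b c ^ 2 / shift ε a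

section Pointwise

theorem shift_pos {ε : ℝ} (hε : 0 < ε) (a : ℝ) : 0 < shift ε a :=
  (half_pos hε).trans_le (half_le_shift hε a)

theorem picone_nonneg (δ : ℝ) {ε : ℝ} (hε : 0 < ε) (a b c : ℝ) : 0 ≤ picone δ ε a b c :=
  div_nonneg (sq_nonneg _) (shift_pos hε a).le

/-- The majorant is independent of `a` and `b` and is a multiple of the square of a test function,
hence integrable against `∂_ν u` and `𝒩ₛ u`. -/
theorem picone_le {δ ε : ℝ} (hδ : 0 < δ) (hε : 0 < ε) (a b c : ℝ) :
    picone δ ε a b c ≤ 8 / ε * c ^ 2 := by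
  have h1 : cut δ b c ^ 2 ≤ 4 * c ^ 2 := by
    have := pow_le_pow_left₀ (abs_nonneg _) (abs_cut_le_snd hδ b c) 2
    rw [sq_abs, mul_pow, sq_abs] at this
    linarith
  rw [picone, div_le_iff₀ (shift_pos hε a)]
  have h2 : 8 / ε * c ^ 2 * (ε / 2) ≤ 8 / ε * c ^ 2 * shift ε a := by
    gcongr; exact half_le_shift hε a
  have h3 : 8 / ε * c ^ 2 * (ε / 2) = 4 * c ^ 2 := by field_simp; ring
  linarith

/-- The nonlocal Picone inequality. -/
theorem mul_sub_le_sq_sub {ε a a' w w' : ℝ} (hε : 0 < ε) (ha : 0 ≤ a) (ha' : 0 ≤ a') :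
    (a - a') * (w ^ 2 / shift ε a - w' ^ 2 / shift ε a') ≤ (w - w') ^ 2 := by
  rw [shift_of_le hε (by linarith), shift_of_le hε (by linarith)]
  set p := ε + a
  set q := ε + a'
  have hp : 0 < p := by positivity
  have hq : 0 < q := by positivity
  have e : a - a' = p - q := by simp only [p, q]; ring
  rw [e]
  -- The defect is an explicit square, zero exactly when `w / p = w' / q`.
  have h1 : (w - w') ^ 2 - (p - q) * (w ^ 2 / p - w' ^ 2 / q) = (w * q - w' * p) ^ 2 / (p * q) := by
    field_simp; ring
  have h2 : 0 ≤ (w * q - w' * p) ^ 2 / (p * q) := by positivity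
  linarith

/-- The local Picone inequality. -/
theorem inner_picone_le {F : Type*} [NormedAddCommGroup F] [InnerProductSpace ℝ F] (X Y : F)
    (w h : ℝ) : inner ℝ X ((2 * w / h) • Y - (w ^ 2 / h ^ 2) • X) ≤ ‖Y‖ ^ 2 := by
  have h1 : 0 ≤ ‖Y - (w / h) • X‖ ^ 2 := by positivity
  rw [norm_sub_sq_real, inner_smul_right, norm_smul, mul_pow, Real.norm_eq_abs, sq_abs] at h1
  rw [inner_sub_right, inner_smul_right, inner_smul_right, real_inner_self_eq_norm_sq,
    real_inner_comm]
  have e1 : 2 * w / h = 2 * (w / h) := by ring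
  have e2 : w ^ 2 / h ^ 2 = (w / h) ^ 2 := by rw [div_pow]
  rw [e1, e2]
  nlinarith

/-- Bounding `c` bounds the cut-off, so the square and the quotient become globally Lipschitz.
Differences of the test function are thereby dominated by differences of `u`, `v` and `φ`. -/
theorem exists_abs_picone_sub_le {δ ε : ℝ} (hδ : 0 < δ) (hε : 0 < ε) {M : ℝ} (hM : 0 ≤ M) :
    ∃ L : ℝ, 0 ≤ L ∧ ∀ a b c a' b' c' : ℝ, |c| ≤ M → |c'| ≤ M →
      |picone δ ε a b c - picone δ ε a' b' c'| ≤ L * (|a - a'| + |b - b'| + |c - c'|) := by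
  obtain ⟨H, hH0, hH⟩ := exists_deriv_shift_le hε
  refine ⟨32 * M / ε + 16 * M ^ 2 * H / ε ^ 2, by positivity, fun a b c a' b' c' hc hc' => ?_⟩
  set w := cut δ b c
  set w' := cut δ b' c'
  set p := shift ε a
  set q := shift ε a'
  have hp : 0 < p := shift_pos hε a
  have hq : 0 < q := shift_pos hε a'
  have hw : |w| ≤ 2 * M := (abs_cut_le_snd hδ b c).trans (by linarith)
  have hw' : |w'| ≤ 2 * M := (abs_cut_le_snd hδ b' c').trans (by linarith)
  have hip : 1 / p ≤ 2 / ε := by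
    rw [div_le_div_iff₀ hp hε]; have := half_le_shift hε a; linarith
  have hiq : 1 / q ≤ 2 / ε := by
    rw [div_le_div_iff₀ hq hε]; have := half_le_shift hε a'; linarith
  have hpq : |p - q| ≤ H * |a - a'| := by
    have := convex_univ.norm_image_sub_le_of_norm_deriv_le (f := shift ε) (C := H) (x := a')
      (y := a) (fun x _ => (contDiff_shift ε).differentiable (by simp) x) (fun x _ => hH x)
      (Set.mem_univ _) (Set.mem_univ _)
    simpa using this
  have hww : |w - w'| ≤ 4 * (|b - b'| + |c - c'|) := abs_cut_sub_cut_le hδ b c b' c'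
  have e : picone δ ε a b c - picone δ ε a' b' c'
      = (w + w') * (w - w') * (1 / p) - w' ^ 2 * (p - q) * (1 / p) * (1 / q) := by
    change w ^ 2 / p - w' ^ 2 / q = _
    field_simp; ring
  have k1 : |(w + w') * (w - w') * (1 / p)| ≤ (4 * M) * (4 * (|b - b'| + |c - c'|)) * (2 / ε) := by
    rw [abs_mul, abs_mul, abs_of_pos (show 0 < 1 / p by positivity)]
    have : |w + w'| ≤ 4 * M := (abs_add_le _ _).trans (by linarith)
    gcongr
  have k2 : |w' ^ 2 * (p - q) * (1 / p) * (1 / q)|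
      ≤ (2 * M) ^ 2 * (H * |a - a'|) * (2 / ε) * (2 / ε) := by
    rw [abs_mul, abs_mul, abs_mul, abs_of_pos (show 0 < 1 / p by positivity),
      abs_of_pos (show 0 < 1 / q by positivity), abs_pow]
    gcongr
  rw [e]
  refine (abs_sub _ _).trans ((add_le_add k1 k2).trans (le_of_sub_nonneg ?_))
  have : (32 * M / ε + 16 * M ^ 2 * H / ε ^ 2) * (|a - a'| + |b - b'| + |c - c'|)
      - ((4 * M) * (4 * (|b - b'| + |c - c'|)) * (2 / ε)
        + (2 * M) ^ 2 * (H * |a - a'|) * (2 / ε) * (2 / ε))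
      = 32 * M / ε * |a - a'| + 16 * M ^ 2 * H / ε ^ 2 * (|b - b'| + |c - c'|) := by
    field_simp; ring
  rw [this]; positivity

theorem continuous_picone {δ ε : ℝ} (hδ : 0 < δ) (hε : 0 < ε) :
    Continuous fun p : ℝ × ℝ × ℝ => picone δ ε p.1 p.2.1 p.2.2 :=
  (((continuous_cut hδ).comp continuous_snd).pow 2).div
    ((contDiff_shift ε).continuous.comp continuous_fst) fun p => (shift_pos hε p.1).ne'

theorem isTest_picone {δ ε : ℝ} (hδ : 0 < δ) (hε : 0 < ε) {D : Set (E n)} {f g φ : E n → ℝ}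
    (hf : ContDiff ℝ ∞ f) (hg : ContDiff ℝ ∞ g) (hφ : IsTest D φ) :
    IsTest D (fun x => picone δ ε (f x) (g x) (φ x)) := by
  have hsupp : ∀ x, x ∉ tsupport φ → picone δ ε (f x) (g x) (φ x) = 0 := fun x hx => by
    rw [image_eq_zero_of_notMem_tsupport hx]; simp [picone, cut]
  refine ⟨?_, HasCompactSupport.intro hφ.2.1 hsupp, ?_⟩
  · refine ContDiff.div (((contDiff_cut hδ).comp (hg.prodMk hφ.1)).pow 2)
      ((contDiff_shift ε).comp hf) fun x => (shift_pos hε _).ne'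
  · refine (closure_minimal (fun x hx => ?_) (isClosed_tsupport φ)).trans hφ.2.2
    by_contra hn
    exact hx (hsupp x hn)

theorem gradient_picone {δ ε : ℝ} (hδ : 0 < δ) (hε : 0 < ε) {f g φ : E n → ℝ} {x : E n}
    (hf : DifferentiableAt ℝ f x) (hg : DifferentiableAt ℝ g x) (hφ : DifferentiableAt ℝ φ x) :
    gradient (fun x => picone δ ε (f x) (g x) (φ x)) x =
      (2 * cut δ (g x) (φ x) / shift ε (f x)) • (cutFst δ (g x) (φ x) • gradient g x +
        cutSnd δ (g x) (φ x) • gradient φ x) -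
      (cut δ (g x) (φ x) ^ 2 * deriv (shift ε) (f x) / shift ε (f x) ^ 2) • gradient f x := by
  have hw : DifferentiableAt ℝ (fun y => cut δ (g y) (φ y)) x :=
    ((contDiff_cut hδ).differentiable (by simp) _).comp x (hg.prodMk hφ)
  have hs : Differentiable ℝ (shift ε) := (contDiff_shift ε).differentiable (by simp)
  have hp := (shift_pos hε (f x)).ne'
  have hinv : HasDerivAt (fun t => (shift ε t)⁻¹) (-deriv (shift ε) (f x) / shift ε (f x) ^ 2)
      (f x) := (hs (f x)).hasDerivAt.fun_inv hp
  have hsq : HasDerivAt (fun t : ℝ => t ^ 2) (2 * cut δ (g x) (φ x)) (cut δ (g x) (φ x)) := by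
    simpa using hasDerivAt_pow 2 (cut δ (g x) (φ x))
  have e : (fun x => picone δ ε (f x) (g x) (φ x))
      = fun y => cut δ (g y) (φ y) ^ 2 * (shift ε (f y))⁻¹ := by
    ext y; rw [picone, div_eq_mul_inv]
  rw [e, gradient_mul (f := fun y => cut δ (g y) (φ y) ^ 2) (g := fun y => (shift ε (f y))⁻¹)
    (hw.pow 2) ((hinv.differentiableAt).comp x hf),
    gradient_comp (S := fun t => (shift ε t)⁻¹) hinv hf,
    gradient_comp (S := fun t : ℝ => t ^ 2) (f := fun y => cut δ (g y) (φ y)) hsq hw,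
    gradient_cut hδ hg hφ, smul_smul, smul_smul, add_comm, sub_eq_add_neg, ← neg_smul]
  congr 2
  · field_simp
  · field_simp

end Pointwise

/-! ### First limit, in the form: smooth approximations tend to `u` and `v` while `φ` stays fixed.
-/

section Irreducible

attribute [local irreducible] cut cutFst cutSnd shift picone

theorem integral_norm_sq_eq {α F : Type*} [MeasurableSpace α] [NormedAddCommGroup F]
    {ν : Measure α} {f : α → F} (hf : AEStronglyMeasurable f ν) :
    ∫ x, ‖f x‖ ^ 2 ∂ν = (eLpNorm f 2 ν ^ 2).toReal := by
  have hm : AEStronglyMeasurable (fun x => ‖f x‖ ^ 2) ν := hf.norm.pow 2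
  rw [integral_eq_lintegral_of_nonneg_ae (Eventually.of_forall fun x => by positivity) hm,
    lintegral_ofReal_norm_sq]

theorem integrable_norm_sq {α F : Type*} [MeasurableSpace α] [NormedAddCommGroup F]
    {ν : Measure α} {f : α → F} (hf : MemLp f 2 ν) : Integrable (fun x => ‖f x‖ ^ 2) ν :=
  hf.integrable_norm_pow (by norm_num)

theorem aestronglyMeasurable_comp_prod {α : Type*} [MeasurableSpace α] {ν : Measure α}
    {F : ℝ × ℝ → ℝ} (hF : Continuous F) {f g : α → ℝ} (hf : AEStronglyMeasurable f ν)
    (hg : AEStronglyMeasurable g ν) : AEStronglyMeasurable (fun x => F (f x, g x)) ν :=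
  hF.comp_aestronglyMeasurable (hf.prodMk hg)

/-- The weak gradient of `cut δ v φ`. -/
def cutGrad (δ : ℝ) (v φ : E n → ℝ) (x : E n) : E n :=
  cutFst δ (v x) (φ x) • wgrad v x + cutSnd δ (v x) (φ x) • gradient φ x

theorem memLp_cutGrad {δ : ℝ} (hδ : 0 < δ) {D : Set (E n)} {v φ : E n → ℝ}
    (hv : AEStronglyMeasurable v volume) (hw : MemLp (wgrad v) 2 volume) (hφ : IsTest D φ) :
    MemLp (cutGrad δ v φ) 2 volume := by
  have hφm := hφ.continuous.aestronglyMeasurable (μ := (volume : Measure (E n)))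
  refine MemLp.add ?_ ?_
  · exact MemLp.of_le_mul (c := 4) hw
      ((aestronglyMeasurable_comp_prod (continuous_cutFst hδ) hv hφm).smul hw.1)
      (Eventually.of_forall fun x => by
        rw [norm_smul]; exact mul_le_mul_of_nonneg_right (abs_cutFst_le hδ _ _) (norm_nonneg _))
  · have hg := hφ.memLp_gradient 2
    exact MemLp.of_le_mul (c := 4) hg
      ((aestronglyMeasurable_comp_prod (continuous_cutSnd hδ) hv hφm).smul hg.1)
      (Eventually.of_forall fun x => by
        rw [norm_smul]; exact mul_le_mul_of_nonneg_right (abs_cutSnd_le hδ _ _) (norm_nonneg _))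

theorem memLp_dif_cut [NeZero n] {s : ℝ} (hs0 : 0 < s) (hs1 : s < 1) {Ω D : Set (E n)}
    {δ : ℝ} (hδ : 0 < δ) {v φ : E n → ℝ} (hv : AEStronglyMeasurable v volume)
    (hd : MemLp (dif v) 2 (kern s Ω)) (hφ : IsTest D φ) :
    MemLp (dif fun x => cut δ (v x) (φ x)) 2 (kern s Ω) := by
  have hφm := hφ.continuous.aestronglyMeasurable (μ := (volume : Measure (E n)))
  have hφd := MemLp.dif_test hs0 hs1 Ω hφ
  refine MemLp.of_le_mul (c := 4) (hd.norm.add hφd.norm) (aestronglyMeasurable_dif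
    (aestronglyMeasurable_comp_prod (continuous_cut hδ) hv hφm) s Ω)
    (Eventually.of_forall fun p => ?_)
  refine (abs_cut_sub_cut_le hδ _ _ _ _).trans (le_of_eq ?_)
  rw [Real.norm_of_nonneg (by simp only [Pi.add_apply]; positivity)]
  rfl

theorem abs_two_mul_cut_div_shift_le {δ ε M : ℝ} (hδ : 0 < δ) (hε : 0 < ε) (a b : ℝ) {c : ℝ}
    (hc : |c| ≤ M) : |2 * cut δ b c / shift ε a| ≤ 8 * M / ε := by
  have h1 : |cut δ b c| ≤ 2 * M := (abs_cut_le_snd hδ _ _).trans (by linarith)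
  have hM : 0 ≤ M := (abs_nonneg c).trans hc
  have h2 := half_le_shift hε a
  rw [abs_div, abs_of_pos (shift_pos hε a), abs_mul, div_le_div_iff₀ (shift_pos hε a) hε]
  have : |(2 : ℝ)| = 2 := by norm_num
  rw [this]
  calc 2 * |cut δ b c| * ε ≤ 2 * (2 * M) * ε := by gcongr
    _ = 8 * M * (ε / 2) := by ring
    _ ≤ _ := by gcongr

theorem abs_neg_cut_sq_mul_deriv_div_le {δ ε M H : ℝ} (hδ : 0 < δ) (hε : 0 < ε)
    (hH0 : 0 ≤ H) (hH : ∀ a, |deriv (shift ε) a| ≤ H) (a b : ℝ) {c : ℝ} (hc : |c| ≤ M) :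
    |-(cut δ b c ^ 2 * deriv (shift ε) a / shift ε a ^ 2)| ≤ 16 * M ^ 2 * H / ε ^ 2 := by
  have h1 : |cut δ b c| ≤ 2 * M := (abs_cut_le_snd hδ _ _).trans (by linarith)
  have hM : 0 ≤ M := (abs_nonneg c).trans hc
  have h2 := half_le_shift hε a
  have h3 := hH a
  rw [abs_neg, abs_div, abs_mul, abs_pow, abs_of_pos (pow_pos (shift_pos hε a) 2),
    div_le_div_iff₀ (pow_pos (shift_pos hε a) 2) (by positivity)]
  calc |cut δ b c| ^ 2 * |deriv (shift ε) a| * ε ^ 2 ≤ (2 * M) ^ 2 * H * ε ^ 2 := by gcongr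
    _ = 16 * M ^ 2 * H * (ε / 2) ^ 2 := by ring
    _ ≤ _ := by gcongr

theorem tendsto_gradient_cut {D : Set (E n)} {v φ : E n → ℝ} {V : ℕ → E n → ℝ}
    (hV : ∀ k, IsTest D (V k))
    (hVg : Tendsto (fun k => eLpNorm (gradient (V k) - wgrad v) 2 volume) atTop (𝓝 0))
    (hVa : ∀ᵐ x, Tendsto (fun k => V k x) atTop (𝓝 (v x))) (hφ : IsTest D φ)
    (hvm : AEStronglyMeasurable v volume) (hv : MemLp (wgrad v) 2 volume)
    {δ : ℝ} (hδ : 0 < δ) :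
    Tendsto (fun k => eLpNorm ((gradient fun x => cut δ (V k x) (φ x)) - cutGrad δ v φ) 2 volume)
      atTop (𝓝 0) := by
  have hφm := hφ.continuous.aestronglyMeasurable (μ := (volume : Measure (E n)))
  have hVm : ∀ k, AEStronglyMeasurable (V k) volume := fun k =>
    (hV k).continuous.aestronglyMeasurable
  have hgV : ∀ k, MemLp (gradient (V k)) 2 volume := fun k => (hV k).memLp_gradient 2
  have hgφ : MemLp (gradient φ) 2 volume := hφ.memLp_gradient 2
  have m1 : ∀ w : E n → ℝ, AEStronglyMeasurable w volume →
      AEStronglyMeasurable (fun x => cutFst δ (w x) (φ x)) volume := fun w hw =>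
    aestronglyMeasurable_comp_prod (continuous_cutFst hδ) hw hφm
  have m2 : ∀ w : E n → ℝ, AEStronglyMeasurable w volume →
      AEStronglyMeasurable (fun x => cutSnd δ (w x) (φ x)) volume := fun w hw =>
    aestronglyMeasurable_comp_prod (continuous_cutSnd hδ) hw hφm
  have l1 : ∀ᵐ x, Tendsto (fun k => cutFst δ (V k x) (φ x)) atTop (𝓝 (cutFst δ (v x) (φ x))) := by
    filter_upwards [hVa] with x hx
    exact ((continuous_cutFst hδ).tendsto (v x, φ x)).comp (hx.prodMk_nhds tendsto_const_nhds)
  have l2 : ∀ᵐ x, Tendsto (fun k => cutSnd δ (V k x) (φ x)) atTop (𝓝 (cutSnd δ (v x) (φ x))) := by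
    filter_upwards [hVa] with x hx
    exact ((continuous_cutSnd hδ).tendsto (v x, φ x)).comp (hx.prodMk_nhds tendsto_const_nhds)
  have t1 := tendsto_eLpNorm_smul_sub (c := fun k x => cutFst δ (V k x) (φ x))
    (c' := fun x => cutFst δ (v x) (φ x)) (L := 4) (fun k => m1 _ (hVm k)) (m1 _ hvm)
    (fun k x => abs_cutFst_le hδ _ _) (fun x => abs_cutFst_le hδ _ _) l1
    (fun k => (hgV k).1) hv hVg
  have t2 := tendsto_eLpNorm_smul_sub (c := fun k x => cutSnd δ (V k x) (φ x))
    (c' := fun x => cutSnd δ (v x) (φ x)) (L := 4) (fun k => m2 _ (hVm k)) (m2 _ hvm)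
    (fun k x => abs_cutSnd_le hδ _ _) (fun x => abs_cutSnd_le hδ _ _) l2
    (X := fun _ => gradient φ) (fun k => hgφ.1) hgφ (by simp)
  have t3 := tendsto_eLpNorm_add_sub (fun k => (m1 _ (hVm k)).smul (hgV k).1)
    ((m1 _ hvm).smul hv.1) (fun k => (m2 _ (hVm k)).smul hgφ.1) ((m2 _ hvm).smul hgφ.1) t1 t2
  refine t3.congr fun k => ?_
  have e : (gradient fun x => cut δ (V k x) (φ x)) =
      (fun x => cutFst δ (V k x) (φ x) • gradient (V k) x) +
        fun x => cutSnd δ (V k x) (φ x) • gradient φ x := by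
    ext1 x
    exact gradient_cut hδ ((hV k).1.differentiable (by simp) x) (hφ.1.differentiable (by simp) x)
  rw [e]
  rfl

/-- Convergence of the local part of the form along the test functions of the Picone
inequality. -/
theorem tendsto_gradient_picone [NeZero n] {s : ℝ} {Ω D : Set (E n)} {m : Measure (E n)}
    {u v φ : E n → ℝ} {U V : ℕ → E n → ℝ} (hU : EnergyApprox s Ω D m u U)
    (hV : EnergyApprox s Ω D m v V) (hφ : IsTest D φ)
    (hum : AEStronglyMeasurable u volume) (hvm : AEStronglyMeasurable v volume)
    (hu : MemLp (wgrad u) 2 volume) (hv : MemLp (wgrad v) 2 volume)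
    {δ ε : ℝ} (hδ : 0 < δ) (hε : 0 < ε) :
    Tendsto (fun k => eLpNorm ((gradient fun x => picone δ ε (U k x) (V k x) (φ x)) -
      fun x => (2 * cut δ (v x) (φ x) / shift ε (u x)) • cutGrad δ v φ x -
        (cut δ (v x) (φ x) ^ 2 * deriv (shift ε) (u x) / shift ε (u x) ^ 2) • wgrad u x) 2 volume)
      atTop (𝓝 0) := by
  obtain ⟨M, hM⟩ := hφ.2.1.exists_bound_of_continuous hφ.continuous
  obtain ⟨H, hH0, hH⟩ := exists_deriv_shift_le hε
  have hφm := hφ.continuous.aestronglyMeasurable (μ := (volume : Measure (E n)))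
  have hUm : ∀ k, AEStronglyMeasurable (U k) volume := fun k =>
    (hU.test k).continuous.aestronglyMeasurable
  have hVm : ∀ k, AEStronglyMeasurable (V k) volume := fun k =>
    (hV.test k).continuous.aestronglyMeasurable
  have hgU : ∀ k, AEStronglyMeasurable (gradient (U k)) volume := fun k =>
    ((hU.test k).memLp_gradient 2).1
  have hgc : ∀ k, AEStronglyMeasurable (gradient fun x => cut δ (V k x) (φ x)) volume := fun k =>
    (continuous_gradient ((contDiff_cut hδ).comp ((hV.test k).1.prodMk hφ.1))).aestronglyMeasurable
  have hsc : Continuous (shift ε) := (contDiff_shift ε).continuous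
  have hsc' : Continuous (deriv (shift ε)) := (contDiff_shift ε).continuous_deriv (by simp)
  have hcc := continuous_cut hδ
  have c1 : Continuous fun p : ℝ × ℝ × ℝ => 2 * cut δ p.2.1 p.2.2 / shift ε p.1 :=
    (continuous_const.mul (hcc.comp continuous_snd)).div (hsc.comp continuous_fst)
      fun p => (shift_pos hε p.1).ne'
  have c2 : Continuous fun p : ℝ × ℝ × ℝ =>
      -(cut δ p.2.1 p.2.2 ^ 2 * deriv (shift ε) p.1 / shift ε p.1 ^ 2) :=
    ((((hcc.comp continuous_snd).pow 2).mul (hsc'.comp continuous_fst)).div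
      ((hsc.comp continuous_fst).pow 2) fun p => pow_ne_zero 2 (shift_pos hε p.1).ne').neg
  have hlim : ∀ᵐ x, Tendsto (fun k => (U k x, V k x, φ x)) atTop (𝓝 (u x, v x, φ x)) := by
    filter_upwards [hU.ae, hV.ae] with x h1 h2
    exact h1.prodMk_nhds (h2.prodMk_nhds tendsto_const_nhds)
  have hLm : AEStronglyMeasurable (fun x => (u x, v x, φ x)) volume :=
    hum.prodMk (hvm.prodMk hφm)
  have hLkm : ∀ k, AEStronglyMeasurable (fun x => (U k x, V k x, φ x)) volume := fun k =>
    (hUm k).prodMk ((hVm k).prodMk hφm)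
  have n1 := c1.comp_aestronglyMeasurable hLm
  have n2 := c2.comp_aestronglyMeasurable hLm
  have n1' := fun k => c1.comp_aestronglyMeasurable (hLkm k)
  have n2' := fun k => c2.comp_aestronglyMeasurable (hLkm k)
  have l1 := hlim.mono fun x hx => (c1.tendsto _).comp hx
  have l2 := hlim.mono fun x hx => (c2.tendsto _).comp hx
  have hcut := memLp_cutGrad hδ hvm hv hφ
  have t4 := tendsto_eLpNorm_smul_sub
    (c := fun k x => 2 * cut δ (V k x) (φ x) / shift ε (U k x))
    (c' := fun x => 2 * cut δ (v x) (φ x) / shift ε (u x)) (L := 8 * M / ε) n1' n1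
    (fun k x => abs_two_mul_cut_div_shift_le hδ hε _ _ (hM x))
    (fun x => abs_two_mul_cut_div_shift_le hδ hε _ _ (hM x)) l1 hgc hcut
    (tendsto_gradient_cut hV.test hV.grad hV.ae hφ hvm hv hδ)
  have t5 := tendsto_eLpNorm_smul_sub
    (c := fun k x => -(cut δ (V k x) (φ x) ^ 2 * deriv (shift ε) (U k x) / shift ε (U k x) ^ 2))
    (c' := fun x => -(cut δ (v x) (φ x) ^ 2 * deriv (shift ε) (u x) / shift ε (u x) ^ 2))
    (L := 16 * M ^ 2 * H / ε ^ 2) n2' n2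
    (fun k x => abs_neg_cut_sq_mul_deriv_div_le hδ hε hH0 hH _ _ (hM x))
    (fun x => abs_neg_cut_sq_mul_deriv_div_le hδ hε hH0 hH _ _ (hM x)) l2 hgU hu hU.grad
  have t6 := tendsto_eLpNorm_add_sub (fun k => (n1' k).smul (hgc k)) (n1.smul hcut.1)
    (fun k => (n2' k).smul (hgU k)) (n2.smul hu.1) t4 t5
  refine t6.congr fun k => ?_
  congr 1
  ext1 x
  simp only [Pi.sub_apply, Pi.add_apply, Pi.smul_apply']
  rw [gradient_picone hδ hε ((hU.test k).1.differentiable (by simp) x)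
    ((hV.test k).1.differentiable (by simp) x) (hφ.1.differentiable (by simp) x),
    gradient_cut hδ ((hV.test k).1.differentiable (by simp) x) (hφ.1.differentiable (by simp) x)]
  simp only [neg_smul, ← sub_eq_add_neg]

/-- The Lipschitz bound is applied at `(U k, V k, φ)` and at `(u, v, φ)`. The resulting majorant is
fixed up to a multiple of `|dif (U k) - dif u| + |dif (V k) - dif v|`, which tends to zero in `L²`.
-/
theorem tendsto_dif_picone [NeZero n] {s : ℝ} (hs0 : 0 < s) (hs1 : s < 1) {Ω D : Set (E n)}
    {m : Measure (E n)}
    {u v φ : E n → ℝ} {U V : ℕ → E n → ℝ} (hU : EnergyApprox s Ω D m u U)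
    (hV : EnergyApprox s Ω D m v V) (hφ : IsTest D φ)
    (hum : AEStronglyMeasurable u volume) (hvm : AEStronglyMeasurable v volume)
    (hu : MemLp (dif u) 2 (kern s Ω)) (hv : MemLp (dif v) 2 (kern s Ω))
    {δ ε : ℝ} (hδ : 0 < δ) (hε : 0 < ε) :
    Tendsto (fun k => eLpNorm ((dif fun x => picone δ ε (U k x) (V k x) (φ x)) -
      dif fun x => picone δ ε (u x) (v x) (φ x)) 2 (kern s Ω)) atTop (𝓝 0) := by
  obtain ⟨M, hM⟩ := hφ.2.1.exists_bound_of_continuous hφ.continuous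
  have hM0 : 0 ≤ M := (norm_nonneg _).trans (hM 0)
  obtain ⟨L, hL0, hL⟩ := exists_abs_picone_sub_le hδ hε hM0
  have hpc := continuous_picone hδ hε
  have hφm := hφ.continuous.aestronglyMeasurable (μ := (volume : Measure (E n)))
  have hdφ := MemLp.dif_test hs0 hs1 Ω hφ
  have hdU : ∀ k, MemLp (dif (U k)) 2 (kern s Ω) := fun k => MemLp.dif_test hs0 hs1 Ω (hU.test k)
  have hdV : ∀ k, MemLp (dif (V k)) 2 (kern s Ω) := fun k => MemLp.dif_test hs0 hs1 Ω (hV.test k)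
  have hm : AEStronglyMeasurable (dif fun x => picone δ ε (u x) (v x) (φ x)) (kern s Ω) :=
    aestronglyMeasurable_dif (hpc.comp_aestronglyMeasurable (hum.prodMk (hvm.prodMk hφm))) s Ω
  have hmk : ∀ k, AEStronglyMeasurable (dif fun x => picone δ ε (U k x) (V k x) (φ x))
      (kern s Ω) := fun k => (MemLp.dif_test hs0 hs1 Ω
    (isTest_picone hδ hε (hU.test k).1 (hV.test k).1 hφ)).1
  set r : ℕ → E n × E n → ℝ := fun k p =>
    L * ‖(dif (U k) - dif u) p‖ + L * ‖(dif (V k) - dif v) p‖ with hr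
  have mr1 : ∀ k, AEStronglyMeasurable (fun p => L * ‖(dif (U k) - dif u) p‖) (kern s Ω) :=
    fun k => (((hdU k).sub hu).1.norm.const_mul L)
  have mr2 : ∀ k, AEStronglyMeasurable (fun p => L * ‖(dif (V k) - dif v) p‖) (kern s Ω) :=
    fun k => (((hdV k).sub hv).1.norm.const_mul L)
  have hr0 : Tendsto (fun k => eLpNorm (r k) 2 (kern s Ω)) atTop (𝓝 0) := by
    have hle : ∀ w : E n × E n → ℝ, eLpNorm (fun p => L * ‖w p‖) 2 (kern s Ω) ≤
        ENNReal.ofReal L * eLpNorm w 2 (kern s Ω) := fun w =>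
      eLpNorm_le_mul_eLpNorm_of_ae_le_mul (Eventually.of_forall fun p => by
        rw [norm_mul, norm_norm, Real.norm_of_nonneg hL0]) 2
    have := (tendsto_const_mul_zero hU.dif L).add (tendsto_const_mul_zero hV.dif L)
    rw [add_zero] at this
    refine tendsto_of_tendsto_of_tendsto_of_le_of_le tendsto_const_nhds this (fun _ => zero_le)
      fun k => ?_
    exact (eLpNorm_add_le (mr1 k) (mr2 k) (by norm_num)).trans (add_le_add (hle _) (hle _))
  refine tendsto_eLpNorm_two_of_dominated (r := r)
    (q := fun p => 2 * L * (‖dif u p‖ + ‖dif v p‖ + ‖dif φ p‖)) (fun k => (hmk k).sub hm)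
    (((hu.norm.add hv.norm).add hdφ.norm).const_mul _) hr0 (fun k => (mr1 k).add (mr2 k))
    (fun k => Eventually.of_forall fun p => ?_) ?_
  · have h1 := hL (U k p.1) (V k p.1) (φ p.1) (U k p.2) (V k p.2) (φ p.2) (hM _) (hM _)
    have h2 := hL (u p.1) (v p.1) (φ p.1) (u p.2) (v p.2) (φ p.2) (hM _) (hM _)
    have h3 : |dif (U k) p| ≤ |dif (U k) p - dif u p| + |dif u p| := by
      have := abs_add_le (dif (U k) p - dif u p) (dif u p); simpa using this
    have h4 : |dif (V k) p| ≤ |dif (V k) p - dif v p| + |dif v p| := by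
      have := abs_add_le (dif (V k) p - dif v p) (dif v p); simpa using this
    rw [abs_of_nonneg (by positivity), abs_of_nonneg (by positivity)]
    refine (norm_sub_le _ _).trans ((add_le_add h1 h2).trans ?_)
    change L * (|dif (U k) p| + |dif (V k) p| + |dif φ p|) + L * (|dif u p| + |dif v p| + |dif φ p|)
      ≤ L * |dif (U k) p - dif u p| + L * |dif (V k) p - dif v p|
        + 2 * L * (|dif u p| + |dif v p| + |dif φ p|)
    nlinarith [mul_le_mul_of_nonneg_left h3 hL0, mul_le_mul_of_nonneg_left h4 hL0]
  · have hlim : ∀ᵐ x, Tendsto (fun k => picone δ ε (U k x) (V k x) (φ x)) atTop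
        (𝓝 (picone δ ε (u x) (v x) (φ x))) := by
      filter_upwards [hU.ae, hV.ae] with x h1 h2
      exact (hpc.tendsto (u x, v x, φ x)).comp (h1.prodMk_nhds (h2.prodMk_nhds tendsto_const_nhds))
    filter_upwards [ae_kern_of_ae hlim s Ω] with p hp
    have := (hp.1.sub hp.2).sub_const
      (picone δ ε (u p.1) (v p.1) (φ p.1) - picone δ ε (u p.2) (v p.2) (φ p.2))
    rw [sub_self] at this
    exact this

/-- The limit of the form along the test functions of the Picone inequality. -/
theorem exists_tendsto_form_picone [NeZero n] {s : ℝ} (hs0 : 0 < s) (hs1 : s < 1)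
    {Ω D : Set (E n)} {m : Measure (E n)}
    {u v φ : E n → ℝ} {U V : ℕ → E n → ℝ} (hU : EnergyApprox s Ω D m u U)
    (hV : EnergyApprox s Ω D m v V) (hφ : IsTest D φ) (hu : MemX s Ω D u) (hv : MemX s Ω D v)
    (hu0 : ∀ᵐ x, 0 ≤ u x) {δ ε : ℝ} (hδ : 0 < δ) (hε : 0 < ε) :
    ∃ I : ℝ, Tendsto (fun k => form s Ω u fun x => picone δ ε (U k x) (V k x) (φ x)) atTop (𝓝 I) ∧
      I ≤ (eLpNorm (cutGrad δ v φ) 2 volume ^ 2 +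
        eLpNorm (dif fun x => cut δ (v x) (φ x)) 2 (kern s Ω) ^ 2).toReal := by
  have hum := hu.1.1
  have hvm := hv.1.1
  have hug := hu.memLp_wgrad
  have hvg := hv.memLp_wgrad
  have hud := hu.memLp_dif hs0 hs1
  have hvd := hv.memLp_dif hs0 hs1
  have hψ : ∀ k, IsTest D (fun x => picone δ ε (U k x) (V k x) (φ x)) := fun k =>
    isTest_picone hδ hε (hU.test k).1 (hV.test k).1 hφ
  have hφm := hφ.continuous.aestronglyMeasurable (μ := (volume : Measure (E n)))
  have t1 := tendsto_gradient_picone hU hV hφ hum hvm hug hvg hδ hε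
  have t2 := tendsto_dif_picone hs0 hs1 hU hV hφ hum hvm hud hvd hδ hε
  set G : E n → E n := fun x => (2 * cut δ (v x) (φ x) / shift ε (u x)) • cutGrad δ v φ x -
        (cut δ (v x) (φ x) ^ 2 * deriv (shift ε) (u x) / shift ε (u x) ^ 2) • wgrad u x with hG
  set w : E n → ℝ := fun x => cut δ (v x) (φ x) with hw
  have hLm : AEStronglyMeasurable (fun x => (u x, v x, φ x)) volume :=
    hum.prodMk (hvm.prodMk hφm)
  have hwm : AEStronglyMeasurable w volume :=
    aestronglyMeasurable_comp_prod (continuous_cut hδ) hvm hφm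
  have hsm : AEStronglyMeasurable (fun x => shift ε (u x)) volume :=
    (contDiff_shift ε).continuous.comp_aestronglyMeasurable hum
  have hsm' : AEStronglyMeasurable (fun x => deriv (shift ε) (u x)) volume :=
    ((contDiff_shift ε).continuous_deriv (by simp)).comp_aestronglyMeasurable hum
  have hYL := memLp_cutGrad hδ hvm hvg hφ
  have hGm : AEStronglyMeasurable G volume :=
    (((hwm.const_mul 2).div₀ hsm).smul hYL.1).sub
      ((((hwm.pow 2).mul hsm').div₀ (hsm.pow 2)).smul hug.1)
  have hGL : MemLp G 2 volume := memLp_of_tendsto_sub (fun k => (hψ k).memLp_gradient 2) hGm t1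
  have hpm : AEStronglyMeasurable (dif fun x => picone δ ε (u x) (v x) (φ x)) (kern s Ω) :=
    aestronglyMeasurable_dif ((continuous_picone hδ hε).comp_aestronglyMeasurable hLm) s Ω
  have hdL : MemLp (dif fun x => picone δ ε (u x) (v x) (φ x)) 2 (kern s Ω) :=
    memLp_of_tendsto_sub (fun k => MemLp.dif_test hs0 hs1 Ω (hψ k)) hpm t2
  have hdw : MemLp (dif w) 2 (kern s Ω) := memLp_dif_cut hs0 hs1 hδ hvm hvd hφ
  refine ⟨(∫ x in Ω, inner ℝ (wgrad u x) (G x)) + ∫ p, inner ℝ (dif u p)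
    (dif (fun x => picone δ ε (u x) (v x) (φ x)) p) ∂(kern s Ω), ?_, ?_⟩
  · simp only [form_eq]
    refine Tendsto.add ?_ ?_
    · refine tendsto_integral_inner (hug.restrict Ω) (fun k => ((hψ k).memLp_gradient 2).restrict _)
        (hGL.restrict Ω) ?_
      exact tendsto_of_tendsto_of_tendsto_of_le_of_le tendsto_const_nhds t1 (fun _ => zero_le)
        fun k => eLpNorm_mono_measure _ Measure.restrict_le_self
    · exact tendsto_integral_inner hud (fun k => MemLp.dif_test hs0 hs1 Ω (hψ k)) hdL t2
  · rw [ENNReal.toReal_add (ENNReal.pow_ne_top hYL.2.ne) (ENNReal.pow_ne_top hdw.2.ne),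
      ← integral_norm_sq_eq hYL.1, ← integral_norm_sq_eq hdw.1]
    refine add_le_add ?_ ?_
    -- The form integrates gradients over `Ω` only, whereas the energy on the right uses all of
    -- space. Picone's inequality enters only here, after the limit, where `u ≥ 0` makes the
    -- denominator `ε + u` with derivative `1`.
    · refine le_trans ?_ (setIntegral_le_integral (s := Ω) (integrable_norm_sq hYL)
        (Eventually.of_forall fun x => by positivity))
      refine integral_mono_ae (integrable_inner_of_memLp_two (hug.restrict Ω) (hGL.restrict Ω))
        (integrable_norm_sq hYL).restrict (ae_restrict_of_ae ?_)
      filter_upwards [hu0] with x hx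
      simp only [hG]
      rw [deriv_shift_of_nonneg hε hx, mul_one]
      exact inner_picone_le _ _ _ _
    · refine integral_mono_ae (integrable_inner_of_memLp_two hud hdL) (integrable_norm_sq hdw) ?_
      filter_upwards [ae_kern_of_ae hu0 s Ω] with p hp
      have := mul_sub_le_sq_sub (w := w p.1) (w' := w p.2) hε hp.1 hp.2
      simp only [RCLike.inner_apply, conj_trivial, Real.norm_eq_abs, sq_abs]
      rw [mul_comm]
      simp only [dif, picone]
      exact this

end Irreducible

/-! ### First limit, in the measure, boundary and exterior terms. -/

section TestFunctionLimit

attribute [local irreducible] cut cutFst cutSnd shift picone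

theorem aestronglyMeasurable_nonlocalNormal [NeZero n] (s : ℝ) (Ω : Set (E n)) {u : E n → ℝ}
    (hu : AEStronglyMeasurable u volume) :
    AEStronglyMeasurable (nonlocalNormal s Ω u) volume := by
  have h1 : AEStronglyMeasurable (fun p : E n × E n => u p.1 - u p.2)
      ((volume : Measure (E n)).prod (volume.restrict Ω)) :=
    hu.comp_fst.sub hu.restrict.comp_snd
  have h2 : Measurable fun p : E n × E n => ‖p.1 - p.2‖ ^ ((n : ℝ) + 2 * s) := by fun_prop
  have h3 : AEStronglyMeasurable
      (fun p : E n × E n => (u p.1 - u p.2) / ‖p.1 - p.2‖ ^ ((n : ℝ) + 2 * s))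
      ((volume : Measure (E n)).prod (volume.restrict Ω)) :=
    (h1.aemeasurable.div h2.aemeasurable).aestronglyMeasurable
  exact h3.integral_prod_right'.const_mul _

variable {α : Type*} [MeasurableSpace α] {ν : Measure α} {δ ε : ℝ}

theorem aestronglyMeasurable_picone (hδ : 0 < δ) (hε : 0 < ε) {u v φ : α → ℝ}
    (hu : AEStronglyMeasurable u ν) (hv : AEStronglyMeasurable v ν)
    (hφ : AEStronglyMeasurable φ ν) :
    AEStronglyMeasurable (fun x => picone δ ε (u x) (v x) (φ x)) ν :=
  (continuous_picone hδ hε).comp_aestronglyMeasurable (hu.prodMk (hv.prodMk hφ))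

theorem norm_picone_mul_le (hδ : 0 < δ) (hε : 0 < ε) (a b c g : ℝ) :
    ‖picone δ ε a b c * g‖ ≤ 8 / ε * ‖c ^ 2 * g‖ := by
  rw [norm_mul, norm_mul, ← mul_assoc, Real.norm_of_nonneg (picone_nonneg δ hε a b c),
    Real.norm_of_nonneg (sq_nonneg c)]
  exact mul_le_mul_of_nonneg_right (picone_le hδ hε a b c) (norm_nonneg g)

theorem integrable_picone_mul (hδ : 0 < δ) (hε : 0 < ε) {u v φ g : α → ℝ}
    (hu : AEStronglyMeasurable u ν) (hv : AEStronglyMeasurable v ν)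
    (hφ : AEStronglyMeasurable φ ν) (hg : AEStronglyMeasurable g ν)
    (hint : Integrable (fun x => φ x ^ 2 * g x) ν) :
    Integrable (fun x => picone δ ε (u x) (v x) (φ x) * g x) ν :=
  (hint.norm.const_mul (8 / ε)).mono' ((aestronglyMeasurable_picone hδ hε hu hv hφ).mul hg)
    (Eventually.of_forall fun _ => norm_picone_mul_le hδ hε _ _ _ _)

theorem tendsto_integral_picone_mul (hδ : 0 < δ) (hε : 0 < ε) {u v φ g : α → ℝ}
    {U V : ℕ → α → ℝ} (hU : ∀ k, AEStronglyMeasurable (U k) ν)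
    (hV : ∀ k, AEStronglyMeasurable (V k) ν) (hφ : AEStronglyMeasurable φ ν)
    (hg : AEStronglyMeasurable g ν) (hUu : ∀ᵐ x ∂ν, Tendsto (fun k => U k x) atTop (𝓝 (u x)))
    (hVv : ∀ᵐ x ∂ν, Tendsto (fun k => V k x) atTop (𝓝 (v x)))
    (hint : Integrable (fun x => φ x ^ 2 * g x) ν) :
    Tendsto (fun k => ∫ x, picone δ ε (U k x) (V k x) (φ x) * g x ∂ν) atTop
      (𝓝 (∫ x, picone δ ε (u x) (v x) (φ x) * g x ∂ν)) := by
  refine tendsto_integral_of_dominated_convergence _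
    (fun k => (aestronglyMeasurable_picone hδ hε (hU k) (hV k) hφ).mul hg)
    (hint.norm.const_mul (8 / ε))
    (fun k => Eventually.of_forall fun _ => norm_picone_mul_le hδ hε _ _ _ _) ?_
  filter_upwards [hUu, hVv] with x h1 h2
  exact (((continuous_picone hδ hε).tendsto (u x, v x, φ x)).comp
    (h1.prodMk_nhds (h2.prodMk_nhds tendsto_const_nhds))).mul_const _

/-- At fixed truncation both parts are finite, so a signed identity can be rearranged into an
inequality in `[0, ∞]`, where monotonicity and Fatou's lemma apply to each part separately. -/
theorem integral_picone_mul_eq (hε : 0 < ε) {u v φ g : α → ℝ}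
    (hint : Integrable (fun x => picone δ ε (u x) (v x) (φ x) * g x) ν) :
    ∫⁻ x, ENNReal.ofReal (picone δ ε (u x) (v x) (φ x)) * ENNReal.ofReal (g x) ∂ν ≠ ⊤ ∧
    ∫⁻ x, ENNReal.ofReal (picone δ ε (u x) (v x) (φ x)) * ENNReal.ofReal (-g x) ∂ν ≠ ⊤ ∧
    ∫ x, picone δ ε (u x) (v x) (φ x) * g x ∂ν =
      (∫⁻ x, ENNReal.ofReal (picone δ ε (u x) (v x) (φ x)) * ENNReal.ofReal (g x) ∂ν).toReal -
      (∫⁻ x, ENNReal.ofReal (picone δ ε (u x) (v x) (φ x)) *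
        ENNReal.ofReal (-g x) ∂ν).toReal := by
  have e1 : ∀ x, ENNReal.ofReal (picone δ ε (u x) (v x) (φ x)) * ENNReal.ofReal (g x) =
      ENNReal.ofReal (picone δ ε (u x) (v x) (φ x) * g x) := fun x =>
    (ENNReal.ofReal_mul (picone_nonneg δ hε _ _ _)).symm
  have e2 : ∀ x, ENNReal.ofReal (picone δ ε (u x) (v x) (φ x)) * ENNReal.ofReal (-g x) =
      ENNReal.ofReal (-(picone δ ε (u x) (v x) (φ x) * g x)) := fun x => by
    rw [← ENNReal.ofReal_mul (picone_nonneg δ hε _ _ _), mul_neg]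
  simp only [e1, e2]
  have h2 : ∫⁻ x, ENNReal.ofReal (-(picone δ ε (u x) (v x) (φ x) * g x)) ∂ν < ⊤ :=
    hint.neg.lintegral_lt_top
  exact ⟨hint.lintegral_lt_top.ne, h2.ne,
    integral_eq_lintegral_pos_part_sub_lintegral_neg_part hint⟩

end TestFunctionLimit

section FixedTruncation

/-- The Picone inequality with the truncated weight `picone δ ε u v φ` in place of `v² / u`. -/
theorem lintegral_picone_le [NeZero n] {s : ℝ} (hs0 : 0 < s) (hs1 : s < 1)
    {Ω P₂ : Set (E n)} {m μ : Measure (E n)} [IsFiniteMeasure μ]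
    {u v φ g : E n → ℝ} {U V : ℕ → E n → ℝ} (hU : EnergyApprox s Ω (Ω ∪ P₂) m u U)
    (hV : EnergyApprox s Ω (Ω ∪ P₂) m v V) (hφ : IsTest (Ω ∪ P₂) φ)
    (hu : MemX s Ω (Ω ∪ P₂) u) (hv : MemX s Ω (Ω ∪ P₂) v)
    (hu0 : ∀ᵐ x, 0 ≤ u x) (hμm : μ.restrict Ω ≤ m) (hσm : surface Ω P₂ ≤ m)
    (hg : HasWeakNormalDeriv s Ω P₂ u μ g) {δ ε : ℝ} (hδ : 0 < δ) (hε : 0 < ε) :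
    ∫⁻ x in Ω, ENNReal.ofReal (picone δ ε (u x) (v x) (φ x)) ∂μ +
      ∫⁻ x, ENNReal.ofReal (picone δ ε (u x) (v x) (φ x)) * ENNReal.ofReal (g x)
        ∂(surface Ω P₂) +
      ∫⁻ x in P₂, ENNReal.ofReal (picone δ ε (u x) (v x) (φ x)) *
        ENNReal.ofReal (nonlocalNormal s Ω u x) ≤
    eLpNorm (cutGrad δ v φ) 2 volume ^ 2 +
        eLpNorm (dif fun x => cut δ (v x) (φ x)) 2 (kern s Ω) ^ 2 +
      ∫⁻ x, ENNReal.ofReal (picone δ ε (u x) (v x) (φ x)) * ENNReal.ofReal (-g x)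
        ∂(surface Ω P₂) +
      ∫⁻ x in P₂, ENNReal.ofReal (picone δ ε (u x) (v x) (φ x)) *
        ENNReal.ofReal (-nonlocalNormal s Ω u x) := by
  obtain ⟨I, hI, hIle⟩ := exists_tendsto_form_picone hs0 hs1 hU hV hφ hu hv hu0 hδ hε
  have hUm : ∀ (ν : Measure (E n)) k, AEStronglyMeasurable (U k) ν := fun ν k =>
    (hU.test k).continuous.aestronglyMeasurable
  have hVm : ∀ (ν : Measure (E n)) k, AEStronglyMeasurable (V k) ν := fun ν k =>
    (hV.test k).continuous.aestronglyMeasurable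
  have hφm : ∀ ν : Measure (E n), AEStronglyMeasurable φ ν := fun ν =>
    hφ.continuous.aestronglyMeasurable
  -- Green's formula is used at `φ²` only for the integrability it asserts, which yields the
  -- majorants.
  have hsq : IsTest (Ω ∪ P₂) (fun x => φ x ^ 2) := by
    have := hφ.mul_left hφ.1
    simpa only [pow_two] using this
  have iμ : Integrable (fun x => φ x ^ 2 * 1) (μ.restrict Ω) := by
    simpa only [mul_one] using hsq.continuous.integrable_of_hasCompactSupport hsq.2.1
  obtain ⟨iσ, iP, -⟩ := hg.2 _ hsq
  have hN : AEStronglyMeasurable (nonlocalNormal s Ω u) (volume.restrict P₂) :=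
    (aestronglyMeasurable_nonlocalNormal s Ω hu.1.1).restrict
  have aU := hU.ae'
  have aV := hV.ae'
  have aUP := ae_restrict_of_ae (s := P₂) hU.ae
  have aVP := ae_restrict_of_ae (s := P₂) hV.ae
  have aUμ := Measure.absolutelyContinuous_of_le hμm |>.ae_le aU
  have aVμ := Measure.absolutelyContinuous_of_le hμm |>.ae_le aV
  have aUσ := Measure.absolutelyContinuous_of_le hσm |>.ae_le aU
  have aVσ := Measure.absolutelyContinuous_of_le hσm |>.ae_le aV
  have lim : ∀ (ν : Measure (E n)) {w : E n → ℝ} {W : ℕ → E n → ℝ},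
      (∀ k, AEStronglyMeasurable (W k) ν) →
      (∀ᵐ x ∂ν, Tendsto (fun k => W k x) atTop (𝓝 (w x))) → AEStronglyMeasurable w ν :=
    fun ν w W h1 h2 => aestronglyMeasurable_of_tendsto_ae atTop h1 h2
  have t1 := tendsto_integral_picone_mul hδ hε (hUm _) (hVm _) (hφm _)
    (aestronglyMeasurable_const (b := (1 : ℝ))) aUμ aVμ iμ
  have t2 := tendsto_integral_picone_mul hδ hε (hUm _) (hVm _) (hφm _) hg.1 aUσ aVσ iσ
  have t3 := tendsto_integral_picone_mul hδ hε (hUm _) (hVm _) (hφm _) hN aUP aVP iP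
  have j1 := integrable_picone_mul hδ hε (lim _ (hUm _) aUμ) (lim _ (hVm _) aVμ) (hφm _)
    (aestronglyMeasurable_const (b := (1 : ℝ))) iμ
  have j2 := integrable_picone_mul hδ hε (lim _ (hUm _) aUσ) (lim _ (hVm _) aVσ) (hφm _) hg.1 iσ
  have j3 := integrable_picone_mul hδ hε (lim _ (hUm _) aUP) (lim _ (hVm _) aVP) (hφm _) hN iP
  -- Green's formula holds at each smooth stage `k`; both of its sides converge, so it survives for
  -- the non-smooth limit.
  have hlim := tendsto_nhds_unique hI (((t1.add t2).add t3).congr fun k => by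
    have := (hg.2 _ (isTest_picone hδ hε (hU.test k).1 (hV.test k).1 hφ)).2.2
    simp only [mul_one]
    exact this.symm)
  obtain ⟨p1, -, e1⟩ := integral_picone_mul_eq hε j1
  obtain ⟨p2, q2, e2⟩ := integral_picone_mul_eq hε j2
  obtain ⟨p3, q3, e3⟩ := integral_picone_mul_eq hε j3
  have hR1 := memLp_cutGrad hδ hv.1.1 hv.memLp_wgrad hφ
  have hR2 := memLp_dif_cut hs0 hs1 hδ hv.1.1 (hv.memLp_dif hs0 hs1) hφ
  have hR : eLpNorm (cutGrad δ v φ) 2 volume ^ 2 +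
      eLpNorm (dif fun x => cut δ (v x) (φ x)) 2 (kern s Ω) ^ 2 ≠ ⊤ :=
    ENNReal.add_ne_top.2 ⟨ENNReal.pow_ne_top hR1.2.ne, ENNReal.pow_ne_top hR2.2.ne⟩
  rw [hlim, e1, e2, e3] at hIle
  simp only [ENNReal.ofReal_one, mul_one] at p1 hIle
  have hneg : ∫⁻ x, ENNReal.ofReal (picone δ ε (u x) (v x) (φ x)) * ENNReal.ofReal (-1)
      ∂(μ.restrict Ω) = 0 := by
    simp [ENNReal.ofReal_of_nonpos]
  rw [hneg, ENNReal.toReal_zero, sub_zero] at hIle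
  rw [← ENNReal.toReal_le_toReal (by finiteness) (by finiteness),
    ENNReal.toReal_add (by finiteness) (by finiteness), ENNReal.toReal_add (by finiteness)
      (by finiteness), ENNReal.toReal_add (by finiteness) (by finiteness),
    ENNReal.toReal_add hR (by finiteness)]
  linarith

end FixedTruncation

/-! ### Second limit: the truncations are removed. -/

theorem liminf_add_liminf_le (a b : ℕ → ℝ≥0∞) :
    liminf a atTop + liminf b atTop ≤ liminf (fun j => a j + b j) atTop := by
  simp only [liminf_eq_iSup_iInf_of_nat]
  rw [ENNReal.iSup_add_iSup_of_monotone]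
  · exact iSup_mono fun i => le_iInf₂ fun j hj => add_le_add (iInf₂_le j hj) (iInf₂_le j hj)
  all_goals exact fun i j hij => biInf_mono fun k hk => hij.trans hk

section Limit

variable {δ : ℕ → ℝ} {u v : E n → ℝ} {φ : ℕ → E n → ℝ}

theorem ofReal_picone_le_quot {δ ε : ℝ} (hδ : 0 < δ) (hε : 0 < ε) {x : E n} (hu : 0 ≤ u x)
    (c : ℝ) : ENNReal.ofReal (picone δ ε (u x) (v x) c) ≤ quot u v x := by
  rw [picone, ENNReal.ofReal_div_of_pos (shift_pos hε _), quot,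
    shift_of_le hε (by linarith)]
  refine ENNReal.div_le_div (ENNReal.ofReal_le_ofReal ?_) (ENNReal.ofReal_le_ofReal (by linarith))
  exact sq_le_sq.2 (abs_cut_le_fst hδ _ _)

/-- Where `v = 0` the cut-off is identically zero, matching `0 / 0 = 0`. Elsewhere the numerator has
a nonzero limit, so division in `[0, ∞]` is continuous even at `u = 0`, where the limit is `∞`. -/
theorem tendsto_ofReal_picone (hδ : ∀ j, 0 < δ j) (h0 : Tendsto δ atTop (𝓝 0)) {x : E n}
    (hu : 0 ≤ u x) (hφ : Tendsto (fun j => φ j x) atTop (𝓝 (v x))) :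
    Tendsto (fun j => ENNReal.ofReal (picone (δ j) (δ j) (u x) (v x) (φ j x))) atTop
      (𝓝 (quot u v x)) := by
  have e : ∀ j, ENNReal.ofReal (picone (δ j) (δ j) (u x) (v x) (φ j x)) =
      ENNReal.ofReal (cut (δ j) (v x) (φ j x) ^ 2) / ENNReal.ofReal (δ j + u x) := fun j => by
    rw [picone, ENNReal.ofReal_div_of_pos (shift_pos (hδ j) _),
      shift_of_le (hδ j) (by linarith [hδ j])]
  simp only [e, quot]
  by_cases hv : v x = 0
  · simp [hv, cut]
  · refine ENNReal.Tendsto.div (ENNReal.tendsto_ofReal ((tendsto_cut h0 hφ).pow 2)) (Or.inl ?_)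
      (ENNReal.tendsto_ofReal (by simpa using h0.add_const (u x))) (Or.inl ENNReal.ofReal_ne_top)
    simpa using hv

theorem lintegral_picone_mul_le {ν : Measure (E n)} {δ ε : ℝ} (hδ : 0 < δ) (hε : 0 < ε)
    (hu : ∀ᵐ x ∂ν, 0 ≤ u x) (c : E n → ℝ) (G : E n → ℝ≥0∞) :
    ∫⁻ x, ENNReal.ofReal (picone δ ε (u x) (v x) (c x)) * G x ∂ν ≤
      ∫⁻ x, quot u v x * G x ∂ν := by
  refine lintegral_mono_ae ?_
  filter_upwards [hu] with x hx
  gcongr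
  exact ofReal_picone_le_quot hδ hε hx _

theorem lintegral_quot_le_liminf {ν : Measure (E n)} (hδ : ∀ j, 0 < δ j)
    (h0 : Tendsto δ atTop (𝓝 0)) (hum : AEStronglyMeasurable u ν)
    (hφm : ∀ j, AEStronglyMeasurable (φ j) ν) (hu : ∀ᵐ x ∂ν, 0 ≤ u x)
    (hφ : ∀ᵐ x ∂ν, Tendsto (fun j => φ j x) atTop (𝓝 (v x))) {G : E n → ℝ≥0∞}
    (hG : AEMeasurable G ν) (hGt : ∀ x, G x ≠ ⊤) :
    ∫⁻ x, quot u v x * G x ∂ν ≤ liminf (fun j =>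
      ∫⁻ x, ENNReal.ofReal (picone (δ j) (δ j) (u x) (v x) (φ j x)) * G x ∂ν) atTop := by
  have hvm : AEStronglyMeasurable v ν := aestronglyMeasurable_of_tendsto_ae atTop hφm hφ
  refine le_trans (lintegral_mono_ae ?_) (lintegral_liminf_le' fun j =>
    (aestronglyMeasurable_picone (hδ j) (hδ j) hum hvm (hφm j)).aemeasurable.ennreal_ofReal.mul hG)
  filter_upwards [hu, hφ] with x hx hx'
  exact (ENNReal.Tendsto.mul_const (tendsto_ofReal_picone hδ h0 hx hx')
    (Or.inr (hGt x))).liminf_eq.ge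

/-- The gradient is rewritten as `(cutFst + cutSnd) ∇v + cutSnd (∇φ - ∇v)`. The first coefficient
tends to the indicator of `{v ≠ 0}`, and since only an upper bound is wanted, nothing need be known
about `∇v` on `{v = 0}`. -/
theorem exists_eLpNorm_cutGrad_le {D : Set (E n)} (hδ : ∀ j, 0 < δ j)
    (h0 : Tendsto δ atTop (𝓝 0)) (hφt : ∀ j, IsTest D (φ j))
    (hφg : Tendsto (fun k => eLpNorm (gradient (φ k) - wgrad v) 2 volume) atTop (𝓝 0))
    (hφ : ∀ᵐ x, Tendsto (fun k => φ k x) atTop (𝓝 (v x)))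
    (hvm : AEStronglyMeasurable v volume) (hv : MemLp (wgrad v) 2 volume) :
    ∃ a : ℕ → ℝ≥0∞, Tendsto a atTop (𝓝 0) ∧
      ∀ j, eLpNorm (cutGrad (δ j) v (φ j)) 2 volume ≤ a j + eLpNorm (wgrad v) 2 volume := by
  have hφm : ∀ j, AEStronglyMeasurable (φ j) volume := fun j =>
    (hφt j).continuous.aestronglyMeasurable
  set c : ℕ → E n → ℝ := fun j x => cutFst (δ j) (v x) (φ j x) + cutSnd (δ j) (v x) (φ j x) with hc
  set c' : E n → ℝ := fun x => if v x = 0 then 0 else 1 with hc'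
  have m2 : ∀ j, AEStronglyMeasurable (fun x => cutSnd (δ j) (v x) (φ j x)) volume := fun j =>
    aestronglyMeasurable_comp_prod (continuous_cutSnd (hδ j)) hvm (hφm j)
  have mc : ∀ j, AEStronglyMeasurable (c j) volume := fun j =>
    (aestronglyMeasurable_comp_prod (continuous_cutFst (hδ j)) hvm (hφm j)).add (m2 j)
  have lc : ∀ᵐ x, Tendsto (fun j => c j x) atTop (𝓝 (c' x)) := hφ.mono fun x hx =>
    tendsto_cutFst_add_cutSnd h0 hx
  have mc' : AEStronglyMeasurable c' volume := aestronglyMeasurable_of_tendsto_ae atTop mc lc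
  have t1 := tendsto_eLpNorm_smul_sub (c := c) (c' := c') (L := 8) mc mc'
    (fun j x => (abs_add_le _ _).trans (by
      linarith [abs_cutFst_le (hδ j) (v x) (φ j x), abs_cutSnd_le (hδ j) (v x) (φ j x)]))
    (fun x => by simp only [hc']; split_ifs <;> norm_num) lc (X := fun _ => wgrad v)
    (fun _ => hv.1) hv (by simp)
  have hgm : ∀ j, AEStronglyMeasurable (gradient (φ j)) volume := fun j =>
    ((hφt j).memLp_gradient 2).1
  have t2 : Tendsto (fun j => ENNReal.ofReal 4 * eLpNorm (gradient (φ j) - wgrad v) 2 volume)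
    atTop (𝓝 0) := tendsto_const_mul_zero hφg 4
  have t := t1.add t2
  rw [add_zero] at t
  refine ⟨_, t, fun j => ?_⟩
  have e : cutGrad (δ j) v (φ j) =
      ((fun x => c j x • wgrad v x) - fun x => c' x • wgrad v x) +
      (fun x => cutSnd (δ j) (v x) (φ j x) • (gradient (φ j) - wgrad v) x) +
      fun x => c' x • wgrad v x := by
    ext1 x
    simp only [cutGrad, hc, Pi.add_apply, Pi.sub_apply, add_smul, smul_sub]
    abel
  have n1 : AEStronglyMeasurable ((fun x => c j x • wgrad v x) - fun x => c' x • wgrad v x)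
    volume := ((mc j).smul hv.1).sub (mc'.smul hv.1)
  have n2 : AEStronglyMeasurable
      (fun x => cutSnd (δ j) (v x) (φ j x) • (gradient (φ j) - wgrad v) x) volume :=
    (m2 j).smul ((hgm j).sub hv.1)
  rw [e]
  have b2 : eLpNorm (fun x => cutSnd (δ j) (v x) (φ j x) • (gradient (φ j) - wgrad v) x) 2 volume ≤
      ENNReal.ofReal 4 * eLpNorm (gradient (φ j) - wgrad v) 2 volume := by
    refine eLpNorm_le_mul_eLpNorm_of_ae_le_mul (Eventually.of_forall fun x => ?_) 2
    rw [norm_smul]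
    exact mul_le_mul_of_nonneg_right (abs_cutSnd_le (hδ j) _ _) (norm_nonneg _)
  have b3 : eLpNorm (fun x => c' x • wgrad v x) 2 volume ≤ eLpNorm (wgrad v) 2 volume := by
    refine eLpNorm_mono fun x => ?_
    simp only [hc']
    split_ifs <;> simp
  exact (eLpNorm_add_le (n1.add n2) (mc'.smul hv.1) (by norm_num)).trans (add_le_add
    ((eLpNorm_add_le n1 n2 (by norm_num)).trans (add_le_add le_rfl b2)) b3)

theorem exists_eLpNorm_dif_cut_le [NeZero n] {s : ℝ} (hs0 : 0 < s) (hs1 : s < 1)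
    {Ω D : Set (E n)} (hδ : ∀ j, 0 < δ j)
    (h0 : Tendsto δ atTop (𝓝 0)) (hφt : ∀ j, IsTest D (φ j))
    (hφd : Tendsto (fun k => eLpNorm (dif (φ k) - dif v) 2 (kern s Ω)) atTop (𝓝 0))
    (hφ : ∀ᵐ x, Tendsto (fun k => φ k x) atTop (𝓝 (v x)))
    (hvm : AEStronglyMeasurable v volume) (hv : MemLp (dif v) 2 (kern s Ω)) :
    ∃ b : ℕ → ℝ≥0∞, Tendsto b atTop (𝓝 0) ∧
      ∀ j, eLpNorm (dif fun x => cut (δ j) (v x) (φ j x)) 2 (kern s Ω) ≤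
        b j + eLpNorm (dif v) 2 (kern s Ω) := by
  have hd : ∀ j, MemLp (dif (φ j)) 2 (kern s Ω) := fun j => MemLp.dif_test hs0 hs1 Ω (hφt j)
  have hm : ∀ j, MemLp (dif fun x => cut (δ j) (v x) (φ j x)) 2 (kern s Ω) := fun j =>
    memLp_dif_cut hs0 hs1 (hδ j) hvm hv (hφt j)
  refine ⟨fun j => eLpNorm ((dif fun x => cut (δ j) (v x) (φ j x)) - dif v) 2 (kern s Ω), ?_,
    fun j => ?_⟩
  · refine tendsto_eLpNorm_two_of_dominated
      -- `9 = 4 + 4 + 1`: the Lipschitz bound in `v`, the one in `φ j` after comparison with `v`,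
      -- and the subtracted `dif v`.
      (r := fun j p => 4 * ‖(dif (φ j) - dif v) p‖) (q := fun p => 9 * ‖dif v p‖)
      (fun j => (hm j).1.sub hv.1) (hv.norm.const_mul 9) ?_
      (fun j => ((hd j).sub hv).1.norm.const_mul 4)
      (fun j => Eventually.of_forall fun p => ?_) ?_
    · refine tendsto_of_tendsto_of_tendsto_of_le_of_le tendsto_const_nhds
        (tendsto_const_mul_zero hφd 4) (fun _ => zero_le) fun j => ?_
      exact eLpNorm_le_mul_eLpNorm_of_ae_le_mul (Eventually.of_forall fun p => by
        rw [norm_mul, norm_norm]; norm_num) 2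
    · have h1 := abs_cut_sub_cut_le (hδ j) (v p.1) (φ j p.1) (v p.2) (φ j p.2)
      have h2 : |dif (φ j) p| ≤ |dif (φ j) p - dif v p| + |dif v p| := by
        have := abs_add_le (dif (φ j) p - dif v p) (dif v p); simpa using this
      rw [abs_of_nonneg (by positivity), abs_of_nonneg (by positivity)]
      refine (norm_sub_le _ _).trans ((add_le_add h1 le_rfl).trans ?_)
      change 4 * (|dif v p| + |dif (φ j) p|) + |dif v p| ≤
        4 * |dif (φ j) p - dif v p| + 9 * |dif v p|
      linarith
    · have hlim : ∀ᵐ x, Tendsto (fun j => cut (δ j) (v x) (φ j x)) atTop (𝓝 (v x)) :=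
        hφ.mono fun x hx => tendsto_cut h0 hx
      filter_upwards [ae_kern_of_ae hlim s Ω] with p hp
      have := (hp.1.sub hp.2).sub_const (v p.1 - v p.2)
      rw [sub_self] at this
      exact this
  · have := eLpNorm_add_le ((hm j).sub hv).1 hv.1 (by norm_num : (1 : ℝ≥0∞) ≤ 2)
    rwa [sub_add_cancel] at this

end Limit

/-- The Picone inequality with the negative parts of the boundary and exterior terms on the
right-hand side. -/
theorem lintegral_quot_le [NeZero n] {s : ℝ} (hs0 : 0 < s) (hs1 : s < 1)
    {Ω P₂ : Set (E n)} {m μ : Measure (E n)} [IsFiniteMeasure μ]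
    {u v g : E n → ℝ} {U V : ℕ → E n → ℝ} (hU : EnergyApprox s Ω (Ω ∪ P₂) m u U)
    (hV : EnergyApprox s Ω (Ω ∪ P₂) m v V)
    (hu : MemX s Ω (Ω ∪ P₂) u) (hv : MemX s Ω (Ω ∪ P₂) v)
    (hu0 : ∀ᵐ x, 0 ≤ u x) (hum : ∀ᵐ x ∂m, 0 ≤ u x)
    (hμm : μ.restrict Ω ≤ m) (hσm : surface Ω P₂ ≤ m)
    (hg : HasWeakNormalDeriv s Ω P₂ u μ g) :
    ∫⁻ x in Ω, quot u v x ∂μ + ∫⁻ x, quot u v x * ENNReal.ofReal (g x) ∂(surface Ω P₂) +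
      ∫⁻ x in P₂, quot u v x * ENNReal.ofReal (nonlocalNormal s Ω u x) ≤
    scalarSq s Ω v + ∫⁻ x, quot u v x * ENNReal.ofReal (-g x) ∂(surface Ω P₂) +
      ∫⁻ x in P₂, quot u v x * ENNReal.ofReal (-nonlocalNormal s Ω u x) := by
  -- One sequence serves for both regularizations, and the approximations `V j` of `v` serve also as
  -- the cut-off functions `φ`.
  set δ : ℕ → ℝ := fun j => 1 / ((j : ℝ) + 1)
  have hδ : ∀ j, 0 < δ j := fun j => Nat.one_div_pos_of_nat
  have h0 : Tendsto δ atTop (𝓝 0) := tendsto_one_div_add_atTop_nhds_zero_nat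
  have hUm : ∀ (ν : Measure (E n)) k, AEStronglyMeasurable (U k) ν := fun ν k =>
    (hU.test k).continuous.aestronglyMeasurable
  have hVm : ∀ (ν : Measure (E n)) k, AEStronglyMeasurable (V k) ν := fun ν k =>
    (hV.test k).continuous.aestronglyMeasurable
  have hN : AEMeasurable (nonlocalNormal s Ω u) (volume.restrict P₂) :=
    (aestronglyMeasurable_nonlocalNormal s Ω hu.1.1).restrict.aemeasurable
  have fatou : ∀ ν : Measure (E n), ν ≪ m → ∀ G : E n → ℝ≥0∞, AEMeasurable G ν →
      (∀ x, G x ≠ ⊤) → ∫⁻ x, quot u v x * G x ∂ν ≤ liminf (fun j =>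
        ∫⁻ x, ENNReal.ofReal (picone (δ j) (δ j) (u x) (v x) (V j x)) * G x ∂ν) atTop :=
    fun ν hν G hG hGt => lintegral_quot_le_liminf hδ h0
      (aestronglyMeasurable_of_tendsto_ae atTop (hUm ν) (hν.ae_le hU.ae')) (hVm ν)
      (hν.ae_le hum) (hν.ae_le hV.ae') hG hGt
  have f1 := fatou _ (Measure.absolutelyContinuous_of_le hμm) (fun _ => 1) aemeasurable_const
    (by simp)
  have f2 := fatou _ (Measure.absolutelyContinuous_of_le hσm) (fun x => ENNReal.ofReal (g x))
    hg.1.aemeasurable.ennreal_ofReal (by simp)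
  have f3 := lintegral_quot_le_liminf hδ h0 hu.1.1.restrict (hVm _)
    (ae_restrict_of_ae (s := P₂) hu0) (ae_restrict_of_ae hV.ae) hN.ennreal_ofReal (by simp)
  simp only [mul_one] at f1
  obtain ⟨a, ha, hac⟩ := exists_eLpNorm_cutGrad_le hδ h0 hV.test hV.grad hV.ae hv.1.1
    hv.memLp_wgrad
  obtain ⟨b, hb, hbc⟩ := exists_eLpNorm_dif_cut_le hs0 hs1 hδ h0 hV.test hV.dif hV.ae hv.1.1
    (hv.memLp_dif hs0 hs1)
  set N₁ := ∫⁻ x, quot u v x * ENNReal.ofReal (-g x) ∂(surface Ω P₂)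
  set N₂ := ∫⁻ x in P₂, quot u v x * ENNReal.ofReal (-nonlocalNormal s Ω u x)
  set R : ℕ → ℝ≥0∞ := fun j => (a j + eLpNorm (wgrad v) 2 volume) ^ 2 +
    (b j + eLpNorm (dif v) 2 (kern s Ω)) ^ 2 + N₁ + N₂ with hR
  have hRlim : Tendsto R atTop (𝓝 (scalarSq s Ω v + N₁ + N₂)) := by
    rw [scalarSq_eq]
    have h1 := ((ENNReal.continuous_pow 2).tendsto _).comp
      (ha.add_const (eLpNorm (wgrad v) 2 volume))
    have h2 := ((ENNReal.continuous_pow 2).tendsto _).comp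
      (hb.add_const (eLpNorm (dif v) 2 (kern s Ω)))
    rw [zero_add] at h1 h2
    exact ((h1.add h2).add_const N₁).add_const N₂
  -- Left-hand terms pass to the limit by Fatou and superadditivity of `liminf`. On the right, the
  -- negative parts are bounded for each `j` and only the energy converges.
  refine (add_le_add (add_le_add f1 f2) f3).trans ((add_le_add (liminf_add_liminf_le _ _)
    le_rfl).trans ((liminf_add_liminf_le _ _).trans ?_))
  rw [← hRlim.liminf_eq]
  refine liminf_le_liminf (Eventually.of_forall fun j => ?_)
  refine (lintegral_picone_le hs0 hs1 hU hV (hV.test j) hu hv hu0 hμm hσm hg (hδ j)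
    (hδ j)).trans ?_
  have q1 := lintegral_picone_mul_le (v := v) (hδ j) (hδ j)
    ((Measure.absolutelyContinuous_of_le hσm).ae_le hum) (V j) fun x => ENNReal.ofReal (-g x)
  have q2 := lintegral_picone_mul_le (v := v) (hδ j) (hδ j)
    (ae_restrict_of_ae (s := P₂) hu0) (V j) fun x => ENNReal.ofReal (-nonlocalNormal s Ω u x)
  exact add_le_add (add_le_add (add_le_add (pow_le_pow_left' (hac j) 2)
    (pow_le_pow_left' (hbc j) 2)) q1) q2

/-! ### Conclusion. -/

/-- Passage from positive and negative parts to extended integrals. -/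
theorem extIntegral_add_le {A P₁ P₂ N₁ N₂ S : ℝ≥0∞} (h : A + P₁ + P₂ ≤ S + N₁ + N₂) :
    ((P₁ : EReal) - N₁) + ((P₂ : EReal) - N₂) + (A : EReal) ≤ (S : EReal) := by
  -- In `EReal`, `⊥` absorbs every summand, including `⊤`. An infinite negative part thus makes the
  -- left side `⊥`; otherwise it can be moved across.
  by_cases h1 : N₁ = ⊤
  · simp [h1]
  by_cases h2 : N₂ = ⊤
  · simp [h2]
  have h3 : ((A : EReal) + P₁ + P₂) ≤ (S : EReal) + N₁ + N₂ := by exact_mod_cast h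
  lift N₁ to NNReal using h1
  lift N₂ to NNReal using h2
  have e : ((P₁ : EReal) - (N₁ : ℝ≥0∞)) + ((P₂ : EReal) - (N₂ : ℝ≥0∞)) + (A : EReal) =
      ((A : EReal) + P₁ + P₂) - (N₂ : ℝ≥0∞) - (N₁ : ℝ≥0∞) := by
    simp only [sub_eq_add_neg]
    ac_rfl
  rw [e]
  exact EReal.sub_le_of_le_add (EReal.sub_le_of_le_add h3)

/-- A single measure, `μ` on `Ω` plus surface measure on the whole boundary, is used for the
approximation, so that one sequence converges almost everywhere for both. It is carried by the
compact closure of `Ω`. -/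
theorem picone_inequality [NeZero n] (hn : 2 < n) {s : ℝ} (hs0 : 0 < s) (hs1 : s < 1)
    {Ω P₂ : Set (E n)} (hΩo : IsOpen Ω) (hΩb : Bornology.IsBounded Ω) (hΩs : HasSmoothBoundary Ω)
    {u v : E n → ℝ} (hu : MemX s Ω (Ω ∪ P₂) u) (hv : MemX s Ω (Ω ∪ P₂) v)
    (huq : IsQuasicontinuous u) (hvq : IsQuasicontinuous v) (hu0 : ∀ᵐ x, 0 ≤ u x)
    {μ : Measure (E n)} [IsFiniteMeasure μ] (hLu : OperatorEqMeasure s Ω u μ)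
    {g : E n → ℝ} (hg : HasWeakNormalDeriv s Ω P₂ u μ g) :
    extIntegral (surface Ω P₂) (quot u v) g +
        extIntegral (volume.restrict P₂) (quot u v) (nonlocalNormal s Ω u) +
        ((∫⁻ x in Ω, quot u v x ∂μ : ℝ≥0∞) : EReal) ≤ ((scalarSq s Ω v : ℝ≥0∞) : EReal) := by
  set σ : Measure (E n) := (Measure.euclideanHausdorffMeasure (n - 1)).restrict (frontier Ω)
  have hσ : CapControlled σ := by
    obtain ⟨m, rfl⟩ : ∃ m, n = m + 1 := ⟨n - 1, by omega⟩
    exact capControlled_surface hΩo hΩb hΩs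
  have hm : CapControlled (μ.restrict Ω + σ) :=
    (capControlled_of_operatorEqMeasure hs0 hs1 hΩo hu.memLp_wgrad (hu.memLp_dif hs0 hs1)
      hLu).add hσ
  have hK : IsCompact (closure Ω) := hΩb.isCompact_closure
  have hmK : (μ.restrict Ω + σ) (closure Ω)ᶜ = 0 := by
    have hmeas : MeasurableSet (closure Ω)ᶜ := isClosed_closure.measurableSet.compl
    rw [Measure.add_apply, Measure.restrict_apply hmeas, Measure.restrict_apply hmeas]
    have h1 : (closure Ω)ᶜ ∩ Ω = ∅ := by
      ext x; simp only [Set.mem_inter_iff, Set.mem_compl_iff, Set.mem_empty_iff_false, iff_false]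
      exact fun h => h.1 (subset_closure h.2)
    have h2 : (closure Ω)ᶜ ∩ frontier Ω = ∅ := by
      ext x; simp only [Set.mem_inter_iff, Set.mem_compl_iff, Set.mem_empty_iff_false, iff_false]
      exact fun h => h.1 (frontier_subset_closure h.2)
    simp [h1, h2]
  obtain ⟨U, hU⟩ := hu.exists_energyApprox hn huq hm hK hmK
  obtain ⟨V, hV⟩ := hv.exists_energyApprox hn hvq hm hK hmK
  refine extIntegral_add_le (lintegral_quot_le hs0 hs1 hU hV hu hv hu0 (hm.ae_nonneg huq hu0)
    (Measure.le_add_right le_rfl) ?_ hg)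
  exact (Measure.restrict_mono Set.inter_subset_left le_rfl).trans (Measure.le_add_left le_rfl)

end MixedPicone

end

theorem theorem2p12 (n : ℕ) [NeZero n] (hn : 2 < n) (s : ℝ) (hs0 : 0 < s) (hs1 : s < 1)
    (Ω P₁ P₂ : Set (MixedPicone.E n))
    (hΩo : IsOpen Ω) (hΩc : IsConnected Ω) (hΩb : Bornology.IsBounded Ω)
    (hΩs : MixedPicone.HasSmoothBoundary Ω)
    (hP₁ : MixedPicone.IsRelOpenOutside Ω P₁) (hP₂ : MixedPicone.IsRelOpenOutside Ω P₂)
    (hdisj : Disjoint P₁ P₂) (hcover : closure P₁ ∪ closure P₂ = Ωᶜ)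
    (u v : MixedPicone.E n → ℝ)
    (hu : MixedPicone.MemX s Ω (Ω ∪ P₂) u) (hv : MixedPicone.MemX s Ω (Ω ∪ P₂) v)
    (huq : MixedPicone.IsQuasicontinuous u) (hvq : MixedPicone.IsQuasicontinuous v)
    (hu0 : ∀ᵐ x ∂(volume : Measure (MixedPicone.E n)), 0 ≤ u x)
    (hune : ¬ ∀ᵐ x ∂(volume : Measure (MixedPicone.E n)), u x = 0)
    (μ : Measure (MixedPicone.E n)) [IsFiniteMeasure μ]
    (hLu : MixedPicone.OperatorEqMeasure s Ω u μ)
    (g : MixedPicone.E n → ℝ) (hg : MixedPicone.HasWeakNormalDeriv s Ω P₂ u μ g) :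
    MixedPicone.extIntegral (MixedPicone.surface Ω P₂) (MixedPicone.quot u v) g +
        MixedPicone.extIntegral (volume.restrict P₂) (MixedPicone.quot u v)
          (MixedPicone.nonlocalNormal s Ω u) +
        ((∫⁻ x in Ω, MixedPicone.quot u v x ∂μ : ℝ≥0∞) : EReal) ≤
      ((MixedPicone.scalarSq s Ω v : ℝ≥0∞) : EReal) ∧
    MixedPicone.extIntegral (MixedPicone.surface Ω P₂) (MixedPicone.quot u v) g +
        MixedPicone.extIntegral (volume.restrict P₂) (MixedPicone.quot u v)
          (MixedPicone.nonlocalNormal s Ω u) +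
        ((∫⁻ x in Ω, MixedPicone.quot u v x ∂μ : ℝ≥0∞) : EReal) ≤
      ((MixedPicone.etaSq s Ω v : ℝ≥0∞) : EReal) := by
  have h := MixedPicone.picone_inequality hn hs0 hs1 hΩo hΩb hΩs hu hv huq hvq hu0 hLu hg
  exact ⟨h, h.trans (EReal.coe_ennreal_le_coe_ennreal_iff.2 (MixedPicone.scalarSq_le_etaSq s Ω v))⟩
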